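/- Let $\mathbb H$ be the real quaternions, $\eta\in\{\mathbf i,\mathbf j,\mathbf k\}$. For a quaternion matrix $A$ let $A^*$ be its conjugate transpose, $A^{\eta^*}=-\eta A^*\eta$, $A^\dagger$ its Moore–Penrose inverse, $L_A=I-A^\dagger A$, $R_A=I-AA^\dagger$, and $r(A)$ its rank (the dimension of the right column space). $A$ is $\eta$-Hermitian if $A=A^{\eta^*}$; $L_A^{\eta^*}$ means $(L_A)^{\eta^*}$. Let $A_i,C_i\in\mathbb H^{m_i\times n_i}$, $E_i\in\mathbb H^{p\times n_i}$ $(i=1,2,3)$ and $C=C^{\eta^*}\in\mathbb H^{p\times p}$ be given, and consider the system $$A_1X=C_1,\quad A_2Y=C_2,\quad A_3Z=C_3,\quad X=X^{\eta^*},\ Y=Y^{\eta^*},\ Z=Z^{\eta^*},$$ $$E_1XE_1^{\eta^*}+E_2YE_2^{\eta^*}+E_3ZE_3^{\eta^*}=C .\qquad (\ast)$$ Set $$\begin{aligned} &A_{ii}=E_iL_{A_i}\ (i=1,2,3),\quad M_1=R_{A_{11}}A_{22},\quad S_1=A_{22}L_{M_1},\quad G=R_{M_1}R_{A_{11}},\\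 &T_1=C-\sum_{i=1}^3E_i\bigl(A_i^\dagger C_i+L_{A_i}C_i^{\eta^*}(A_i^{\eta^*})^\dagger\bigr)E_i^{\eta^*},\\ &G_1=GA_{33},\quad G_2=R_{A_{11}}A_{33},\quad G_3=R_{A_{22}}A_{33},\quad G_4=A_{33},\\ &L_1=GT_1,\quad L_2=R_{A_{11}}T_1(R_{A_{22}})^{\eta^*},\quad L_3=R_{A_{22}}T_1(R_{A_{11}})^{\eta^*},\quad L_4=T_1G^{\eta^*},\\ &C_{11}=(L_{G_2},\ L_{G_4}),\quad C_{22}=L_{G_1},\quad C_{33}=L_{G_3},\quad E_{11}=R_{C_{11}}C_{22},\quad E_{22}=R_{C_{11}}C_{33},\\ &M=R_{E_{11}}E_{22},\quad N=(R_{E_{22}}E_{11})^{\eta^*},\quad S=E_{22}L_M,\\ &F_1=G_1^\dagger L_1(G_4^{\eta^*})^\dagger+L_{G_1}G_2^\dagger L_2(G_3^{\eta^*})^\dagger,\quad F_2=G_3^\dagger L_3(G_2^{\eta^*})^\dagger+L_{G_3}G_4^\dagger L_4(G_1^{\eta^*})^\dagger,\\ &F=F_2-F_1,\quad E=R_{C_{11}}F(R_{C_{11}})^{\eta^*}.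 \end{aligned}$$ Then the following are equivalent. (1) The system $(\ast)$ has a solution $(X,Y,Z)$. (2) $A_jC_j^{\eta^*}=C_jA_j^{\eta^*}$ and $R_{A_j}C_j=0$ for $j=1,2,3$, $R_{G_i}L_i=0$ for $i=1,2,3,4$, and $R_{E_{22}}E(R_{E_{22}})^{\eta^*}=0$. (3) $A_jC_j^{\eta^*}=C_jA_j^{\eta^*}$ and $r(A_j,\ C_j)=r(A_j)$ for $j=1,2,3$, and $$r\begin{pmatrix}C&E_3&E_1&E_2\\C_3E_3^{\eta^*}&A_3&0&0\\C_1E_1^{\eta^*}&0&A_1&0\\C_2E_2^{\eta^*}&0&0&A_2\end{pmatrix}=r\begin{pmatrix}E_3&E_1&E_2\\A_3&0&0\\0&A_1&0\\0&0&A_2\end{pmatrix},$$ $$r\begin{pmatrix}C&E_3&E_1&E_2C_2^{\eta^*}\\E_2^{\eta^*}&0&0&A_2^{\eta^*}\\C_3E_3^{\eta^*}&A_3&0&0\\C_1E_1^{\eta^*}&0&A_1&0\end{pmatrix}=r\begin{pmatrix}E_3&E_1\\A_3&0\\0&A_1\end{pmatrix}+r\begin{pmatrix}E_2\\A_2\end{pmatrix},$$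 $$r\begin{pmatrix}C&E_3&E_2&E_1C_1^{\eta^*}\\E_1^{\eta^*}&0&0&A_1^{\eta^*}\\C_3E_3^{\eta^*}&A_3&0&0\\C_2E_2^{\eta^*}&0&A_2&0\end{pmatrix}=r\begin{pmatrix}E_3&E_2\\A_3&0\\0&A_2\end{pmatrix}+r\begin{pmatrix}E_1\\A_1\end{pmatrix},$$ $$r\begin{pmatrix}C&E_3&E_1C_1^{\eta^*}&E_2C_2^{\eta^*}\\E_1^{\eta^*}&0&A_1^{\eta^*}&0\\E_2^{\eta^*}&0&0&A_2^{\eta^*}\\C_3E_3^{\eta^*}&A_3&0&0\end{pmatrix}=r\begin{pmatrix}E_1&E_2\\A_1&0\\0&A_2\end{pmatrix}+r\begin{pmatrix}E_3\\A_3\end{pmatrix},$$ $$r\begin{pmatrix} C&0&E_1&0&E_3&E_2C_2^{\eta^*}&0&E_3C_3^{\eta^*}\\ 0&-C&0&E_2&E_3&0&-E_1C_1^{\eta^*}&0\\ E_2^{\eta^*}&0&0&0&0&A_2^{\eta^*}&0&0\\ 0&E_1^{\eta^*}&0&0&0&0&A_1^{\eta^*}&0\\ E_3^{\eta^*}&E_3^{\eta^*}&0&0&0&0&0&A_3^{\eta^*}\\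 C_1E_1^{\eta^*}&0&A_1&0&0&0&0&0\\ 0&-C_2E_2^{\eta^*}&0&A_2&0&0&0&0\\ 0&-C_3E_3^{\eta^*}&0&0&A_3&0&0&0 \end{pmatrix}=2\,r\begin{pmatrix}E_1&0&E_3\\0&E_2&E_3\\A_1&0&0\\0&A_2&0\\0&0&A_3\end{pmatrix}.$$ If these conditions hold, then the general solution of $(\ast)$ is $$X=\tfrac12(\tilde X+\tilde X^{\eta^*}),\quad Y=\tfrac12(\tilde Y+\tilde Y^{\eta^*}),\quad Z=\tfrac12(\tilde Z+\tilde Z^{\eta^*}),$$ $$\begin{aligned} \tilde X&=A_1^\dagger C_1+L_{A_1}C_1^{\eta^*}(A_1^{\eta^*})^\dagger+L_{A_1}U_1L_{A_1}^{\eta^*},\\ \tilde Y&=A_2^\dagger C_2+L_{A_2}C_2^{\eta^*}(A_2^{\eta^*})^\dagger+L_{A_2}U_2L_{A_2}^{\eta^*},\\ \tilde Z&=A_3^\dagger C_3+L_{A_3}C_3^{\eta^*}(A_3^{\eta^*})^\dagger+L_{A_3}U_3L_{A_3}^{\eta^*}, \end{aligned}$$ where $$\begin{aligned} U_1={}&A_{11}^\dagger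 T(A_{11}^\dagger)^{\eta^*}-A_{11}^\dagger A_{22}M_1^\dagger T(A_{11}^\dagger)^{\eta^*}-A_{11}^\dagger S_1A_{22}^\dagger T(M_1^\dagger)^{\eta^*}A_{22}^{\eta^*}(A_{11}^\dagger)^{\eta^*}\\ &-A_{11}^\dagger S_1U_4R_{M_1^{\eta^*}}A_{22}^{\eta^*}(A_{11}^\dagger)^{\eta^*}+L_{A_{11}}U_5+U_6R_{A_{11}^{\eta^*}},\\ U_2={}&M_1^\dagger T(A_{22}^\dagger)^{\eta^*}+S_1^\dagger S_1A_{22}^\dagger T(M_1^\dagger)^{\eta^*}+L_{M_1}L_{S_1}U_7+U_8R_{A_{22}^{\eta^*}}+L_{M_1}U_4R_{M_1^{\eta^*}},\\ T={}&T_1-A_{33}U_3A_{33}^{\eta^*}, \end{aligned}$$ and $U_3$ is given by either one of the two expressions (each of which yields the general solution) $$U_3=F_1+L_{G_2}V_1+V_2R_{G_4^{\eta^*}}+L_{G_1}V_3R_{G_3^{\eta^*}}\quad\text{or}\quad U_3=F_2-L_{G_4}W_1-W_2R_{G_2^{\eta^*}}-L_{G_3}W_3R_{G_1^{\eta^*}},$$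 with, writing $Q=F-C_{22}V_3C_{33}^{\eta^*}-C_{33}W_3C_{22}^{\eta^*}$ and $I=I_{n_3}$, $$\begin{aligned} V_1&=(I,\ 0)\,C_{11}^\dagger Q-(I,\ 0)\bigl[C_{11}^\dagger U_{11}C_{11}^{\eta^*}+L_{C_{11}}U_{12}\bigr],\\ W_1&=(0,\ I)\,C_{11}^\dagger Q-(0,\ I)\bigl[C_{11}^\dagger U_{11}C_{11}^{\eta^*}+L_{C_{11}}U_{12}\bigr],\\ W_2&=R_{C_{11}}Q(C_{11}^{\eta^*})^\dagger\begin{pmatrix}I\\0\end{pmatrix}+\bigl[C_{11}C_{11}^\dagger U_{11}+U_{21}L_{C_{11}}^{\eta^*}\bigr]\begin{pmatrix}I\\0\end{pmatrix},\\ V_2&=R_{C_{11}}Q(C_{11}^{\eta^*})^\dagger\begin{pmatrix}0\\I\end{pmatrix}+\bigl[C_{11}C_{11}^\dagger U_{11}+U_{21}L_{C_{11}}^{\eta^*}\bigr]\begin{pmatrix}0\\I\end{pmatrix},\\ V_3&=E_{11}^\dagger F(E_{22}^{\eta^*})^\dagger-E_{11}^\dagger E_{22}M^\dagger F(E_{22}^{\eta^*})^\dagger-E_{11}^\dagger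 SE_{22}^\dagger FN^\dagger E_{11}^{\eta^*}(E_{22}^{\eta^*})^\dagger\\ &\quad-E_{11}^\dagger SU_{31}R_NE_{11}^{\eta^*}(E_{22}^{\eta^*})^\dagger+L_{E_{11}}U_{32}+U_{33}L_{E_{22}}^{\eta^*},\\ W_3&=M^\dagger F(E_{11}^{\eta^*})^\dagger+S^\dagger SE_{22}^\dagger FN^\dagger+L_ML_SU_{41}+L_MU_{31}R_N-U_{42}L_{E_{11}}^{\eta^*}, \end{aligned}$$ and $U_4,\dots,U_8,U_{11},U_{12},U_{21},U_{31},U_{32},U_{33},U_{41},U_{42}$ are arbitrary quaternion matrices of appropriate sizes. That is, $(X,Y,Z)$ solves $(\ast)$ if and only if it has this form for some choice of the arbitrary matrices. -/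

import Mathlib

open Quaternion Matrix
namespace QMat

/-- The four Penrose equations: `Y` is a Moore-Penrose inverse of the quaternion matrix `A`. -/
def IsMoorePenrose {m n : Type*} [Fintype m] [Fintype n]
    (A : Matrix m n ℍ[ℝ]) (Y : Matrix n m ℍ[ℝ]) : Prop :=
  A * Y * A = A ∧ Y * A * Y = Y ∧ (A * Y)ᴴ = A * Y ∧ (Y * A)ᴴ = Y * A

theorem eq_zero_of_conjTranspose_mul_self {m n : Type*} [Fintype m]
    (A : Matrix m n ℍ[ℝ]) (h : Aᴴ * A = 0) : A = 0 := by
  ext1 i j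
  have h1 : ∑ i, Quaternion.normSq (A i j) = 0 := by
    have h2 := congrArg (fun q : ℍ[ℝ] => q.re) (congrFun (congrFun h j) j)
    have h3 : ((Aᴴ * A) j j) = ∑ i, ((Quaternion.normSq (A i j) : ℝ) : ℍ[ℝ]) := by
      simp [Matrix.mul_apply, Quaternion.star_mul_self]
    have h4 : ((∑ i, Quaternion.normSq (A i j) : ℝ) : ℍ[ℝ])
        = ∑ i, ((Quaternion.normSq (A i j) : ℝ) : ℍ[ℝ]) :=
      map_sum (algebraMap ℝ ℍ[ℝ]) _ _
    simp only [h3, ← h4] at h2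
    simpa using h2
  have h3 := (Finset.sum_eq_zero_iff_of_nonneg
    (fun i _ => Quaternion.normSq_nonneg (a := A i j))).1 h1 i (Finset.mem_univ i)
  exact Quaternion.normSq_eq_zero.1 h3

theorem exists_inner_inverse {m n : Type*} [Fintype m] [Fintype n]
    (A : Matrix m n ℍ[ℝ]) : ∃ G : Matrix n m ℍ[ℝ], A * G * A = A := by
  classical
  let f := toLinearMapRight' A
  obtain ⟨g', hg'⟩ := f.rangeRestrict.exists_rightInverse_of_surjective f.range_rangeRestrict
  obtain ⟨g, hg⟩ := LinearMap.exists_extend g'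
  refine ⟨toLinearMapRight'.symm g, toLinearMapRight'.injective ?_⟩
  rw [toLinearMapRight'_mul, toLinearMapRight'_mul]
  simp only [LinearEquiv.apply_symm_apply]
  refine LinearMap.ext fun x => ?_
  have h1 : g (f x) = g' (f.rangeRestrict x) := by rw [← hg]; rfl
  have h2 := congrArg Subtype.val (LinearMap.congr_fun hg' (f.rangeRestrict x))
  show f (g (f x)) = f x
  rw [h1]
  exact h2

theorem mul_eq_self_of_conjTranspose_mul {m n : Type*} [Fintype m] [Fintype n]
    (A : Matrix m n ℍ[ℝ]) (G : Matrix n n ℍ[ℝ]) (hG : Aᴴ * A * G * (Aᴴ * A) = Aᴴ * A) :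
    A * (G * Aᴴ) * A = A := by
  classical
  rw [← sub_eq_zero]
  apply eq_zero_of_conjTranspose_mul_self
  have h0 : Aᴴ * (A * (G * Aᴴ) * A - A) = 0 := by
    rw [Matrix.mul_sub, sub_eq_zero]; simpa only [Matrix.mul_assoc] using hG
  have e : A * (G * Aᴴ) * A - A = A * (G * Aᴴ * A - 1) := by
    rw [Matrix.mul_sub, Matrix.mul_one]; simp only [Matrix.mul_assoc]
  conv_lhs => lhs; rw [e]
  rw [conjTranspose_mul, Matrix.mul_assoc, h0, Matrix.mul_zero]

/-- Every quaternion matrix has a Moore-Penrose inverse. -/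
theorem exists_isMoorePenrose {m n : Type*} [Fintype m] [Fintype n]
    (A : Matrix m n ℍ[ℝ]) : ∃ Y, IsMoorePenrose A Y := by
  obtain ⟨G, hG⟩ := exists_inner_inverse (Aᴴ * A)
  obtain ⟨H, hH⟩ := exists_inner_inverse (Aᴴᴴ * Aᴴ)
  have h1 := mul_eq_self_of_conjTranspose_mul A G hG
  have h2 := congrArg conjTranspose (mul_eq_self_of_conjTranspose_mul Aᴴ H hH)
  simp only [conjTranspose_mul, conjTranspose_conjTranspose] at h2
  obtain ⟨K, hK⟩ : ∃ K, Hᴴ = K := ⟨_, rfl⟩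
  rw [hK] at h2
  have hP : (A * (G * Aᴴ))ᴴ = A * (G * Aᴴ) := by
    have e := congrArg (fun X => A * G * X) (congrArg conjTranspose h1)
    simp only [conjTranspose_mul, conjTranspose_conjTranspose, Matrix.mul_assoc] at e
    have e2 : A * (G * Aᴴ) * (A * (G * Aᴴ))ᴴ = A * (G * Aᴴ) := by
      simpa only [conjTranspose_mul, conjTranspose_conjTranspose, Matrix.mul_assoc] using e
    rw [← e2, conjTranspose_mul, conjTranspose_conjTranspose]
  have hQ : (Aᴴ * K * A)ᴴ = Aᴴ * K * A := by
    have e := congrArg (fun X => X * K * A) (congrArg conjTranspose h2)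
    have e2 : (Aᴴ * K * A)ᴴ * (Aᴴ * K * A) = Aᴴ * K * A := by
      simpa only [conjTranspose_mul, conjTranspose_conjTranspose, Matrix.mul_assoc] using e
    rw [← e2, conjTranspose_mul, conjTranspose_conjTranspose]
  have h2' : ∀ X : Matrix n m ℍ[ℝ], A * (Aᴴ * (K * (A * X))) = A * X := by
    intro X
    have := congrArg (fun B => B * X) h2
    simpa only [Matrix.mul_assoc] using this
  have e1 : A * (Aᴴ * K * A * (G * Aᴴ)) = A * (G * Aᴴ) := by
    simp only [Matrix.mul_assoc, h2']
  have e2 : Aᴴ * K * A * (G * Aᴴ) * A = Aᴴ * K * A := by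
    simp only [Matrix.mul_assoc] at h1 ⊢
    rw [h1]
  refine ⟨Aᴴ * K * A * (G * Aᴴ), ?_, ?_, ?_, ?_⟩
  · rw [e1, h1]
  · rw [e2]; simp only [Matrix.mul_assoc, h2']
  · rw [e1, hP]
  · rw [e2, hQ]

/-- The Moore-Penrose inverse is unique. -/
theorem IsMoorePenrose.unique {m n : Type*} [Fintype m] [Fintype n] {A : Matrix m n ℍ[ℝ]}
    {Y Z : Matrix n m ℍ[ℝ]} (hY : IsMoorePenrose A Y) (hZ : IsMoorePenrose A Z) : Y = Z := by
  obtain ⟨y1, y2, y3, y4⟩ := hY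
  obtain ⟨z1, z2, z3, z4⟩ := hZ
  have a : A * Y = A * Z := by
    calc A * Y = (A * Z * A) * Y := by rw [z1]
      _ = (A * Z)ᴴ * (A * Y)ᴴ := by rw [z3, y3]; simp only [Matrix.mul_assoc]
      _ = ((A * Y * A) * Z)ᴴ := by rw [← conjTranspose_mul]; simp only [Matrix.mul_assoc]
      _ = A * Z := by rw [y1, z3]
  have b : Y * A = Z * A := by
    calc Y * A = Y * (A * Z * A) := by rw [z1]
      _ = (Y * A)ᴴ * (Z * A)ᴴ := by rw [z4, y4]; simp only [Matrix.mul_assoc]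
      _ = (Z * (A * Y * A))ᴴ := by rw [← conjTranspose_mul]; simp only [Matrix.mul_assoc]
      _ = Z * A := by rw [y1, z4]
  calc Y = Y * A * Y := y2.symm
    _ = Z * A * Z := by rw [b, Matrix.mul_assoc, a, Matrix.mul_assoc]
    _ = Z := z2

/-- The Moore-Penrose inverse `A†`. -/
noncomputable def pinv {m n : Type*} [Fintype m] [Fintype n] (A : Matrix m n ℍ[ℝ]) :
    Matrix n m ℍ[ℝ] :=
  (exists_isMoorePenrose A).choose

/-- `L_A = I - A† A`. -/
noncomputable def projL {m n : Type*} [Fintype m] [Fintype n] [DecidableEq n]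
    (A : Matrix m n ℍ[ℝ]) : Matrix n n ℍ[ℝ] :=
  1 - pinv A * A

/-- `R_A = I - A A†`. -/
noncomputable def projR {m n : Type*} [Fintype m] [Fintype n] [DecidableEq m]
    (A : Matrix m n ℍ[ℝ]) : Matrix m m ℍ[ℝ] :=
  1 - A * pinv A

/-- The rank `r(A)`: the dimension of the right column space, where columns are vectors over `ℍ`
with scalars acting by multiplication from the right. -/
noncomputable def qrank {m n : Type*} (A : Matrix m n ℍ[ℝ]) : ℕ :=
  Module.finrank ℍ[ℝ]ᵐᵒᵖ (Submodule.span ℍ[ℝ]ᵐᵒᵖ (Set.range A.col))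

/-- `η ∈ {i, j, k}`. -/
def IsBasicUnit (η : ℍ[ℝ]) : Prop :=
  η = ⟨0, 1, 0, 0⟩ ∨ η = ⟨0, 0, 1, 0⟩ ∨ η = ⟨0, 0, 0, 1⟩

/-- `A^{η*} = -η A* η`, where `A*` is the conjugate transpose. -/
noncomputable def etaStar {m n : Type*} (η : ℍ[ℝ]) (A : Matrix m n ℍ[ℝ]) : Matrix n m ℍ[ℝ] :=
  Aᴴ.map fun q => -η * q * η

/-- `A` is `η`-Hermitian: `A = A^{η*}`. -/
def IsEtaHermitian {m : Type*} (η : ℍ[ℝ]) (A : Matrix m m ℍ[ℝ]) : Prop :=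
  A = etaStar η A

end QMat

/-! Block matrices: `A ⊕ᶜ B = (A, B)` (side by side), `A ⊕ʳ B` (`A` on top of `B`).
Side-by-side composition binds more tightly. -/
infixr:66 " ⊕ᶜ " => Matrix.fromCols
infixr:65 " ⊕ʳ " => Matrix.fromRows

/-- The data of the system `A₁X = C₁`, `A₂Y = C₂`, `A₃Z = C₃`,
`E₁XE₁^{η*} + E₂YE₂^{η*} + E₃ZE₃^{η*} = C` with `X, Y, Z` `η`-Hermitian. -/
structure EtaSystem (m₁ m₂ m₃ n₁ n₂ n₃ p : ℕ) where
  η : ℍ[ℝ]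
  A₁ : Matrix (Fin m₁) (Fin n₁) ℍ[ℝ]
  A₂ : Matrix (Fin m₂) (Fin n₂) ℍ[ℝ]
  A₃ : Matrix (Fin m₃) (Fin n₃) ℍ[ℝ]
  C₁ : Matrix (Fin m₁) (Fin n₁) ℍ[ℝ]
  C₂ : Matrix (Fin m₂) (Fin n₂) ℍ[ℝ]
  C₃ : Matrix (Fin m₃) (Fin n₃) ℍ[ℝ]
  E₁ : Matrix (Fin p) (Fin n₁) ℍ[ℝ]
  E₂ : Matrix (Fin p) (Fin n₂) ℍ[ℝ]
  E₃ : Matrix (Fin p) (Fin n₃) ℍ[ℝ]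
  C : Matrix (Fin p) (Fin p) ℍ[ℝ]

/-- The free matrices `U₄, …, U₈, U₁₁, U₁₂, U₂₁, U₃₁, U₃₂, U₃₃, U₄₁, U₄₂` of the general
solution. -/
structure EtaParams (n₁ n₂ n₃ : ℕ) where
  U₄ : Matrix (Fin n₂) (Fin n₂) ℍ[ℝ]
  U₅ : Matrix (Fin n₁) (Fin n₁) ℍ[ℝ]
  U₆ : Matrix (Fin n₁) (Fin n₁) ℍ[ℝ]
  U₇ : Matrix (Fin n₂) (Fin n₂) ℍ[ℝ]
  U₈ : Matrix (Fin n₂) (Fin n₂) ℍ[ℝ]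
  U₁₁ : Matrix (Fin n₃) (Fin n₃ ⊕ Fin n₃) ℍ[ℝ]
  U₁₂ : Matrix (Fin n₃ ⊕ Fin n₃) (Fin n₃) ℍ[ℝ]
  U₂₁ : Matrix (Fin n₃) (Fin n₃ ⊕ Fin n₃) ℍ[ℝ]
  U₃₁ : Matrix (Fin n₃) (Fin n₃) ℍ[ℝ]
  U₃₂ : Matrix (Fin n₃) (Fin n₃) ℍ[ℝ]
  U₃₃ : Matrix (Fin n₃) (Fin n₃) ℍ[ℝ]
  U₄₁ : Matrix (Fin n₃) (Fin n₃) ℍ[ℝ]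
  U₄₂ : Matrix (Fin n₃) (Fin n₃) ℍ[ℝ]

namespace EtaSystem

open QMat

variable {m₁ m₂ m₃ n₁ n₂ n₃ p : ℕ} (S : EtaSystem m₁ m₂ m₃ n₁ n₂ n₃ p)

/-- `A^{η*}` for the unit `η` of the system. -/
noncomputable abbrev st {a b : Type*} (A : Matrix a b ℍ[ℝ]) : Matrix b a ℍ[ℝ] := etaStar S.η A

/-- `(X, Y, Z)` is an `η`-Hermitian solution of the system. -/
def IsSolution (X : Matrix (Fin n₁) (Fin n₁) ℍ[ℝ]) (Y : Matrix (Fin n₂) (Fin n₂) ℍ[ℝ])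
    (Z : Matrix (Fin n₃) (Fin n₃) ℍ[ℝ]) : Prop :=
  S.A₁ * X = S.C₁ ∧ IsEtaHermitian S.η X ∧
  S.A₂ * Y = S.C₂ ∧ IsEtaHermitian S.η Y ∧
  S.A₃ * Z = S.C₃ ∧ IsEtaHermitian S.η Z ∧
  S.E₁ * X * S.st S.E₁ + S.E₂ * Y * S.st S.E₂ + S.E₃ * Z * S.st S.E₃ = S.C

/-- The system is consistent. -/
def Consistent : Prop := ∃ X Y Z, S.IsSolution X Y Z

/-- The compatibility conditions `A_i C_i^{η*} = C_i A_i^{η*}`. -/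
def Compatible : Prop :=
  S.A₁ * S.st S.C₁ = S.C₁ * S.st S.A₁ ∧
  S.A₂ * S.st S.C₂ = S.C₂ * S.st S.A₂ ∧
  S.A₃ * S.st S.C₃ = S.C₃ * S.st S.A₃

/-! ### Auxiliary matrices -/

noncomputable def A11 := S.E₁ * projL S.A₁
noncomputable def A22 := S.E₂ * projL S.A₂
noncomputable def A33 := S.E₃ * projL S.A₃
noncomputable def M1 := projR S.A11 * S.A22
noncomputable def S1 := S.A22 * projL S.M1
noncomputable def X0 := pinv S.A₁ * S.C₁ + projL S.A₁ * S.st S.C₁ * pinv (S.st S.A₁)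
noncomputable def Y0 := pinv S.A₂ * S.C₂ + projL S.A₂ * S.st S.C₂ * pinv (S.st S.A₂)
noncomputable def Z0 := pinv S.A₃ * S.C₃ + projL S.A₃ * S.st S.C₃ * pinv (S.st S.A₃)
noncomputable def T1 :=
  S.C - S.E₁ * S.X0 * S.st S.E₁ - S.E₂ * S.Y0 * S.st S.E₂ - S.E₃ * S.Z0 * S.st S.E₃
noncomputable def G := projR S.M1 * projR S.A11
noncomputable def G1 := S.G * S.A33
noncomputable def G2 := projR S.A11 * S.A33
noncomputable def G3 := projR S.A22 * S.A33
noncomputable def G4 := S.A33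
noncomputable def L1 := S.G * S.T1
noncomputable def L2 := projR S.A11 * S.T1 * S.st (projR S.A22)
noncomputable def L3 := projR S.A22 * S.T1 * S.st (projR S.A11)
noncomputable def L4 := S.T1 * S.st S.G
noncomputable def C11 := projL S.G2 ⊕ᶜ projL S.G4
noncomputable def C22 := projL S.G1
noncomputable def C33 := projL S.G3
noncomputable def E11 := projR S.C11 * S.C22
noncomputable def E22 := projR S.C11 * S.C33
noncomputable def M := projR S.E11 * S.E22
noncomputable def N := S.st (projR S.E22 * S.E11)
noncomputable def F1 :=
  pinv S.G1 * S.L1 * pinv (S.st S.G4) + projL S.G1 * pinv S.G2 * S.L2 * pinv (S.st S.G3)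
noncomputable def F2 :=
  pinv S.G3 * S.L3 * pinv (S.st S.G2) + projL S.G3 * pinv S.G4 * S.L4 * pinv (S.st S.G1)
noncomputable def F := S.F2 - S.F1
noncomputable def E := projR S.C11 * S.F * S.st (projR S.C11)
/-- The matrix `S = E₂₂ L_M`. -/
noncomputable def SM := S.E22 * projL S.M

/-! ### The two solvability criteria -/

/-- The solvability conditions in projector form. -/
def ProjectorCondition : Prop :=
  S.Compatible ∧
  projR S.A₁ * S.C₁ = 0 ∧ projR S.A₂ * S.C₂ = 0 ∧ projR S.A₃ * S.C₃ = 0 ∧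
  projR S.G1 * S.L1 = 0 ∧ projR S.G2 * S.L2 = 0 ∧
  projR S.G3 * S.L3 = 0 ∧ projR S.G4 * S.L4 = 0 ∧
  projR S.E22 * S.E * S.st (projR S.E22) = 0

/-- The solvability conditions in block rank form. -/
def RankCondition : Prop :=
  S.Compatible ∧
  qrank (S.A₁ ⊕ᶜ S.C₁) = qrank S.A₁ ∧
  qrank (S.A₂ ⊕ᶜ S.C₂) = qrank S.A₂ ∧
  qrank (S.A₃ ⊕ᶜ S.C₃) = qrank S.A₃ ∧
  qrank (S.C                ⊕ᶜ S.E₃ ⊕ᶜ S.E₁ ⊕ᶜ S.E₂ ⊕ʳ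
        S.C₃ * S.st S.E₃ ⊕ᶜ S.A₃ ⊕ᶜ 0    ⊕ᶜ 0    ⊕ʳ
        S.C₁ * S.st S.E₁ ⊕ᶜ 0    ⊕ᶜ S.A₁ ⊕ᶜ 0    ⊕ʳ
        S.C₂ * S.st S.E₂ ⊕ᶜ 0    ⊕ᶜ 0    ⊕ᶜ S.A₂)
    = qrank (S.E₃ ⊕ᶜ S.E₁ ⊕ᶜ S.E₂ ⊕ʳ
            S.A₃ ⊕ᶜ 0    ⊕ᶜ 0    ⊕ʳ
            0    ⊕ᶜ S.A₁ ⊕ᶜ 0    ⊕ʳ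
            0    ⊕ᶜ 0    ⊕ᶜ S.A₂) ∧
  qrank (S.C                ⊕ᶜ S.E₃ ⊕ᶜ S.E₁ ⊕ᶜ S.E₂ * S.st S.C₂ ⊕ʳ
        S.st S.E₂          ⊕ᶜ 0    ⊕ᶜ 0    ⊕ᶜ S.st S.A₂ ⊕ʳ
        S.C₃ * S.st S.E₃ ⊕ᶜ S.A₃ ⊕ᶜ 0    ⊕ᶜ 0 ⊕ʳ
        S.C₁ * S.st S.E₁ ⊕ᶜ 0    ⊕ᶜ S.A₁ ⊕ᶜ 0)
    = qrank (S.E₃ ⊕ᶜ S.E₁ ⊕ʳ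
            S.A₃ ⊕ᶜ 0    ⊕ʳ
            0    ⊕ᶜ S.A₁)
      + qrank (S.E₂ ⊕ʳ S.A₂) ∧
  qrank (S.C                ⊕ᶜ S.E₃ ⊕ᶜ S.E₂ ⊕ᶜ S.E₁ * S.st S.C₁ ⊕ʳ
        S.st S.E₁          ⊕ᶜ 0    ⊕ᶜ 0    ⊕ᶜ S.st S.A₁ ⊕ʳ
        S.C₃ * S.st S.E₃ ⊕ᶜ S.A₃ ⊕ᶜ 0    ⊕ᶜ 0 ⊕ʳ
        S.C₂ * S.st S.E₂ ⊕ᶜ 0    ⊕ᶜ S.A₂ ⊕ᶜ 0)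
    = qrank (S.E₃ ⊕ᶜ S.E₂ ⊕ʳ
            S.A₃ ⊕ᶜ 0    ⊕ʳ
            0    ⊕ᶜ S.A₂)
      + qrank (S.E₁ ⊕ʳ S.A₁) ∧
  qrank (S.C                ⊕ᶜ S.E₃ ⊕ᶜ S.E₁ * S.st S.C₁ ⊕ᶜ S.E₂ * S.st S.C₂ ⊕ʳ
        S.st S.E₁          ⊕ᶜ 0    ⊕ᶜ S.st S.A₁        ⊕ᶜ 0 ⊕ʳ
        S.st S.E₂          ⊕ᶜ 0    ⊕ᶜ 0                ⊕ᶜ S.st S.A₂ ⊕ʳ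
        S.C₃ * S.st S.E₃ ⊕ᶜ S.A₃ ⊕ᶜ 0                ⊕ᶜ 0)
    = qrank (S.E₁ ⊕ᶜ S.E₂ ⊕ʳ
            S.A₁ ⊕ᶜ 0    ⊕ʳ
            0    ⊕ᶜ S.A₂)
      + qrank (S.E₃ ⊕ʳ S.A₃) ∧
  qrank (S.C                ⊕ᶜ 0 ⊕ᶜ S.E₁ ⊕ᶜ 0 ⊕ᶜ S.E₃ ⊕ᶜ S.E₂ * S.st S.C₂ ⊕ᶜ 0 ⊕ᶜ
          S.E₃ * S.st S.C₃ ⊕ʳ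
        0 ⊕ᶜ -S.C ⊕ᶜ 0 ⊕ᶜ S.E₂ ⊕ᶜ S.E₃ ⊕ᶜ 0 ⊕ᶜ -(S.E₁ * S.st S.C₁) ⊕ᶜ 0 ⊕ʳ
        S.st S.E₂ ⊕ᶜ 0 ⊕ᶜ 0 ⊕ᶜ 0 ⊕ᶜ 0 ⊕ᶜ S.st S.A₂ ⊕ᶜ 0 ⊕ᶜ 0 ⊕ʳ
        0 ⊕ᶜ S.st S.E₁ ⊕ᶜ 0 ⊕ᶜ 0 ⊕ᶜ 0 ⊕ᶜ 0 ⊕ᶜ S.st S.A₁ ⊕ᶜ 0 ⊕ʳ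
        S.st S.E₃ ⊕ᶜ S.st S.E₃ ⊕ᶜ 0 ⊕ᶜ 0 ⊕ᶜ 0 ⊕ᶜ 0 ⊕ᶜ 0 ⊕ᶜ S.st S.A₃ ⊕ʳ
        S.C₁ * S.st S.E₁ ⊕ᶜ 0 ⊕ᶜ S.A₁ ⊕ᶜ 0 ⊕ᶜ 0 ⊕ᶜ 0 ⊕ᶜ 0 ⊕ᶜ 0 ⊕ʳ
        0 ⊕ᶜ -(S.C₂ * S.st S.E₂) ⊕ᶜ 0 ⊕ᶜ S.A₂ ⊕ᶜ 0 ⊕ᶜ 0 ⊕ᶜ 0 ⊕ᶜ 0 ⊕ʳ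
        0 ⊕ᶜ -(S.C₃ * S.st S.E₃) ⊕ᶜ 0 ⊕ᶜ 0 ⊕ᶜ S.A₃ ⊕ᶜ 0 ⊕ᶜ 0 ⊕ᶜ 0)
    = 2 * qrank (S.E₁ ⊕ᶜ 0    ⊕ᶜ S.E₃ ⊕ʳ
                0    ⊕ᶜ S.E₂ ⊕ᶜ S.E₃ ⊕ʳ
                S.A₁ ⊕ᶜ 0    ⊕ᶜ 0    ⊕ʳ
                0    ⊕ᶜ S.A₂ ⊕ᶜ 0    ⊕ʳ
                0    ⊕ᶜ 0    ⊕ᶜ S.A₃)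

/-! ### The general solution -/

variable (P : EtaParams n₁ n₂ n₃)

noncomputable def V3 : Matrix (Fin n₃) (Fin n₃) ℍ[ℝ] :=
  pinv S.E11 * S.F * pinv (S.st S.E22)
    - pinv S.E11 * S.E22 * pinv S.M * S.F * pinv (S.st S.E22)
    - pinv S.E11 * S.SM * pinv S.E22 * S.F * pinv S.N * S.st S.E11 * pinv (S.st S.E22)
    - pinv S.E11 * S.SM * P.U₃₁ * projR S.N * S.st S.E11 * pinv (S.st S.E22)
    + projL S.E11 * P.U₃₂ + P.U₃₃ * S.st (projL S.E22)

noncomputable def W3 : Matrix (Fin n₃) (Fin n₃) ℍ[ℝ] :=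
  pinv S.M * S.F * pinv (S.st S.E11)
    + pinv S.SM * S.SM * pinv S.E22 * S.F * pinv S.N
    + projL S.M * projL S.SM * P.U₄₁ + projL S.M * P.U₃₁ * projR S.N
    - P.U₄₂ * S.st (projL S.E11)

/-- The residual `F - C₂₂ V₃ C₃₃^{η*} - C₃₃ W₃ C₂₂^{η*}`. -/
noncomputable def Q : Matrix (Fin n₃) (Fin n₃) ℍ[ℝ] :=
  S.F - S.C22 * S.V3 P * S.st S.C33 - S.C33 * S.W3 P * S.st S.C22

noncomputable def V1 : Matrix (Fin n₃) (Fin n₃) ℍ[ℝ] :=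
  (1 ⊕ᶜ 0) * (pinv S.C11 * S.Q P)
    - (1 ⊕ᶜ 0) * (pinv S.C11 * P.U₁₁ * S.st S.C11 + projL S.C11 * P.U₁₂)

noncomputable def W1 : Matrix (Fin n₃) (Fin n₃) ℍ[ℝ] :=
  (0 ⊕ᶜ 1) * (pinv S.C11 * S.Q P)
    - (0 ⊕ᶜ 1) * (pinv S.C11 * P.U₁₁ * S.st S.C11 + projL S.C11 * P.U₁₂)

noncomputable def W2 : Matrix (Fin n₃) (Fin n₃) ℍ[ℝ] :=
  (projR S.C11 * S.Q P * pinv (S.st S.C11)) * (1 ⊕ʳ 0)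
    + (S.C11 * pinv S.C11 * P.U₁₁ + P.U₂₁ * S.st (projL S.C11)) * (1 ⊕ʳ 0)

noncomputable def V2 : Matrix (Fin n₃) (Fin n₃) ℍ[ℝ] :=
  (projR S.C11 * S.Q P * pinv (S.st S.C11)) * (0 ⊕ʳ 1)
    + (S.C11 * pinv S.C11 * P.U₁₁ + P.U₂₁ * S.st (projL S.C11)) * (0 ⊕ʳ 1)

/-- The first expression for `U₃`. -/
noncomputable def U3 : Matrix (Fin n₃) (Fin n₃) ℍ[ℝ] :=
  S.F1 + projL S.G2 * S.V1 P + S.V2 P * projR (S.st S.G4)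
    + projL S.G1 * S.V3 P * projR (S.st S.G3)

/-- The second expression for `U₃`. -/
noncomputable def U3' : Matrix (Fin n₃) (Fin n₃) ℍ[ℝ] :=
  S.F2 - projL S.G4 * S.W1 P - S.W2 P * projR (S.st S.G2)
    - projL S.G3 * S.W3 P * projR (S.st S.G1)

variable (U₃ : Matrix (Fin n₃) (Fin n₃) ℍ[ℝ])

/-- `T = T₁ - A₃₃ U₃ A₃₃^{η*}`. -/
noncomputable def T : Matrix (Fin p) (Fin p) ℍ[ℝ] := S.T1 - S.A33 * U₃ * S.st S.A33

noncomputable def U1 : Matrix (Fin n₁) (Fin n₁) ℍ[ℝ] :=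
  pinv S.A11 * S.T U₃ * S.st (pinv S.A11)
    - pinv S.A11 * S.A22 * pinv S.M1 * S.T U₃ * S.st (pinv S.A11)
    - pinv S.A11 * S.S1 * pinv S.A22 * S.T U₃ * S.st (pinv S.M1) * S.st S.A22
        * S.st (pinv S.A11)
    - pinv S.A11 * S.S1 * P.U₄ * projR (S.st S.M1) * S.st S.A22 * S.st (pinv S.A11)
    + projL S.A11 * P.U₅ + P.U₆ * projR (S.st S.A11)

noncomputable def U2 : Matrix (Fin n₂) (Fin n₂) ℍ[ℝ] :=
  pinv S.M1 * S.T U₃ * S.st (pinv S.A22)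
    + pinv S.S1 * S.S1 * pinv S.A22 * S.T U₃ * S.st (pinv S.M1)
    + projL S.M1 * projL S.S1 * P.U₇ + P.U₈ * projR (S.st S.A22)
    + projL S.M1 * P.U₄ * projR (S.st S.M1)

noncomputable def Xt : Matrix (Fin n₁) (Fin n₁) ℍ[ℝ] :=
  pinv S.A₁ * S.C₁ + projL S.A₁ * S.st S.C₁ * pinv (S.st S.A₁)
    + projL S.A₁ * S.U1 P U₃ * S.st (projL S.A₁)

noncomputable def Yt : Matrix (Fin n₂) (Fin n₂) ℍ[ℝ] :=
  pinv S.A₂ * S.C₂ + projL S.A₂ * S.st S.C₂ * pinv (S.st S.A₂)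
    + projL S.A₂ * S.U2 P U₃ * S.st (projL S.A₂)

noncomputable def Zt : Matrix (Fin n₃) (Fin n₃) ℍ[ℝ] :=
  pinv S.A₃ * S.C₃ + projL S.A₃ * S.st S.C₃ * pinv (S.st S.A₃)
    + projL S.A₃ * U₃ * S.st (projL S.A₃)

/-- `(X, Y, Z)` is the triple `X = (X̃ + X̃^{η*})/2`, `Y = (Ỹ + Ỹ^{η*})/2`, `Z = (Z̃ + Z̃^{η*})/2`
given by the free matrices `P` and the matrix `U₃`. -/
def IsGiven (X : Matrix (Fin n₁) (Fin n₁) ℍ[ℝ]) (Y : Matrix (Fin n₂) (Fin n₂) ℍ[ℝ])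
    (Z : Matrix (Fin n₃) (Fin n₃) ℍ[ℝ]) : Prop :=
  X = (1 / 2 : ℝ) • (S.Xt P U₃ + S.st (S.Xt P U₃)) ∧
  Y = (1 / 2 : ℝ) • (S.Yt P U₃ + S.st (S.Yt P U₃)) ∧
  Z = (1 / 2 : ℝ) • (S.Zt U₃ + S.st (S.Zt U₃))

end EtaSystem

set_option linter.unusedSectionVars false

/-! Write `X = X₀ + D₁`, and likewise for `Y` and `Z`, with `X₀, Y₀, Z₀` the explicit η-Hermitian
solutions of the three one-sided equations. A difference of two η-Hermitian solutions of `A X = C`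
equals `L_A D L_A^{η*}`, so the system becomes `A₁₁U₁A₁₁^{η*} + A₂₂U₂A₂₂^{η*} + A₃₃U₃A₃₃^{η*} = T₁`.
The unknowns need not be η-Hermitian: since `C` is, averaging a solution with its η-star gives one
that is.

For fixed `U₃` this is a two-term equation `A X B + C Y D = E`, solved completely by
`mul_twoTermFst_mul_add` and `exists_twoTerm`. Its four solvability conditions are four equations
for `U₃` (`T_solvable_iff`), which split into two nested pairs, with general solutions `F₁ + …` and
`F₂ - …`. Equating these two expressions gives a Sylvester equation with coefficient `C₁₁` for the
stacked `V₁, W₁` and `W₂, V₂`. It is solvable exactly when `E₁₁V₃E₂₂^{η*} + E₂₂W₃E₁₁^{η*} = E`,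
again a two-term equation. Three of its four conditions hold automatically, because `G₁FG₂^{η*} = 0
= G₂FG₁^{η*}`; the fourth is the last projector condition. Solving these layers from the inside out
yields the formulas and their completeness.

The rank conditions rest on `qrank_fromBlocks_iff`: the block matrix with rows `(W, P)` and `(Q, 0)`
has rank `r(P) + r(Q)` iff `W = P a + b Q`. Subtracting terms built from any η-Hermitian solutions
of the one-sided equations reduces `W` to blocks containing only the residual of the main equation.
An actual solution has residual zero, so (1) implies (3). With `X₀, Y₀, Z₀` the residual is `T₁`,
and multiplying by matrices annihilating `P` on the left and `Q` on the right gives the projector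
conditions, so (3) implies (2). The explicit formulas give (2) implies (1). -/

namespace QMat

/-! ### The η-star as an involutive anti-automorphism. -/

section EtaStar

variable {l m n : Type*} {η : ℍ[ℝ]}

theorem IsBasicUnit.star_eq (hη : IsBasicUnit η) : star η = -η :=
  Quaternion.star_eq_neg.2 <| by rcases hη with rfl | rfl | rfl <;> rfl

theorem IsBasicUnit.normSq_eq (hη : IsBasicUnit η) : Quaternion.normSq η = 1 := by
  rw [Quaternion.normSq_def']
  rcases hη with rfl | rfl | rfl <;> norm_num

theorem IsBasicUnit.mul_self (hη : IsBasicUnit η) : η * η = -1 := by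
  have h := Quaternion.self_mul_star (a := η)
  rw [hη.star_eq, hη.normSq_eq, mul_neg] at h
  rw [← neg_neg (η * η), h, Quaternion.coe_one]

theorem IsBasicUnit.cancel (hη : IsBasicUnit η) (q : ℍ[ℝ]) : η * (η * q) = -q := by
  rw [← mul_assoc, hη.mul_self, neg_one_mul]

theorem etaStar_apply (A : Matrix m n ℍ[ℝ]) (i : n) (j : m) :
    etaStar η A i j = -η * star (A j i) * η := rfl

theorem etaStar_mul [Fintype m] (hη : IsBasicUnit η) (A : Matrix l m ℍ[ℝ]) (B : Matrix m n ℍ[ℝ]) :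
    etaStar η (A * B) = etaStar η B * etaStar η A := by
  ext1 i j
  simp only [etaStar_apply, Matrix.mul_apply, star_sum, Finset.mul_sum, Finset.sum_mul, star_mul]
  refine Finset.sum_congr rfl fun k _ => ?_
  simp only [mul_assoc, neg_mul, mul_neg, hη.cancel, neg_neg]

theorem etaStar_etaStar (hη : IsBasicUnit η) (A : Matrix m n ℍ[ℝ]) :
    etaStar η (etaStar η A) = A := by
  ext1 i j
  simp only [etaStar_apply, star_mul, star_neg, star_star, hη.star_eq, neg_neg, mul_assoc,
    neg_mul, mul_neg, hη.cancel, hη.mul_self, mul_one]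

theorem etaStar_add (A B : Matrix m n ℍ[ℝ]) : etaStar η (A + B) = etaStar η A + etaStar η B := by
  ext1 i j
  simp only [etaStar_apply, Matrix.add_apply, star_add, mul_add, add_mul]

theorem etaStar_neg (A : Matrix m n ℍ[ℝ]) : etaStar η (-A) = -etaStar η A := by
  ext1 i j
  simp only [etaStar_apply, Matrix.neg_apply, star_neg, mul_neg, neg_mul]

theorem etaStar_sub (A B : Matrix m n ℍ[ℝ]) : etaStar η (A - B) = etaStar η A - etaStar η B := by
  rw [sub_eq_add_neg, etaStar_add, etaStar_neg, ← sub_eq_add_neg]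

theorem etaStar_zero : etaStar η (0 : Matrix m n ℍ[ℝ]) = 0 := by
  ext1 i j
  simp [etaStar_apply]

theorem etaStar_one [DecidableEq n] (hη : IsBasicUnit η) :
    etaStar η (1 : Matrix n n ℍ[ℝ]) = 1 := by
  ext1 i j
  by_cases h : i = j
  · subst h; simp [etaStar_apply, hη.mul_self]
  · simp [etaStar_apply, Matrix.one_apply_ne h, Matrix.one_apply_ne (Ne.symm h)]

theorem etaStar_smul (r : ℝ) (A : Matrix m n ℍ[ℝ]) : etaStar η (r • A) = r • etaStar η A := by
  ext1 i j
  simp [etaStar_apply]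

theorem conjTranspose_etaStar (hη : IsBasicUnit η) (A : Matrix m n ℍ[ℝ]) :
    (etaStar η A)ᴴ = etaStar η Aᴴ := by
  ext1 i j
  simp [etaStar_apply, hη.star_eq, mul_assoc]

end EtaStar

/-! ### Moore–Penrose inverses and their projections. -/

section MoorePenrose

variable {k l m n : Type*} [Fintype m] [Fintype n]

theorem pinv_spec (A : Matrix m n ℍ[ℝ]) : IsMoorePenrose A (pinv A) :=
  (exists_isMoorePenrose A).choose_spec

theorem mul_pinv_mul (A : Matrix m n ℍ[ℝ]) : A * (pinv A * A) = A := by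
  rw [← Matrix.mul_assoc]; exact (pinv_spec A).1

theorem pinv_mul_pinv (A : Matrix m n ℍ[ℝ]) : pinv A * (A * pinv A) = pinv A := by
  rw [← Matrix.mul_assoc]; exact (pinv_spec A).2.1

/-- The η-star reverses products and commutes with the conjugate transpose, so it carries the four
Penrose equations for `A` to those for its η-star; uniqueness does the rest. -/
theorem etaStar_pinv {η : ℍ[ℝ]} (hη : IsBasicUnit η) (A : Matrix m n ℍ[ℝ]) :
    etaStar η (pinv A) = pinv (etaStar η A) := by
  refine IsMoorePenrose.unique (A := etaStar η A) ?_ (pinv_spec _)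
  obtain ⟨h1, h2, h3, h4⟩ := pinv_spec A
  refine ⟨?_, ?_, ?_, ?_⟩
  · rw [Matrix.mul_assoc, ← etaStar_mul hη, ← etaStar_mul hη, h1]
  · rw [Matrix.mul_assoc, ← etaStar_mul hη, ← etaStar_mul hη, h2]
  · rw [← etaStar_mul hη, conjTranspose_etaStar hη, h4]
  · rw [← etaStar_mul hη, conjTranspose_etaStar hη, h3]

theorem mul_projL [DecidableEq n] (A : Matrix m n ℍ[ℝ]) : A * projL A = 0 := by
  rw [projL, Matrix.mul_sub, mul_pinv_mul, Matrix.mul_one, sub_self]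

theorem projR_mul [DecidableEq m] (A : Matrix m n ℍ[ℝ]) : projR A * A = 0 := by
  rw [projR, Matrix.sub_mul, Matrix.mul_assoc, mul_pinv_mul, Matrix.one_mul, sub_self]

theorem projL_mul_pinv [DecidableEq n] (A : Matrix m n ℍ[ℝ]) : projL A * pinv A = 0 := by
  rw [projL, Matrix.sub_mul, Matrix.mul_assoc, pinv_mul_pinv, Matrix.one_mul, sub_self]

theorem pinv_mul_projR [DecidableEq m] (A : Matrix m n ℍ[ℝ]) : pinv A * projR A = 0 := by
  rw [projR, Matrix.mul_sub, pinv_mul_pinv, Matrix.mul_one, sub_self]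

theorem projL_mul_projL [DecidableEq n] (A : Matrix m n ℍ[ℝ]) : projL A * projL A = projL A := by
  conv_lhs => rhs; rw [projL]
  rw [Matrix.mul_sub, ← Matrix.mul_assoc, projL_mul_pinv, Matrix.mul_one, Matrix.zero_mul, sub_zero]

theorem projR_mul_projR [DecidableEq m] (A : Matrix m n ℍ[ℝ]) : projR A * projR A = projR A := by
  conv_lhs => lhs; rw [projR]
  rw [Matrix.sub_mul, Matrix.mul_assoc, pinv_mul_projR, Matrix.one_mul, Matrix.mul_zero, sub_zero]

theorem conjTranspose_projL [DecidableEq n] (A : Matrix m n ℍ[ℝ]) : (projL A)ᴴ = projL A := by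
  rw [projL, conjTranspose_sub, conjTranspose_one, (pinv_spec A).2.2.2]

theorem conjTranspose_projR [DecidableEq m] (A : Matrix m n ℍ[ℝ]) : (projR A)ᴴ = projR A := by
  rw [projR, conjTranspose_sub, conjTranspose_one, (pinv_spec A).2.2.1]

theorem etaStar_projL [DecidableEq n] {η : ℍ[ℝ]} (hη : IsBasicUnit η) (A : Matrix m n ℍ[ℝ]) :
    etaStar η (projL A) = projR (etaStar η A) := by
  rw [projL, projR, etaStar_sub, etaStar_mul hη, etaStar_pinv hη, etaStar_one hη]

theorem etaStar_projR [DecidableEq m] {η : ℍ[ℝ]} (hη : IsBasicUnit η) (A : Matrix m n ℍ[ℝ]) :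
    etaStar η (projR A) = projL (etaStar η A) := by
  rw [projL, projR, etaStar_sub, etaStar_mul hη, etaStar_pinv hη, etaStar_one hη]

/-- If the Hermitian matrix `P` fixes the columns of `A`, then `A† P = A†`. -/
theorem pinv_mul_of_mul_eq {A : Matrix m n ℍ[ℝ]} {P : Matrix m m ℍ[ℝ]} (hP : Pᴴ = P)
    (h : P * A = A) : pinv A * P = pinv A := by
  have e : A * pinv A * P = A * pinv A := by
    have h3 := (pinv_spec A).2.2.1
    calc A * pinv A * P = (P * (A * pinv A))ᴴ := by rw [conjTranspose_mul, h3, hP]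
      _ = A * pinv A := by rw [← Matrix.mul_assoc, h, h3]
  calc pinv A * P = pinv A * (A * pinv A * P) := by
        rw [← Matrix.mul_assoc, ← Matrix.mul_assoc, (pinv_spec A).2.1]
    _ = pinv A := by rw [e, pinv_mul_pinv]

/-- If the Hermitian matrix `P` fixes the rows of `A`, then `P A† = A†`. -/
theorem mul_pinv_of_mul_eq {A : Matrix m n ℍ[ℝ]} {P : Matrix n n ℍ[ℝ]} (hP : Pᴴ = P)
    (h : A * P = A) : P * pinv A = pinv A := by
  have e : P * (pinv A * A) = pinv A * A := by
    have h3 := (pinv_spec A).2.2.2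
    calc P * (pinv A * A) = ((pinv A * A) * P)ᴴ := by rw [conjTranspose_mul, h3, hP]
      _ = pinv A * A := by rw [Matrix.mul_assoc, h, h3]
  calc P * pinv A = P * (pinv A * A) * pinv A := by
        rw [Matrix.mul_assoc, (pinv_spec A).2.1]
    _ = pinv A := by rw [e, (pinv_spec A).2.1]

theorem mul_pinv_mul_of_projR [DecidableEq m] {A : Matrix m n ℍ[ℝ]} {K : Matrix m l ℍ[ℝ]} (h : projR A * K = 0) :
    A * (pinv A * K) = K := by
  rw [projR, Matrix.sub_mul, Matrix.one_mul, sub_eq_zero, Matrix.mul_assoc] at h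
  exact h.symm

theorem mul_pinv_mul_of_projL [DecidableEq n] {B : Matrix m n ℍ[ℝ]} {K : Matrix l n ℍ[ℝ]} (h : K * projL B = 0) :
    K * (pinv B * B) = K := by
  rw [projL, Matrix.mul_sub, Matrix.mul_one, sub_eq_zero] at h
  exact h.symm

theorem eq_projL_mul [DecidableEq n] {A : Matrix m n ℍ[ℝ]} {K : Matrix n l ℍ[ℝ]} (h : A * K = 0) :
    projL A * K = K := by
  rw [projL, Matrix.sub_mul, Matrix.mul_assoc, h, Matrix.mul_zero, sub_zero, Matrix.one_mul]

theorem eq_mul_projR [DecidableEq m] {B : Matrix m n ℍ[ℝ]} {K : Matrix l m ℍ[ℝ]} (h : K * B = 0) :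
    K * projR B = K := by
  rw [projR, Matrix.mul_sub, ← Matrix.mul_assoc, h, Matrix.zero_mul, sub_zero, Matrix.mul_one]

theorem mul_reassoc {m n : Type*} [Fintype l] [Fintype m] {A : Matrix k l ℍ[ℝ]} {B : Matrix l m ℍ[ℝ]} {C : Matrix k m ℍ[ℝ]}
    (h : A * B = C) (Z : Matrix m n ℍ[ℝ]) : A * (B * Z) = C * Z := by
  rw [← h, Matrix.mul_assoc]

end MoorePenrose

/-! ### The two-term equation `A X B + C Y D = E`. -/

section TwoTerm

variable {m n k l s t : Type*} [Fintype m] [Fintype n] [Fintype k] [Fintype l] [Fintype s]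
  [Fintype t] [DecidableEq m] [DecidableEq n] [DecidableEq k] [DecidableEq l] [DecidableEq s]
  [DecidableEq t]
  {A : Matrix m k ℍ[ℝ]} {B : Matrix l n ℍ[ℝ]} {C : Matrix m s ℍ[ℝ]} {D : Matrix t n ℍ[ℝ]}
  {E : Matrix m n ℍ[ℝ]} {M : Matrix m s ℍ[ℝ]} {N : Matrix t n ℍ[ℝ]} {S : Matrix m s ℍ[ℝ]}

/-- The solvability conditions of `A X B + C Y D = E`, where `M = R_A C` and `N = D L_B`. -/
structure TwoTermSolvable (A : Matrix m k ℍ[ℝ]) (B : Matrix l n ℍ[ℝ]) (C : Matrix m s ℍ[ℝ])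
    (D : Matrix t n ℍ[ℝ]) (E : Matrix m n ℍ[ℝ]) (M : Matrix m s ℍ[ℝ])
    (N : Matrix t n ℍ[ℝ]) : Prop where
  left : projR M * (projR A * E) = 0
  right : E * projL B * projL N = 0
  left_right : projR A * E * projL D = 0
  right_left : projR C * (E * projL B) = 0

/-- The general second component of the solution of `A X B + C Y D = E`. -/
noncomputable def twoTermSnd (C : Matrix m s ℍ[ℝ]) (D : Matrix t n ℍ[ℝ]) (E : Matrix m n ℍ[ℝ])
    (M : Matrix m s ℍ[ℝ]) (N : Matrix t n ℍ[ℝ]) (S : Matrix m s ℍ[ℝ])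
    (V W Z : Matrix s t ℍ[ℝ]) : Matrix s t ℍ[ℝ] :=
  pinv M * E * pinv D + pinv S * S * pinv C * E * pinv N + projL M * projL S * W
    + projL M * V * projR N + Z * projR D

/-- The general first component of the solution of `A X B + C Y D = E`. -/
noncomputable def twoTermFst (A : Matrix m k ℍ[ℝ]) (B : Matrix l n ℍ[ℝ]) (C : Matrix m s ℍ[ℝ])
    (D : Matrix t n ℍ[ℝ]) (E : Matrix m n ℍ[ℝ]) (M : Matrix m s ℍ[ℝ])
    (N : Matrix t n ℍ[ℝ]) (S : Matrix m s ℍ[ℝ])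
    (V : Matrix s t ℍ[ℝ]) (U Z : Matrix k l ℍ[ℝ]) : Matrix k l ℍ[ℝ] :=
  pinv A * E * pinv B - pinv A * C * pinv M * E * pinv B
    - pinv A * S * pinv C * E * pinv N * D * pinv B
    - pinv A * S * V * projR N * D * pinv B + projL A * U + Z * projR B

theorem pinv_projR_mul_mul_projR (hM : M = projR A * C) : pinv M * projR A = pinv M :=
  pinv_mul_of_mul_eq (conjTranspose_projR A) (by rw [hM, ← Matrix.mul_assoc, projR_mul_projR])

theorem projL_mul_pinv_mul_projL (hN : N = D * projL B) : projL B * pinv N = pinv N :=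
  mul_pinv_of_mul_eq (conjTranspose_projL B) (by rw [hN, Matrix.mul_assoc, projL_mul_projL])

/-- The image `C Y D` of the general second component. -/
theorem mul_twoTermSnd_mul (h : TwoTermSolvable A B C D E M N) (hM : M = projR A * C)
    (hS : S = C * projL M) (V W Z : Matrix s t ℍ[ℝ]) :
    C * twoTermSnd C D E M N S V W Z * D =
      C * (pinv M * E) + S * (pinv C * (E * (pinv N * D))) + S * (V * (projR N * D)) := by
  have hMA := pinv_projR_mul_mul_projR hM
  -- Since `M† = M† R_A`, the condition `R_A E L_D = 0` allows `D†D` to be cancelled here.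
  have h1 : pinv M * (E * (pinv D * D)) = pinv M * E := by
    rw [← hMA, Matrix.mul_assoc, Matrix.mul_assoc, ← Matrix.mul_assoc _ E,
      mul_pinv_mul_of_projL h.left_right]
  have hSp : projL M * pinv S = pinv S :=
    mul_pinv_of_mul_eq (conjTranspose_projL M) (by rw [hS, Matrix.mul_assoc, projL_mul_projL])
  have h2 : C * (pinv S * S) = S := by
    rw [← hSp, Matrix.mul_assoc, ← Matrix.mul_assoc, ← hS, mul_pinv_mul]
  have h3 : C * (projL M * projL S) = 0 := by
    rw [← Matrix.mul_assoc, ← hS, mul_projL]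
  have e1 : C * (pinv M * E * pinv D) * D = C * (pinv M * E) := by
    simp only [Matrix.mul_assoc, h1]
  have e2 : C * (pinv S * S * pinv C * E * pinv N) * D = S * (pinv C * (E * (pinv N * D))) := by
    conv_rhs => rw [← h2]
    simp only [Matrix.mul_assoc]
  have e3 : C * (projL M * projL S * W) * D = 0 := by
    rw [← Matrix.mul_assoc, h3, Matrix.zero_mul, Matrix.zero_mul]
  have e4 : C * (projL M * V * projR N) * D = S * (V * (projR N * D)) := by
    rw [hS]; simp only [Matrix.mul_assoc]
  have e5 : C * (Z * projR D) * D = 0 := by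
    rw [Matrix.mul_assoc, Matrix.mul_assoc, projR_mul, Matrix.mul_zero, Matrix.mul_zero]
  rw [twoTermSnd]
  simp only [Matrix.mul_add, Matrix.add_mul, e1, e2, e3, e4, e5, add_zero]

/-- Subtracting `C Y D` from `E` leaves a matrix `K` with `R_A K = 0` and `K L_B = 0`, so `K = A (A†
K B†) B`; the first component is `A† K B†` plus terms killed by `A · B`. -/
theorem mul_twoTermFst_mul_add (h : TwoTermSolvable A B C D E M N) (hM : M = projR A * C)
    (hN : N = D * projL B) (hS : S = C * projL M) (V W Z : Matrix s t ℍ[ℝ])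
    (U Z' : Matrix k l ℍ[ℝ]) :
    A * twoTermFst A B C D E M N S V U Z' * B + C * twoTermSnd C D E M N S V W Z * D = E := by
  rw [mul_twoTermSnd_mul h hM hS]
  obtain ⟨K, hK⟩ : ∃ K, K = E - C * (pinv M * E) - S * (pinv C * (E * (pinv N * D)))
      - S * (V * (projR N * D)) := ⟨_, rfl⟩
  have hMA := pinv_projR_mul_mul_projR hM
  have hNB := projL_mul_pinv_mul_projL hN
  have hRS : projR A * S = 0 := by rw [hS, ← Matrix.mul_assoc, ← hM, mul_projL]
  have hRK : projR A * K = 0 := by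
    have e : projR A * (C * (pinv M * E)) = projR A * E := by
      rw [← Matrix.mul_assoc, ← hM, ← hMA, Matrix.mul_assoc, mul_pinv_mul_of_projR h.left]
    rw [hK]
    simp only [Matrix.mul_sub, e, mul_reassoc hRS, Matrix.zero_mul, sub_self]
  have hKL : K * projL B = 0 := by
    have e1 : E * (pinv N * (D * projL B)) = E * projL B := by
      have := mul_pinv_mul_of_projL h.right
      rw [Matrix.mul_assoc, mul_reassoc hNB] at this
      rw [← hN, this]
    have e2 : V * (projR N * (D * projL B)) = 0 := by rw [← hN, projR_mul, Matrix.mul_zero]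
    -- As `M†C = M†M`, the two terms are the images under `C` of the parts of one matrix under `M†M`
    -- and `L_M`. The condition `R_C E L_B = 0` then identifies their sum with `E L_B`.
    have e3 : C * (pinv M * (C * (pinv C * (E * projL B)))) +
        S * (pinv C * (E * projL B)) = C * (pinv C * (E * projL B)) := by
      have : pinv M * C = pinv M * M := by rw [hM, ← Matrix.mul_assoc, ← hM, hMA]
      generalize pinv C * (E * projL B) = K'
      rw [mul_reassoc this, hS, projL, Matrix.mul_sub, Matrix.sub_mul, Matrix.mul_one]
      simp only [Matrix.mul_assoc, add_sub_cancel]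
    rw [mul_pinv_mul_of_projR h.right_left] at e3
    rw [hK]
    simp only [Matrix.sub_mul, Matrix.mul_assoc, e1, e2, Matrix.mul_zero, sub_zero]
    conv_lhs => lhs; lhs; rw [← e3]
    abel
  have e : A * twoTermFst A B C D E M N S V U Z' * B = K := by
    have hf : twoTermFst A B C D E M N S V U Z' =
        pinv A * K * pinv B + projL A * U + Z' * projR B := by
      rw [twoTermFst, hK]
      simp only [Matrix.mul_sub, Matrix.sub_mul, Matrix.mul_assoc]
    rw [hf]
    simp only [Matrix.mul_add, Matrix.add_mul, Matrix.mul_assoc, projR_mul, Matrix.mul_zero,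
      mul_reassoc (mul_projL A), Matrix.zero_mul, add_zero, mul_pinv_mul_of_projL hKL,
      mul_pinv_mul_of_projR hRK]
  rw [e, hK]
  abel

/-- Elements of the kernel of `X ↦ A X B` have the form `L_A U + Z R_B`. -/
theorem exists_of_mul_mul_eq_zero {X : Matrix k l ℍ[ℝ]} (h : A * X * B = 0) :
    X = projL A * X + (pinv A * A * X) * projR B := by
  have : pinv A * A * X * projR B = pinv A * A * X :=
    eq_mul_projR (by rw [Matrix.mul_assoc, Matrix.mul_assoc, ← Matrix.mul_assoc A, h,
      Matrix.mul_zero])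
  rw [this, projL, Matrix.sub_mul, Matrix.one_mul, sub_add_cancel]

theorem TwoTermSolvable.of_eq (hM : M = projR A * C) (hN : N = D * projL B)
    {X : Matrix k l ℍ[ℝ]} {Y : Matrix s t ℍ[ℝ]} (h : A * X * B + C * Y * D = E) :
    TwoTermSolvable A B C D E M N := by
  have hA : projR A * E = M * (Y * D) := by
    rw [← h, hM, Matrix.mul_add]
    simp only [Matrix.mul_assoc, mul_reassoc (projR_mul A), Matrix.zero_mul, zero_add]
  have hB : E * projL B = C * (Y * N) := by
    rw [← h, hN, Matrix.add_mul]
    simp only [Matrix.mul_assoc, mul_projL, Matrix.mul_zero, zero_add]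
  constructor
  · rw [hA, ← Matrix.mul_assoc, projR_mul, Matrix.zero_mul]
  · rw [hB]; simp only [Matrix.mul_assoc, mul_projL, Matrix.mul_zero]
  · rw [hA]; simp only [Matrix.mul_assoc, mul_projL, Matrix.mul_zero]
  · rw [hB, ← Matrix.mul_assoc, projR_mul, Matrix.zero_mul]

/-- Every solution of `A X B + C Y D = E` is given by the general formulas. -/
theorem exists_twoTerm (hM : M = projR A * C)
    (hN : N = D * projL B) (hS : S = C * projL M) {X : Matrix k l ℍ[ℝ]} {Y : Matrix s t ℍ[ℝ]}
    (h : A * X * B + C * Y * D = E) :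
    ∃ V W Z U Z', twoTermFst A B C D E M N S V U Z' = X ∧ twoTermSnd C D E M N S V W Z = Y := by
  have hs := TwoTermSolvable.of_eq hM hN h
  -- The particular solution with all parameters zero; the difference `Y₀` of second components
  -- satisfies `M Y₀ D = 0` and `C Y₀ N = 0`.
  obtain ⟨X₁, Y₁, hY₁, h0⟩ : ∃ X₁ Y₁, Y₁ = twoTermSnd C D E M N S 0 0 0 ∧
      A * X₁ * B + C * Y₁ * D = A * X * B + C * Y * D :=
    ⟨_, _, rfl, (mul_twoTermFst_mul_add hs hM hN hS 0 0 0 0 0).trans h.symm⟩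
  obtain ⟨Y₀, hY₀⟩ : ∃ Y₀, Y₀ = Y - Y₁ := ⟨_, rfl⟩
  have hMD : M * Y₀ * D = 0 := by
    replace h0 := congrArg (fun K => projR A * K) h0
    simp only [Matrix.mul_add, Matrix.mul_assoc, mul_reassoc (projR_mul A), Matrix.zero_mul,
      zero_add] at h0
    rw [hY₀, hM, Matrix.mul_sub, Matrix.sub_mul]
    simp only [Matrix.mul_assoc, h0, sub_self]
  have hCN : C * Y₀ * N = 0 := by
    replace h0 := congrArg (fun K => K * projL B) h0
    simp only [Matrix.add_mul, Matrix.mul_assoc, mul_projL, Matrix.mul_zero, zero_add] at h0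
    rw [hY₀, hN, Matrix.mul_sub, Matrix.sub_mul]
    simp only [Matrix.mul_assoc, h0, sub_self]
  have e1 := exists_of_mul_mul_eq_zero hMD
  -- The `R_D` part of `Y₀` drops out because `N = D L_B`, so only its `L_M` part is left in `C Y₀ N
  -- = 0`, and `C L_M = S`.
  have e2 : S * Y₀ * N = 0 := by
    have hDN : projR D * N = 0 := by rw [hN, ← Matrix.mul_assoc, projR_mul, Matrix.zero_mul]
    rw [e1] at hCN
    simpa only [Matrix.mul_add, Matrix.add_mul, Matrix.mul_assoc, hDN, Matrix.mul_zero, add_zero,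
      hS] using hCN
  have e3 := exists_of_mul_mul_eq_zero e2
  obtain ⟨V, hV⟩ : ∃ V, V = pinv S * S * Y₀ := ⟨_, rfl⟩
  obtain ⟨Z, hZ⟩ : ∃ Z, Z = pinv M * M * Y₀ := ⟨_, rfl⟩
  have hY : twoTermSnd C D E M N S V Y₀ Z = Y := by
    have e4 : Y₀ = projL M * projL S * Y₀ + projL M * V * projR N + Z * projR D := by
      conv_lhs => rw [e1]
      conv_lhs => lhs; rw [e3]
      rw [Matrix.mul_add, hV, hZ]
      simp only [Matrix.mul_assoc]
    rw [eq_sub_iff_add_eq] at hY₀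
    rw [← hY₀, hY₁]
    conv_rhs => lhs; rw [e4]
    simp only [twoTermSnd, Matrix.mul_zero, Matrix.zero_mul, add_zero]
    abel
  -- The two components share the parameter `V`, so it is fixed by `Y` first; `X` then differs from
  -- the formula only by an element of the kernel of `A · B`.
  obtain ⟨X₀, hX₀⟩ : ∃ X₀, X₀ = X - twoTermFst A B C D E M N S V 0 0 := ⟨_, rfl⟩
  have hX : A * X₀ * B = 0 := by
    have h0 := mul_twoTermFst_mul_add hs hM hN hS V Y₀ Z 0 0
    rw [hY] at h0
    rw [hX₀, Matrix.mul_sub, Matrix.sub_mul, sub_eq_zero]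
    exact add_right_cancel (h.trans h0.symm)
  refine ⟨V, Y₀, Z, X₀, pinv A * A * X₀, ?_, hY⟩
  have e5 := exists_of_mul_mul_eq_zero hX
  rw [eq_sub_iff_add_eq] at hX₀
  conv_rhs => rw [← hX₀, e5]
  simp only [twoTermFst, Matrix.mul_zero, Matrix.zero_mul, add_zero]
  abel

end TwoTerm

/-! ### The Sylvester equation `A X + Y B = Q`. -/

section Sylvester

variable {m n k l : Type*} [Fintype m] [Fintype n] [Fintype k] [Fintype l] [DecidableEq m]
  [DecidableEq n] [DecidableEq k] [DecidableEq l]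
  {A : Matrix m k ℍ[ℝ]} {B : Matrix l n ℍ[ℝ]} {Q : Matrix m n ℍ[ℝ]}

/-- The general solution of `A X + Y B = Q` satisfies the equation. -/
theorem sylvester_solves (h : projR A * Q * projL B = 0) (U : Matrix m l ℍ[ℝ])
    (U' : Matrix k n ℍ[ℝ]) (U'' : Matrix m l ℍ[ℝ]) :
    A * (pinv A * Q - (pinv A * U * B + projL A * U')) +
      (projR A * Q * pinv B + (A * pinv A * U + U'' * projR B)) * B = Q := by
  have e : projR A * (Q * (pinv B * B)) = projR A * Q := by
    rw [← Matrix.mul_assoc, mul_pinv_mul_of_projL h]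
  simp only [Matrix.mul_add, Matrix.add_mul, Matrix.mul_sub, Matrix.mul_assoc, projR_mul, e,
    Matrix.mul_zero, mul_reassoc (mul_projL A), Matrix.zero_mul, add_zero]
  simp only [projR, Matrix.sub_mul, Matrix.mul_assoc, Matrix.one_mul]
  abel

/-- Every solution of `A X + Y B = Q` is given by the general formula. -/
theorem exists_sylvester {X : Matrix k n ℍ[ℝ]} {Y : Matrix m l ℍ[ℝ]} (h : A * X + Y * B = Q) :
    ∃ (U : Matrix m l ℍ[ℝ]) (U' : Matrix k n ℍ[ℝ]) (U'' : Matrix m l ℍ[ℝ]),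
      pinv A * Q - (pinv A * U * B + projL A * U') = X ∧
      projR A * Q * pinv B + (A * pinv A * U + U'' * projR B) = Y := by
  refine ⟨Y, -X, projR A * Y, ?_, ?_⟩
  · rw [← h]
    simp only [projL, Matrix.mul_add, Matrix.sub_mul, Matrix.mul_neg, Matrix.one_mul,
      Matrix.mul_assoc]
    abel
  · rw [← h, Matrix.mul_add, ← Matrix.mul_assoc, projR_mul, Matrix.zero_mul, zero_add]
    simp only [projR, Matrix.mul_sub, Matrix.sub_mul, Matrix.one_mul, Matrix.mul_one,
      Matrix.mul_assoc]
    abel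

end Sylvester

/-! ### Rank of quaternion matrices and the block rank criterion. -/

section Rank

variable {m n k l s t : Type*} [Fintype m] [Fintype n] [Fintype k] [Fintype l] [Fintype s]
  [Fintype t]

/-- The right column space of a quaternion matrix. -/
noncomputable abbrev colSpan (A : Matrix m n ℍ[ℝ]) : Submodule ℍ[ℝ]ᵐᵒᵖ (m → ℍ[ℝ]) :=
  Submodule.span ℍ[ℝ]ᵐᵒᵖ (Set.range A.col)

theorem mem_colSpan {A : Matrix m n ℍ[ℝ]} {v : m → ℍ[ℝ]} :
    v ∈ colSpan A ↔ ∃ x : n → ℍ[ℝ], A *ᵥ x = v := by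
  rw [colSpan, Submodule.mem_span_range_iff_exists_fun]
  constructor
  · rintro ⟨c, rfl⟩
    refine ⟨fun j => (c j).unop, ?_⟩
    ext1 i
    simp [Matrix.mulVec, dotProduct, Finset.sum_apply, Matrix.col]
  · rintro ⟨x, rfl⟩
    refine ⟨fun j => MulOpposite.op (x j), ?_⟩
    ext1 i
    simp [Matrix.mulVec, dotProduct, Finset.sum_apply, Matrix.col]

instance finite_colSpan (A : Matrix m n ℍ[ℝ]) : Module.Finite ℍ[ℝ]ᵐᵒᵖ (colSpan A) :=
  FiniteDimensional.span_of_finite _ (Set.finite_range _)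

theorem colSpan_mul_le (A : Matrix m n ℍ[ℝ]) (B : Matrix n k ℍ[ℝ]) :
    colSpan (A * B) ≤ colSpan A := by
  intro v hv
  obtain ⟨x, rfl⟩ := mem_colSpan.1 hv
  exact mem_colSpan.2 ⟨B *ᵥ x, Matrix.mulVec_mulVec _ _ _⟩

theorem exists_eq_mul_of_colSpan_le {A : Matrix m n ℍ[ℝ]} {B : Matrix m k ℍ[ℝ]}
    (h : colSpan A ≤ colSpan B) : ∃ Y : Matrix k n ℍ[ℝ], A = B * Y := by
  have h1 : ∀ j, ∃ x : k → ℍ[ℝ], B *ᵥ x = A.col j := fun j =>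
    mem_colSpan.1 (h (Submodule.subset_span ⟨j, rfl⟩))
  choose x hx using h1
  refine ⟨Matrix.of fun i j => x j i, ?_⟩
  ext1 i j
  exact (congrFun (hx j) i).symm

theorem qrank_mul_le_left (A : Matrix m n ℍ[ℝ]) (B : Matrix n k ℍ[ℝ]) :
    qrank (A * B) ≤ qrank A :=
  Submodule.finrank_mono (colSpan_mul_le A B)

/-- A basis of the right column space supplies `B`, and coordinates supply `C`. A rank bound through
such a factorization avoids comparing row and column spaces: it is what makes right multiplication,
reindexing and the η-star tractable. -/
theorem exists_rank_factorization (A : Matrix m n ℍ[ℝ]) :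
    ∃ (B : Matrix m (Fin (qrank A)) ℍ[ℝ]) (C : Matrix (Fin (qrank A)) n ℍ[ℝ]), A = B * C := by
  let b := Module.finBasis ℍ[ℝ]ᵐᵒᵖ (colSpan A)
  refine ⟨Matrix.of fun i r => (b r : m → ℍ[ℝ]) i, exists_eq_mul_of_colSpan_le ?_⟩
  intro v hv
  rw [mem_colSpan]
  refine ⟨fun r => (b.repr ⟨v, hv⟩ r).unop, ?_⟩
  have h := congrArg Subtype.val (b.sum_repr ⟨v, hv⟩)
  ext1 i
  have h2 := congrFun h i
  rw [Submodule.coe_sum, Finset.sum_apply] at h2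
  exact h2

theorem qrank_mul_le_card (B : Matrix m k ℍ[ℝ]) (C : Matrix k n ℍ[ℝ]) :
    qrank (B * C) ≤ Fintype.card k :=
  (qrank_mul_le_left B C).trans (finrank_range_le_card _)

theorem qrank_mul_le_right (A : Matrix m n ℍ[ℝ]) (B : Matrix n k ℍ[ℝ]) :
    qrank (A * B) ≤ qrank B := by
  obtain ⟨X, Y, h⟩ := exists_rank_factorization B
  calc qrank (A * B) = qrank (A * X * Y) := by rw [Matrix.mul_assoc, ← h]
    _ ≤ _ := (qrank_mul_le_card _ _).trans_eq (Fintype.card_fin _)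

theorem qrank_submatrix_le (A : Matrix m n ℍ[ℝ]) (f : k → m) (g : l → n) :
    qrank (A.submatrix f g) ≤ qrank A := by
  obtain ⟨X, Y, h⟩ := exists_rank_factorization A
  have e : A.submatrix f g = X.submatrix f id * Y.submatrix id g := by
    conv_lhs => rw [h]
    rfl
  rw [e]
  exact (qrank_mul_le_card _ _).trans_eq (Fintype.card_fin _)

theorem qrank_submatrix (A : Matrix m n ℍ[ℝ]) (f : k ≃ m) (g : l ≃ n) :
    qrank (A.submatrix f g) = qrank A := by
  refine le_antisymm (qrank_submatrix_le A f g) ?_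
  have := qrank_submatrix_le (A.submatrix f g) f.symm g.symm
  simpa using this

theorem qrank_etaStar_le {η : ℍ[ℝ]} (hη : IsBasicUnit η) (A : Matrix m n ℍ[ℝ]) :
    qrank (etaStar η A) ≤ qrank A := by
  obtain ⟨X, Y, h⟩ := exists_rank_factorization A
  conv_lhs => rw [h, etaStar_mul hη]
  exact (qrank_mul_le_card _ _).trans_eq (Fintype.card_fin _)

theorem qrank_etaStar {η : ℍ[ℝ]} (hη : IsBasicUnit η) (A : Matrix m n ℍ[ℝ]) :
    qrank (etaStar η A) = qrank A :=
  le_antisymm (qrank_etaStar_le hη A) <| by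
    simpa only [etaStar_etaStar hη] using qrank_etaStar_le hη (etaStar η A)

/-- The column space of `A * B` lies in that of `A`; equal dimensions force equality, and then every
column of `A` is a combination of columns of `A * B`. -/
theorem exists_eq_mul_mul_of_qrank_le {A : Matrix m n ℍ[ℝ]} {B : Matrix n k ℍ[ℝ]}
    (h : qrank A ≤ qrank (A * B)) : ∃ Y : Matrix k n ℍ[ℝ], A = A * B * Y :=
  exists_eq_mul_of_colSpan_le
    (Submodule.eq_of_le_of_finrank_le (colSpan_mul_le A B) h).ge

theorem qrank_fromCols_iff [DecidableEq k] (W : Matrix m n ℍ[ℝ]) (P : Matrix m k ℍ[ℝ]) :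
    qrank (fromCols W P) = qrank P ↔ ∃ a : Matrix k n ℍ[ℝ], W = P * a := by
  have hP : P = fromCols W P * fromRows (0 : Matrix n k ℍ[ℝ]) (1 : Matrix k k ℍ[ℝ]) := by
    rw [fromCols_mul_fromRows, Matrix.mul_zero, zero_add, Matrix.mul_one]
  constructor
  · intro h
    obtain ⟨Y, hY⟩ := exists_eq_mul_mul_of_qrank_le
      (A := fromCols W P) (B := fromRows (0 : Matrix n k ℍ[ℝ]) (1 : Matrix k k ℍ[ℝ])) (by rw [← hP, h])
    rw [← hP] at hY
    refine ⟨Y.submatrix id Sum.inl, ?_⟩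
    ext1 i j
    exact congrFun (congrFun hY i) (Sum.inl j)
  · rintro ⟨a, rfl⟩
    refine le_antisymm ?_ ?_
    · have : fromCols (P * a) P = P * fromCols a (1 : Matrix k k ℍ[ℝ]) := by rw [mul_fromCols, Matrix.mul_one]
      rw [this]
      exact qrank_mul_le_left _ _
    · conv_lhs => rw [hP]
      exact qrank_mul_le_left _ _

theorem qrank_fromCols_comm (A : Matrix m n ℍ[ℝ]) (B : Matrix m k ℍ[ℝ]) :
    qrank (fromCols A B) = qrank (fromCols B A) := by
  rw [← qrank_submatrix (fromCols B A) (Equiv.refl m) (Equiv.sumComm n k)]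
  congr 1
  ext i (j | j) <;> rfl

/-- The upper bound comes from putting rank factorizations of both blocks together, the lower one
from the injection of the product of the two column spaces into the column space of the block
matrix. -/
theorem qrank_antidiagonal (P : Matrix m n ℍ[ℝ]) (Q : Matrix k l ℍ[ℝ]) :
    qrank (fromBlocks 0 P Q 0) = qrank P + qrank Q := by
  refine le_antisymm ?_ ?_
  · obtain ⟨X, Y, h⟩ := exists_rank_factorization P
    obtain ⟨X', Y', h'⟩ := exists_rank_factorization Q
    have e : fromBlocks 0 P Q 0 = fromBlocks X 0 0 X' * fromBlocks 0 Y Y' 0 := by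
      rw [fromBlocks_multiply, ← h, ← h']
      simp
    rw [e]
    refine (qrank_mul_le_card _ _).trans_eq ?_
    rw [Fintype.card_sum, Fintype.card_fin, Fintype.card_fin]
  · let f : (colSpan P × colSpan Q) →ₗ[ℍ[ℝ]ᵐᵒᵖ] (m ⊕ k → ℍ[ℝ]) :=
      (LinearEquiv.sumArrowLequivProdArrow m k ℍ[ℝ]ᵐᵒᵖ ℍ[ℝ]).symm.toLinearMap ∘ₗ
        LinearMap.prodMap (colSpan P).subtype (colSpan Q).subtype
    have hf : Function.Injective f :=
      (LinearEquiv.sumArrowLequivProdArrow m k ℍ[ℝ]ᵐᵒᵖ ℍ[ℝ]).symm.injective.comp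
        (Function.Injective.prodMap Subtype.val_injective Subtype.val_injective)
    have hr : ∀ x, f x ∈ colSpan (fromBlocks 0 P Q 0) := by
      rintro ⟨⟨p, hp⟩, ⟨q, hq⟩⟩
      obtain ⟨x, rfl⟩ := mem_colSpan.1 hp
      obtain ⟨y, rfl⟩ := mem_colSpan.1 hq
      refine mem_colSpan.2 ⟨Sum.elim y x, ?_⟩
      rw [fromBlocks_mulVec]
      simp only [Sum.elim_comp_inl, Sum.elim_comp_inr, Matrix.zero_mulVec, zero_add, add_zero]
      rfl
    have := LinearMap.finrank_le_finrank_of_injective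
      (f := f.codRestrict _ hr) fun x y h => hf (congrArg Subtype.val h)
    rwa [Module.finrank_prod] at this

/-- Block row and column operations, undone by reversing the signs of `a` and `b`, clear the corner.
-/
theorem qrank_fromBlocks_of_eq [DecidableEq m] [DecidableEq n] [DecidableEq k] [DecidableEq l]
    (P : Matrix m n ℍ[ℝ]) (Q : Matrix k l ℍ[ℝ]) (a : Matrix n l ℍ[ℝ]) (b : Matrix m k ℍ[ℝ]) :
    qrank (fromBlocks (P * a + b * Q) P Q 0) = qrank P + qrank Q := by
  rw [← qrank_antidiagonal]
  refine le_antisymm ?_ ?_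
  · have e : fromBlocks (P * a + b * Q) P Q 0 =
        (fromBlocks 1 b 0 1 : Matrix (m ⊕ k) (m ⊕ k) ℍ[ℝ]) * fromBlocks 0 P Q 0 *
          (fromBlocks 1 0 a 1 : Matrix (l ⊕ n) (l ⊕ n) ℍ[ℝ]) := by
      simp [fromBlocks_multiply, add_comm]
    rw [e]
    exact (qrank_mul_le_left _ _).trans (qrank_mul_le_right _ _)
  · have e : fromBlocks 0 P Q 0 =
        (fromBlocks 1 (-b) 0 1 : Matrix (m ⊕ k) (m ⊕ k) ℍ[ℝ]) *
          fromBlocks (P * a + b * Q) P Q 0 *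
          (fromBlocks 1 0 (-a) 1 : Matrix (l ⊕ n) (l ⊕ n) ℍ[ℝ]) := by
      simp [fromBlocks_multiply]
    rw [e]
    exact (qrank_mul_le_left _ _).trans (qrank_mul_le_right _ _)

/-- Multiplying on the right by `diag(Q†Q, 1)` replaces `W` by `W Q†Q` and makes the rank exactly
`r(P) + r(Q)`. If the rank was already that, the column space has not shrunk, and the original
matrix factors through the new one; comparing the first block column shows that `W - W Q†Q` has the
form `P a`. -/
theorem qrank_fromBlocks_iff [DecidableEq m] [DecidableEq n] [DecidableEq k] [DecidableEq l]
    (W : Matrix m l ℍ[ℝ]) (P : Matrix m n ℍ[ℝ]) (Q : Matrix k l ℍ[ℝ]) :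
    qrank (fromBlocks W P Q 0) = qrank P + qrank Q ↔
      ∃ (a : Matrix n l ℍ[ℝ]) (b : Matrix m k ℍ[ℝ]), W = P * a + b * Q := by
  constructor
  · intro h
    have e : fromBlocks W P Q 0 * (fromBlocks (pinv Q * Q) 0 0 1 : Matrix (l ⊕ n) (l ⊕ n) ℍ[ℝ]) =
        fromBlocks (P * (0 : Matrix n l ℍ[ℝ]) + W * pinv Q * Q) P Q 0 := by
      simp [fromBlocks_multiply, mul_pinv_mul, Matrix.mul_assoc]
    obtain ⟨Y, hY⟩ := exists_eq_mul_mul_of_qrank_le (A := fromBlocks W P Q 0)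
      (B := (fromBlocks (pinv Q * Q) 0 0 1 : Matrix (l ⊕ n) (l ⊕ n) ℍ[ℝ])) (by rw [e, qrank_fromBlocks_of_eq, h])
    rw [e, ← fromBlocks_toBlocks Y, fromBlocks_multiply, fromBlocks_inj] at hY
    obtain ⟨h1, -, h3, -⟩ := hY
    rw [Matrix.zero_mul, add_zero] at h3
    rw [Matrix.mul_zero, zero_add, Matrix.mul_assoc, ← h3, add_comm] at h1
    exact ⟨_, _, h1⟩
  · rintro ⟨a, b, rfl⟩
    exact qrank_fromBlocks_of_eq P Q a b

end Rank

/-! ### Reindexing of block matrices. -/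

section Blocks

variable {a b c d e f g h : Type*}

/-- Regrouping of four summands with the second one last. -/
def sumRegroupSnd : a ⊕ b ⊕ c ⊕ d ≃ (a ⊕ c ⊕ d) ⊕ b where
  toFun
    | .inl x => .inl (.inl x)
    | .inr (.inl x) => .inr x
    | .inr (.inr (.inl x)) => .inl (.inr (.inl x))
    | .inr (.inr (.inr x)) => .inl (.inr (.inr x))
  invFun
    | .inl (.inl x) => .inl x
    | .inr x => .inr (.inl x)
    | .inl (.inr (.inl x)) => .inr (.inr (.inl x))
    | .inl (.inr (.inr x)) => .inr (.inr (.inr x))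
  left_inv := by rintro (x | x | x | x) <;> rfl
  right_inv := by rintro ((x | x | x) | x) <;> rfl

/-- Regrouping of four summands with the two middle ones last. -/
def sumRegroupMid : a ⊕ b ⊕ c ⊕ d ≃ (a ⊕ d) ⊕ (b ⊕ c) where
  toFun
    | .inl x => .inl (.inl x)
    | .inr (.inl x) => .inr (.inl x)
    | .inr (.inr (.inl x)) => .inr (.inr x)
    | .inr (.inr (.inr x)) => .inl (.inr x)
  invFun
    | .inl (.inl x) => .inl x
    | .inr (.inl x) => .inr (.inl x)
    | .inr (.inr x) => .inr (.inr (.inl x))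
    | .inl (.inr x) => .inr (.inr (.inr x))
  left_inv := by rintro (x | x | x | x) <;> rfl
  right_inv := by rintro ((x | x) | (x | x)) <;> rfl

/-- Regrouping of eight summands with the third, fourth and fifth last. -/
def sumRegroupEight :
    a ⊕ b ⊕ c ⊕ d ⊕ e ⊕ f ⊕ g ⊕ h ≃ (a ⊕ b ⊕ f ⊕ g ⊕ h) ⊕ (c ⊕ d ⊕ e) where
  toFun
    | .inl x => .inl (.inl x)
    | .inr (.inl x) => .inl (.inr (.inl x))
    | .inr (.inr (.inl x)) => .inr (.inl x)
    | .inr (.inr (.inr (.inl x))) => .inr (.inr (.inl x))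
    | .inr (.inr (.inr (.inr (.inl x)))) => .inr (.inr (.inr x))
    | .inr (.inr (.inr (.inr (.inr (.inl x))))) => .inl (.inr (.inr (.inl x)))
    | .inr (.inr (.inr (.inr (.inr (.inr (.inl x)))))) => .inl (.inr (.inr (.inr (.inl x))))
    | .inr (.inr (.inr (.inr (.inr (.inr (.inr x)))))) => .inl (.inr (.inr (.inr (.inr x))))
  invFun
    | .inl (.inl x) => .inl x
    | .inl (.inr (.inl x)) => .inr (.inl x)
    | .inr (.inl x) => .inr (.inr (.inl x))
    | .inr (.inr (.inl x)) => .inr (.inr (.inr (.inl x)))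
    | .inr (.inr (.inr x)) => .inr (.inr (.inr (.inr (.inl x))))
    | .inl (.inr (.inr (.inl x))) => .inr (.inr (.inr (.inr (.inr (.inl x)))))
    | .inl (.inr (.inr (.inr (.inl x)))) => .inr (.inr (.inr (.inr (.inr (.inr (.inl x))))))
    | .inl (.inr (.inr (.inr (.inr x)))) => .inr (.inr (.inr (.inr (.inr (.inr (.inr x))))))
  left_inv := by rintro (x | x | x | x | x | x | x | x) <;> rfl
  right_inv := by rintro ((x | x | x | x | x) | (x | x | x)) <;> rfl

/-- Exchange of the first two of three summands. -/
def sumSwapThree : b ⊕ a ⊕ c ≃ a ⊕ b ⊕ c where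
  toFun
    | .inl x => .inr (.inl x)
    | .inr (.inl x) => .inl x
    | .inr (.inr x) => .inr (.inr x)
  invFun
    | .inr (.inl x) => .inl x
    | .inl x => .inr (.inl x)
    | .inr (.inr x) => .inr (.inr x)
  left_inv := by rintro (x | x | x) <;> rfl
  right_inv := by rintro (x | x | x) <;> rfl

/-- Exchange of the first two and of the next two of five summands. -/
def sumSwapFive : b ⊕ a ⊕ d ⊕ c ⊕ e ≃ a ⊕ b ⊕ c ⊕ d ⊕ e where
  toFun
    | .inl x => .inr (.inl x)
    | .inr (.inl x) => .inl x
    | .inr (.inr (.inl x)) => .inr (.inr (.inr (.inl x)))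
    | .inr (.inr (.inr (.inl x))) => .inr (.inr (.inl x))
    | .inr (.inr (.inr (.inr x))) => .inr (.inr (.inr (.inr x)))
  invFun
    | .inr (.inl x) => .inl x
    | .inl x => .inr (.inl x)
    | .inr (.inr (.inr (.inl x))) => .inr (.inr (.inl x))
    | .inr (.inr (.inl x)) => .inr (.inr (.inr (.inl x)))
    | .inr (.inr (.inr (.inr x))) => .inr (.inr (.inr (.inr x)))
  left_inv := by rintro (x | x | x | x | x) <;> rfl
  right_inv := by rintro (x | x | x | x | x) <;> rfl

theorem fromRows_add_fromRows (A C : Matrix a c ℍ[ℝ]) (B D : Matrix b c ℍ[ℝ]) :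
    fromRows A B + fromRows C D = fromRows (A + C) (B + D) := by
  ext (i | i) j <;> rfl

theorem fromCols_add_fromCols (A C : Matrix c a ℍ[ℝ]) (B D : Matrix c b ℍ[ℝ]) :
    fromCols A B + fromCols C D = fromCols (A + C) (B + D) := by
  ext i (j | j) <;> rfl

theorem etaStar_fromRows {η : ℍ[ℝ]} (A : Matrix a c ℍ[ℝ]) (B : Matrix b c ℍ[ℝ]) :
    etaStar η (fromRows A B) = fromCols (etaStar η A) (etaStar η B) := by
  ext i (j | j) <;> rfl

theorem etaStar_fromCols {η : ℍ[ℝ]} (A : Matrix c a ℍ[ℝ]) (B : Matrix c b ℍ[ℝ]) :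
    etaStar η (fromCols A B) = fromRows (etaStar η A) (etaStar η B) := by
  ext (i | i) j <;> rfl

end Blocks

/-! ### Solvability of `W = P a + b Q` and its annihilators. -/

section Residual

variable {m n k l : Type*} [Fintype m] [Fintype n] [Fintype k] [Fintype l]

/-- The solvability of `W = P a + b Q` depends on `W` only up to the set of all `P a + b Q`. -/
theorem exists_mul_add_mul_congr {W W' : Matrix m l ℍ[ℝ]} {P : Matrix m n ℍ[ℝ]}
    {Q : Matrix k l ℍ[ℝ]} {a₀ : Matrix n l ℍ[ℝ]} {b₀ : Matrix m k ℍ[ℝ]}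
    (h : W = W' + (P * a₀ + b₀ * Q)) :
    (∃ (a : Matrix n l ℍ[ℝ]) (b : Matrix m k ℍ[ℝ]), W = P * a + b * Q) ↔
      ∃ (a : Matrix n l ℍ[ℝ]) (b : Matrix m k ℍ[ℝ]), W' = P * a + b * Q := by
  subst h
  constructor
  · rintro ⟨a, b, h⟩
    refine ⟨a - a₀, b - b₀, ?_⟩
    rw [Matrix.mul_sub, Matrix.sub_mul, eq_sub_of_add_eq h]
    abel
  · rintro ⟨a, b, rfl⟩
    refine ⟨a + a₀, b + b₀, ?_⟩
    rw [Matrix.mul_add, Matrix.add_mul]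
    abel

theorem mul_mul_eq_zero_of_exists {r r' : Type*} {W : Matrix m l ℍ[ℝ]} {P : Matrix m n ℍ[ℝ]}
    {Q : Matrix k l ℍ[ℝ]} {u : Matrix r m ℍ[ℝ]} {v : Matrix l r' ℍ[ℝ]}
    (h : ∃ (a : Matrix n l ℍ[ℝ]) (b : Matrix m k ℍ[ℝ]), W = P * a + b * Q)
    (hu : u * P = 0) (hv : Q * v = 0) : u * (W * v) = 0 := by
  obtain ⟨a, b, rfl⟩ := h
  rw [Matrix.add_mul, Matrix.mul_add, Matrix.mul_assoc, Matrix.mul_assoc, hv,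
    ← Matrix.mul_assoc, hu, Matrix.zero_mul, Matrix.mul_zero, Matrix.mul_zero, add_zero]

end Residual

/-! ### The five block rank equalities in terms of a residual `T`. -/

section BlockRank

variable {p m₁ m₂ m₃ n₁ n₂ n₃ r r' : Type*} [Fintype p] [Fintype m₁] [Fintype m₂] [Fintype m₃]
  [Fintype n₁] [Fintype n₂] [Fintype n₃] [DecidableEq p] [DecidableEq m₁] [DecidableEq m₂]
  [DecidableEq m₃] [DecidableEq n₁] [DecidableEq n₂] [DecidableEq n₃] {η : ℍ[ℝ]}
  {A₁ C₁ : Matrix m₁ n₁ ℍ[ℝ]} {A₂ C₂ : Matrix m₂ n₂ ℍ[ℝ]} {A₃ C₃ : Matrix m₃ n₃ ℍ[ℝ]}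
  {E₁ : Matrix p n₁ ℍ[ℝ]} {E₂ : Matrix p n₂ ℍ[ℝ]} {E₃ : Matrix p n₃ ℍ[ℝ]}
  {C T : Matrix p p ℍ[ℝ]}
  {X : Matrix n₁ n₁ ℍ[ℝ]} {Y : Matrix n₂ n₂ ℍ[ℝ]} {Z : Matrix n₃ n₃ ℍ[ℝ]}

theorem IsEtaHermitian.mul_etaStar (hη : IsBasicUnit η) (hX : IsEtaHermitian η X)
    (h : A₁ * X = C₁) : X * etaStar η A₁ = etaStar η C₁ := by
  conv_lhs => lhs; rw [hX]
  rw [← etaStar_mul hη, h]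

theorem mul_eq_of_mul_projL {R : Matrix r p ℍ[ℝ]} (h : R * (E₁ * projL A₁) = 0) :
    R * (E₁ * (pinv A₁ * A₁)) = R * E₁ := by
  rw [← Matrix.mul_assoc] at h
  rw [← Matrix.mul_assoc, mul_pinv_mul_of_projL h]

/-- If `R` kills `E₁ L_{A₁}`, then `R E₁ = (R E₁ A₁†) A₁`. The η-star of this relation gives the
entries of the right annihilators used below. -/
theorem etaStar_mul_of_mul_projL (hη : IsBasicUnit η) {R : Matrix r p ℍ[ℝ]}
    (h : R * (E₁ * projL A₁) = 0) :
    etaStar η E₁ * etaStar η R + -(etaStar η A₁ * etaStar η (R * (E₁ * pinv A₁))) = 0 := by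
  rw [← sub_eq_add_neg, ← etaStar_mul hη, ← etaStar_mul hη, Matrix.mul_assoc, Matrix.mul_assoc,
    mul_eq_of_mul_projL h, sub_self]

/-- Because `A₃Z = C₃` and so on, the column headed by `C` equals the column headed by `T` plus the
coefficient block times the explicit `a₀`. Only the residual matters, for any choice of solutions
`X, Y, Z` of the one-sided equations; this and the next three criteria are used with `T = 0` and
with `T = T₁`. -/
theorem qrank_column_iff (hX : A₁ * X = C₁) (hY : A₂ * Y = C₂) (hZ : A₃ * Z = C₃)
    (hT : C = T + E₁ * X * etaStar η E₁ + E₂ * Y * etaStar η E₂ + E₃ * Z * etaStar η E₃) :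
    qrank (C                 ⊕ᶜ E₃ ⊕ᶜ E₁ ⊕ᶜ E₂ ⊕ʳ
          C₃ * etaStar η E₃ ⊕ᶜ A₃ ⊕ᶜ 0  ⊕ᶜ 0  ⊕ʳ
          C₁ * etaStar η E₁ ⊕ᶜ 0  ⊕ᶜ A₁ ⊕ᶜ 0  ⊕ʳ
          C₂ * etaStar η E₂ ⊕ᶜ 0  ⊕ᶜ 0  ⊕ᶜ A₂)
      = qrank (E₃ ⊕ᶜ E₁ ⊕ᶜ E₂ ⊕ʳ A₃ ⊕ᶜ 0 ⊕ᶜ 0 ⊕ʳ 0 ⊕ᶜ A₁ ⊕ᶜ 0 ⊕ʳ 0 ⊕ᶜ 0 ⊕ᶜ A₂) ↔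
    ∃ a : Matrix (n₃ ⊕ n₁ ⊕ n₂) p ℍ[ℝ], (T ⊕ʳ 0 ⊕ʳ 0 ⊕ʳ 0) =
      (E₃ ⊕ᶜ E₁ ⊕ᶜ E₂ ⊕ʳ A₃ ⊕ᶜ 0 ⊕ᶜ 0 ⊕ʳ 0 ⊕ᶜ A₁ ⊕ᶜ 0 ⊕ʳ 0 ⊕ᶜ 0 ⊕ᶜ A₂) * a := by
  have e : (C                 ⊕ᶜ E₃ ⊕ᶜ E₁ ⊕ᶜ E₂ ⊕ʳ
          C₃ * etaStar η E₃ ⊕ᶜ A₃ ⊕ᶜ 0  ⊕ᶜ 0  ⊕ʳ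
          C₁ * etaStar η E₁ ⊕ᶜ 0  ⊕ᶜ A₁ ⊕ᶜ 0  ⊕ʳ
          C₂ * etaStar η E₂ ⊕ᶜ 0  ⊕ᶜ 0  ⊕ᶜ A₂) =
      (C ⊕ʳ C₃ * etaStar η E₃ ⊕ʳ C₁ * etaStar η E₁ ⊕ʳ C₂ * etaStar η E₂) ⊕ᶜ
      (E₃ ⊕ᶜ E₁ ⊕ᶜ E₂ ⊕ʳ A₃ ⊕ᶜ 0 ⊕ᶜ 0 ⊕ʳ 0 ⊕ᶜ A₁ ⊕ᶜ 0 ⊕ʳ 0 ⊕ᶜ 0 ⊕ᶜ A₂) := by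
    ext1 i j
    rcases i with i | i | i | i <;> rcases j with j | j | j | j <;> rfl
  rw [e, qrank_fromCols_iff]
  obtain ⟨a₀, ha₀⟩ : ∃ a₀ : Matrix (n₃ ⊕ n₁ ⊕ n₂) p ℍ[ℝ],
      (C ⊕ʳ C₃ * etaStar η E₃ ⊕ʳ C₁ * etaStar η E₁ ⊕ʳ C₂ * etaStar η E₂) = (T ⊕ʳ 0 ⊕ʳ 0 ⊕ʳ 0) +
      (E₃ ⊕ᶜ E₁ ⊕ᶜ E₂ ⊕ʳ A₃ ⊕ᶜ 0 ⊕ᶜ 0 ⊕ʳ 0 ⊕ᶜ A₁ ⊕ᶜ 0 ⊕ʳ 0 ⊕ᶜ 0 ⊕ᶜ A₂) * a₀ := by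
    refine ⟨Z * etaStar η E₃ ⊕ʳ X * etaStar η E₁ ⊕ʳ Y * etaStar η E₂, ?_⟩
    simp only [fromRows_mul, fromCols_mul_fromRows, fromRows_add_fromRows, Matrix.zero_mul,
      zero_add, add_zero, ← Matrix.mul_assoc, hX, hY, hZ]
    rw [hT]
    congr 1
    abel
  rw [ha₀]
  constructor
  · rintro ⟨a, h⟩
    exact ⟨a - a₀, by rw [Matrix.mul_sub, ← h, add_sub_cancel_right]⟩
  · rintro ⟨a, h⟩
    exact ⟨a + a₀, by rw [Matrix.mul_add, ← h]⟩

theorem mul_eq_zero_of_qrank_column (hX : A₁ * X = C₁) (hY : A₂ * Y = C₂) (hZ : A₃ * Z = C₃)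
    (hT : C = T + E₁ * X * etaStar η E₁ + E₂ * Y * etaStar η E₂ + E₃ * Z * etaStar η E₃)
    (h : qrank (C           ⊕ᶜ E₃ ⊕ᶜ E₁ ⊕ᶜ E₂ ⊕ʳ
          C₃ * etaStar η E₃ ⊕ᶜ A₃ ⊕ᶜ 0  ⊕ᶜ 0  ⊕ʳ
          C₁ * etaStar η E₁ ⊕ᶜ 0  ⊕ᶜ A₁ ⊕ᶜ 0  ⊕ʳ
          C₂ * etaStar η E₂ ⊕ᶜ 0  ⊕ᶜ 0  ⊕ᶜ A₂)
      = qrank (E₃ ⊕ᶜ E₁ ⊕ᶜ E₂ ⊕ʳ A₃ ⊕ᶜ 0 ⊕ᶜ 0 ⊕ʳ 0 ⊕ᶜ A₁ ⊕ᶜ 0 ⊕ʳ 0 ⊕ᶜ 0 ⊕ᶜ A₂))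
    {R : Matrix r p ℍ[ℝ]} (h₁ : R * (E₁ * projL A₁) = 0) (h₂ : R * (E₂ * projL A₂) = 0)
    (h₃ : R * (E₃ * projL A₃) = 0) : R * T = 0 := by
  obtain ⟨a, ha⟩ := (qrank_column_iff hX hY hZ hT).1 h
  -- The entries after `R` are chosen to cancel `R Eᵢ` against `Aᵢ`, which works as `R Eᵢ Aᵢ†Aᵢ = R
  -- Eᵢ`.
  have hu : (R ⊕ᶜ -(R * (E₃ * pinv A₃)) ⊕ᶜ -(R * (E₁ * pinv A₁)) ⊕ᶜ -(R * (E₂ * pinv A₂))) *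
      (E₃ ⊕ᶜ E₁ ⊕ᶜ E₂ ⊕ʳ A₃ ⊕ᶜ 0 ⊕ᶜ 0 ⊕ʳ 0 ⊕ᶜ A₁ ⊕ᶜ 0 ⊕ʳ 0 ⊕ᶜ 0 ⊕ᶜ A₂) = 0 := by
    simp only [fromCols_mul_fromRows, mul_fromCols, fromCols_add_fromCols, fromCols_neg,
      neg_zero, Matrix.mul_zero, add_zero, zero_add, Matrix.neg_mul, Matrix.mul_assoc, mul_eq_of_mul_projL h₁,
      mul_eq_of_mul_projL h₂, mul_eq_of_mul_projL h₃, add_neg_cancel, fromCols_zero]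
  have h0 : (R ⊕ᶜ -(R * (E₃ * pinv A₃)) ⊕ᶜ -(R * (E₁ * pinv A₁)) ⊕ᶜ -(R * (E₂ * pinv A₂))) *
      (T ⊕ʳ 0 ⊕ʳ 0 ⊕ʳ 0 : Matrix (p ⊕ m₃ ⊕ m₁ ⊕ m₂) p ℍ[ℝ]) = 0 := by
    rw [ha, ← Matrix.mul_assoc, hu, Matrix.zero_mul]
  simpa only [fromCols_mul_fromRows, Matrix.mul_zero, add_zero] using h0

theorem qrank_two_left_iff (hη : IsBasicUnit η) (hX : A₁ * X = C₁) (hY : A₂ * Y = C₂)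
    (hYh : IsEtaHermitian η Y) (hZ : A₃ * Z = C₃)
    (hT : C = T + E₁ * X * etaStar η E₁ + E₂ * Y * etaStar η E₂ + E₃ * Z * etaStar η E₃) :
    qrank (C                 ⊕ᶜ E₃ ⊕ᶜ E₁ ⊕ᶜ E₂ * etaStar η C₂ ⊕ʳ
          etaStar η E₂      ⊕ᶜ 0  ⊕ᶜ 0  ⊕ᶜ etaStar η A₂ ⊕ʳ
          C₃ * etaStar η E₃ ⊕ᶜ A₃ ⊕ᶜ 0  ⊕ᶜ 0 ⊕ʳ
          C₁ * etaStar η E₁ ⊕ᶜ 0  ⊕ᶜ A₁ ⊕ᶜ 0)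
      = qrank (E₃ ⊕ᶜ E₁ ⊕ʳ A₃ ⊕ᶜ 0 ⊕ʳ 0 ⊕ᶜ A₁) + qrank (E₂ ⊕ʳ A₂) ↔
    ∃ (a : Matrix (n₃ ⊕ n₁) (p ⊕ m₂) ℍ[ℝ]) (b : Matrix (p ⊕ m₃ ⊕ m₁) n₂ ℍ[ℝ]),
      (T ⊕ᶜ 0 ⊕ʳ 0 ⊕ᶜ 0 ⊕ʳ 0 ⊕ᶜ 0) =
        (E₃ ⊕ᶜ E₁ ⊕ʳ A₃ ⊕ᶜ 0 ⊕ʳ 0 ⊕ᶜ A₁) * a + b * (etaStar η E₂ ⊕ᶜ etaStar η A₂) := by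
  have e : (C                ⊕ᶜ E₃ ⊕ᶜ E₁ ⊕ᶜ E₂ * etaStar η C₂ ⊕ʳ
          etaStar η E₂      ⊕ᶜ 0  ⊕ᶜ 0  ⊕ᶜ etaStar η A₂ ⊕ʳ
          C₃ * etaStar η E₃ ⊕ᶜ A₃ ⊕ᶜ 0  ⊕ᶜ 0 ⊕ʳ
          C₁ * etaStar η E₁ ⊕ᶜ 0  ⊕ᶜ A₁ ⊕ᶜ 0) =
      (fromBlocks (C ⊕ᶜ E₂ * etaStar η C₂ ⊕ʳ C₃ * etaStar η E₃ ⊕ᶜ 0 ⊕ʳ C₁ * etaStar η E₁ ⊕ᶜ 0)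
        (E₃ ⊕ᶜ E₁ ⊕ʳ A₃ ⊕ᶜ 0 ⊕ʳ 0 ⊕ᶜ A₁) (etaStar η E₂ ⊕ᶜ etaStar η A₂) 0).submatrix
          sumRegroupSnd sumRegroupMid := by
    ext1 i j
    rcases i with i | i | i | i <;> rcases j with j | j | j | j <;> rfl
  rw [e, qrank_submatrix, ← qrank_etaStar hη (E₂ ⊕ʳ A₂), etaStar_fromRows, qrank_fromBlocks_iff]
  -- The `X` and `Z` terms are absorbed from the left block; the `Y` term goes to the right block,
  -- where η-Hermitian symmetry gives `Y A₂^{η*} = C₂^{η*}`.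
  refine exists_mul_add_mul_congr
    (a₀ := Z * etaStar η E₃ ⊕ᶜ 0 ⊕ʳ X * etaStar η E₁ ⊕ᶜ 0) (b₀ := E₂ * Y ⊕ʳ 0 ⊕ʳ 0) ?_
  simp only [fromRows_mul, fromCols_mul_fromRows, Matrix.zero_mul]
  simp only [mul_fromCols, fromRows_add_fromRows,
    fromCols_add_fromCols, Matrix.mul_zero, zero_add, add_zero, Matrix.mul_assoc, hYh.mul_etaStar hη hY, mul_reassoc hX, mul_reassoc hZ]
  rw [hT]
  simp only [Matrix.mul_assoc]
  congr 2
  abel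

theorem mul_mul_eq_zero_of_qrank_two_left (hη : IsBasicUnit η) (hX : A₁ * X = C₁)
    (hY : A₂ * Y = C₂) (hYh : IsEtaHermitian η Y) (hZ : A₃ * Z = C₃)
    (hT : C = T + E₁ * X * etaStar η E₁ + E₂ * Y * etaStar η E₂ + E₃ * Z * etaStar η E₃)
    (h : qrank (C           ⊕ᶜ E₃ ⊕ᶜ E₁ ⊕ᶜ E₂ * etaStar η C₂ ⊕ʳ
          etaStar η E₂      ⊕ᶜ 0  ⊕ᶜ 0  ⊕ᶜ etaStar η A₂ ⊕ʳ
          C₃ * etaStar η E₃ ⊕ᶜ A₃ ⊕ᶜ 0  ⊕ᶜ 0 ⊕ʳ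
          C₁ * etaStar η E₁ ⊕ᶜ 0  ⊕ᶜ A₁ ⊕ᶜ 0)
      = qrank (E₃ ⊕ᶜ E₁ ⊕ʳ A₃ ⊕ᶜ 0 ⊕ʳ 0 ⊕ᶜ A₁) + qrank (E₂ ⊕ʳ A₂))
    {R : Matrix r p ℍ[ℝ]} {R' : Matrix r' p ℍ[ℝ]} (h₁ : R * (E₁ * projL A₁) = 0)
    (h₃ : R * (E₃ * projL A₃) = 0) (h₂ : R' * (E₂ * projL A₂) = 0) :
    R * (T * etaStar η R') = 0 := by
  have h0 := mul_mul_eq_zero_of_exists ((qrank_two_left_iff hη hX hY hYh hZ hT).1 h)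
    (u := R ⊕ᶜ -(R * (E₃ * pinv A₃)) ⊕ᶜ -(R * (E₁ * pinv A₁)))
    (v := etaStar η R' ⊕ʳ -etaStar η (R' * (E₂ * pinv A₂))) ?_ ?_
  · simpa only [fromCols_mul_fromRows, fromRows_mul, Matrix.zero_mul, Matrix.mul_zero,
      add_zero] using h0
  · simp only [fromCols_mul_fromRows, mul_fromCols, fromCols_add_fromCols, fromCols_neg,
      neg_zero, Matrix.mul_zero, add_zero, zero_add, Matrix.neg_mul, Matrix.mul_assoc,
      mul_eq_of_mul_projL h₁, mul_eq_of_mul_projL h₃, add_neg_cancel, fromCols_zero]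
  · rw [fromCols_mul_fromRows, Matrix.mul_neg, etaStar_mul_of_mul_projL hη h₂]

theorem qrank_one_left_iff (hη : IsBasicUnit η) (hX : A₁ * X = C₁) (hXh : IsEtaHermitian η X)
    (hY : A₂ * Y = C₂) (hYh : IsEtaHermitian η Y) (hZ : A₃ * Z = C₃)
    (hT : C = T + E₁ * X * etaStar η E₁ + E₂ * Y * etaStar η E₂ + E₃ * Z * etaStar η E₃) :
    qrank (C                 ⊕ᶜ E₃ ⊕ᶜ E₁ * etaStar η C₁ ⊕ᶜ E₂ * etaStar η C₂ ⊕ʳ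
          etaStar η E₁      ⊕ᶜ 0  ⊕ᶜ etaStar η A₁      ⊕ᶜ 0 ⊕ʳ
          etaStar η E₂      ⊕ᶜ 0  ⊕ᶜ 0                 ⊕ᶜ etaStar η A₂ ⊕ʳ
          C₃ * etaStar η E₃ ⊕ᶜ A₃ ⊕ᶜ 0                 ⊕ᶜ 0)
      = qrank (E₁ ⊕ᶜ E₂ ⊕ʳ A₁ ⊕ᶜ 0 ⊕ʳ 0 ⊕ᶜ A₂) + qrank (E₃ ⊕ʳ A₃) ↔
    ∃ (a : Matrix n₃ (p ⊕ m₁ ⊕ m₂) ℍ[ℝ]) (b : Matrix (p ⊕ m₃) (n₁ ⊕ n₂) ℍ[ℝ]),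
      (T ⊕ᶜ 0 ⊕ᶜ 0 ⊕ʳ 0 ⊕ᶜ 0 ⊕ᶜ 0) = (E₃ ⊕ʳ A₃) * a +
        b * (etaStar η E₁ ⊕ᶜ etaStar η A₁ ⊕ᶜ 0 ⊕ʳ etaStar η E₂ ⊕ᶜ 0 ⊕ᶜ etaStar η A₂) := by
  have e : (C                ⊕ᶜ E₃ ⊕ᶜ E₁ * etaStar η C₁ ⊕ᶜ E₂ * etaStar η C₂ ⊕ʳ
          etaStar η E₁      ⊕ᶜ 0  ⊕ᶜ etaStar η A₁      ⊕ᶜ 0 ⊕ʳ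
          etaStar η E₂      ⊕ᶜ 0  ⊕ᶜ 0                 ⊕ᶜ etaStar η A₂ ⊕ʳ
          C₃ * etaStar η E₃ ⊕ᶜ A₃ ⊕ᶜ 0                 ⊕ᶜ 0) =
      (fromBlocks (C ⊕ᶜ E₁ * etaStar η C₁ ⊕ᶜ E₂ * etaStar η C₂ ⊕ʳ
          C₃ * etaStar η E₃ ⊕ᶜ 0 ⊕ᶜ 0) (E₃ ⊕ʳ A₃)
        (etaStar η E₁ ⊕ᶜ etaStar η A₁ ⊕ᶜ 0 ⊕ʳ etaStar η E₂ ⊕ᶜ 0 ⊕ᶜ etaStar η A₂) 0).submatrix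
          sumRegroupMid sumRegroupSnd := by
    ext1 i j
    rcases i with i | i | i | i <;> rcases j with j | j | j | j <;> rfl
  have e' : (etaStar η E₁ ⊕ᶜ etaStar η A₁ ⊕ᶜ 0 ⊕ʳ etaStar η E₂ ⊕ᶜ 0 ⊕ᶜ etaStar η A₂) =
      etaStar η (E₁ ⊕ᶜ E₂ ⊕ʳ A₁ ⊕ᶜ 0 ⊕ʳ 0 ⊕ᶜ A₂) := by
    simp only [etaStar_fromRows, etaStar_fromCols, etaStar_zero]
    ext1 i j
    rcases i with i | i <;> rcases j with j | j | j <;> rfl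
  rw [e, qrank_submatrix, ← qrank_etaStar hη (E₁ ⊕ᶜ E₂ ⊕ʳ _), ← e', add_comm (qrank _),
    qrank_fromBlocks_iff]
  refine exists_mul_add_mul_congr
    (a₀ := Z * etaStar η E₃ ⊕ᶜ 0 ⊕ᶜ 0) (b₀ := E₁ * X ⊕ᶜ E₂ * Y ⊕ʳ 0 ⊕ᶜ 0) ?_
  simp only [fromRows_mul, fromCols_mul_fromRows, Matrix.zero_mul]
  simp only [mul_fromCols, fromRows_add_fromRows,
    fromCols_add_fromCols, Matrix.mul_zero, zero_add, add_zero, Matrix.mul_assoc, hXh.mul_etaStar hη hX, hYh.mul_etaStar hη hY, mul_reassoc hZ]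
  rw [hT]
  simp only [Matrix.mul_assoc]
  congr 2
  abel

theorem mul_mul_eq_zero_of_qrank_one_left (hη : IsBasicUnit η) (hX : A₁ * X = C₁)
    (hXh : IsEtaHermitian η X) (hY : A₂ * Y = C₂) (hYh : IsEtaHermitian η Y) (hZ : A₃ * Z = C₃)
    (hT : C = T + E₁ * X * etaStar η E₁ + E₂ * Y * etaStar η E₂ + E₃ * Z * etaStar η E₃)
    (h : qrank (C           ⊕ᶜ E₃ ⊕ᶜ E₁ * etaStar η C₁ ⊕ᶜ E₂ * etaStar η C₂ ⊕ʳ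
          etaStar η E₁      ⊕ᶜ 0  ⊕ᶜ etaStar η A₁      ⊕ᶜ 0 ⊕ʳ
          etaStar η E₂      ⊕ᶜ 0  ⊕ᶜ 0                 ⊕ᶜ etaStar η A₂ ⊕ʳ
          C₃ * etaStar η E₃ ⊕ᶜ A₃ ⊕ᶜ 0                 ⊕ᶜ 0)
      = qrank (E₁ ⊕ᶜ E₂ ⊕ʳ A₁ ⊕ᶜ 0 ⊕ʳ 0 ⊕ᶜ A₂) + qrank (E₃ ⊕ʳ A₃))
    {R : Matrix r p ℍ[ℝ]} {R' : Matrix r' p ℍ[ℝ]} (h₃ : R * (E₃ * projL A₃) = 0)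
    (h₁ : R' * (E₁ * projL A₁) = 0) (h₂ : R' * (E₂ * projL A₂) = 0) :
    R * (T * etaStar η R') = 0 := by
  have h0 := mul_mul_eq_zero_of_exists ((qrank_one_left_iff hη hX hXh hY hYh hZ hT).1 h)
    (u := R ⊕ᶜ -(R * (E₃ * pinv A₃)))
    (v := etaStar η R' ⊕ʳ -etaStar η (R' * (E₁ * pinv A₁)) ⊕ʳ
      -etaStar η (R' * (E₂ * pinv A₂))) ?_ ?_
  · simpa only [fromCols_mul_fromRows, fromRows_mul, Matrix.zero_mul, Matrix.mul_zero,
      add_zero] using h0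
  · rw [fromCols_mul_fromRows, Matrix.neg_mul, Matrix.mul_assoc, Matrix.mul_assoc,
      mul_eq_of_mul_projL h₃, add_neg_cancel]
  · simp only [fromRows_mul, fromCols_mul_fromRows, Matrix.zero_mul, Matrix.mul_neg, add_zero,
      zero_add, neg_zero, etaStar_mul_of_mul_projL hη h₁,
      etaStar_mul_of_mul_projL hη h₂, fromRows_zero]

theorem qrank_pair_iff (hη : IsBasicUnit η) (hX : A₁ * X = C₁) (hXh : IsEtaHermitian η X)
    (hY : A₂ * Y = C₂) (hYh : IsEtaHermitian η Y) (hZ : A₃ * Z = C₃) (hZh : IsEtaHermitian η Z)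
    (hT : C = T + E₁ * X * etaStar η E₁ + E₂ * Y * etaStar η E₂ + E₃ * Z * etaStar η E₃) :
    qrank (C ⊕ᶜ 0 ⊕ᶜ E₁ ⊕ᶜ 0 ⊕ᶜ E₃ ⊕ᶜ E₂ * etaStar η C₂ ⊕ᶜ 0 ⊕ᶜ E₃ * etaStar η C₃ ⊕ʳ
        0 ⊕ᶜ -C ⊕ᶜ 0 ⊕ᶜ E₂ ⊕ᶜ E₃ ⊕ᶜ 0 ⊕ᶜ -(E₁ * etaStar η C₁) ⊕ᶜ 0 ⊕ʳ
        etaStar η E₂ ⊕ᶜ 0 ⊕ᶜ 0 ⊕ᶜ 0 ⊕ᶜ 0 ⊕ᶜ etaStar η A₂ ⊕ᶜ 0 ⊕ᶜ 0 ⊕ʳ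
        0 ⊕ᶜ etaStar η E₁ ⊕ᶜ 0 ⊕ᶜ 0 ⊕ᶜ 0 ⊕ᶜ 0 ⊕ᶜ etaStar η A₁ ⊕ᶜ 0 ⊕ʳ
        etaStar η E₃ ⊕ᶜ etaStar η E₃ ⊕ᶜ 0 ⊕ᶜ 0 ⊕ᶜ 0 ⊕ᶜ 0 ⊕ᶜ 0 ⊕ᶜ etaStar η A₃ ⊕ʳ
        C₁ * etaStar η E₁ ⊕ᶜ 0 ⊕ᶜ A₁ ⊕ᶜ 0 ⊕ᶜ 0 ⊕ᶜ 0 ⊕ᶜ 0 ⊕ᶜ 0 ⊕ʳ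
        0 ⊕ᶜ -(C₂ * etaStar η E₂) ⊕ᶜ 0 ⊕ᶜ A₂ ⊕ᶜ 0 ⊕ᶜ 0 ⊕ᶜ 0 ⊕ᶜ 0 ⊕ʳ
        0 ⊕ᶜ -(C₃ * etaStar η E₃) ⊕ᶜ 0 ⊕ᶜ 0 ⊕ᶜ A₃ ⊕ᶜ 0 ⊕ᶜ 0 ⊕ᶜ 0)
      = 2 * qrank (E₁ ⊕ᶜ 0 ⊕ᶜ E₃ ⊕ʳ 0 ⊕ᶜ E₂ ⊕ᶜ E₃ ⊕ʳ A₁ ⊕ᶜ 0 ⊕ᶜ 0 ⊕ʳ 0 ⊕ᶜ A₂ ⊕ᶜ 0 ⊕ʳ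
          0 ⊕ᶜ 0 ⊕ᶜ A₃) ↔
    ∃ (a : Matrix (n₁ ⊕ n₂ ⊕ n₃) (p ⊕ p ⊕ m₂ ⊕ m₁ ⊕ m₃) ℍ[ℝ])
      (b : Matrix (p ⊕ p ⊕ m₁ ⊕ m₂ ⊕ m₃) (n₂ ⊕ n₁ ⊕ n₃) ℍ[ℝ]),
      (T ⊕ᶜ 0 ⊕ᶜ 0 ⊕ᶜ 0 ⊕ᶜ 0 ⊕ʳ 0 ⊕ᶜ -T ⊕ᶜ 0 ⊕ᶜ 0 ⊕ᶜ 0 ⊕ʳ 0 ⊕ʳ 0 ⊕ʳ 0) =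
        (E₁ ⊕ᶜ 0 ⊕ᶜ E₃ ⊕ʳ 0 ⊕ᶜ E₂ ⊕ᶜ E₃ ⊕ʳ A₁ ⊕ᶜ 0 ⊕ᶜ 0 ⊕ʳ 0 ⊕ᶜ A₂ ⊕ᶜ 0 ⊕ʳ
          0 ⊕ᶜ 0 ⊕ᶜ A₃) * a +
        b * (etaStar η E₂ ⊕ᶜ 0 ⊕ᶜ etaStar η A₂ ⊕ᶜ 0 ⊕ᶜ 0 ⊕ʳ
          0 ⊕ᶜ etaStar η E₁ ⊕ᶜ 0 ⊕ᶜ etaStar η A₁ ⊕ᶜ 0 ⊕ʳ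
          etaStar η E₃ ⊕ᶜ etaStar η E₃ ⊕ᶜ 0 ⊕ᶜ 0 ⊕ᶜ etaStar η A₃) := by
  have e : (C ⊕ᶜ 0 ⊕ᶜ E₁ ⊕ᶜ 0 ⊕ᶜ E₃ ⊕ᶜ E₂ * etaStar η C₂ ⊕ᶜ 0 ⊕ᶜ E₃ * etaStar η C₃ ⊕ʳ
        0 ⊕ᶜ -C ⊕ᶜ 0 ⊕ᶜ E₂ ⊕ᶜ E₃ ⊕ᶜ 0 ⊕ᶜ -(E₁ * etaStar η C₁) ⊕ᶜ 0 ⊕ʳ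
        etaStar η E₂ ⊕ᶜ 0 ⊕ᶜ 0 ⊕ᶜ 0 ⊕ᶜ 0 ⊕ᶜ etaStar η A₂ ⊕ᶜ 0 ⊕ᶜ 0 ⊕ʳ
        0 ⊕ᶜ etaStar η E₁ ⊕ᶜ 0 ⊕ᶜ 0 ⊕ᶜ 0 ⊕ᶜ 0 ⊕ᶜ etaStar η A₁ ⊕ᶜ 0 ⊕ʳ
        etaStar η E₃ ⊕ᶜ etaStar η E₃ ⊕ᶜ 0 ⊕ᶜ 0 ⊕ᶜ 0 ⊕ᶜ 0 ⊕ᶜ 0 ⊕ᶜ etaStar η A₃ ⊕ʳ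
        C₁ * etaStar η E₁ ⊕ᶜ 0 ⊕ᶜ A₁ ⊕ᶜ 0 ⊕ᶜ 0 ⊕ᶜ 0 ⊕ᶜ 0 ⊕ᶜ 0 ⊕ʳ
        0 ⊕ᶜ -(C₂ * etaStar η E₂) ⊕ᶜ 0 ⊕ᶜ A₂ ⊕ᶜ 0 ⊕ᶜ 0 ⊕ᶜ 0 ⊕ᶜ 0 ⊕ʳ
        0 ⊕ᶜ -(C₃ * etaStar η E₃) ⊕ᶜ 0 ⊕ᶜ 0 ⊕ᶜ A₃ ⊕ᶜ 0 ⊕ᶜ 0 ⊕ᶜ 0) =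
      (fromBlocks (C ⊕ᶜ 0 ⊕ᶜ E₂ * etaStar η C₂ ⊕ᶜ 0 ⊕ᶜ E₃ * etaStar η C₃ ⊕ʳ
          0 ⊕ᶜ -C ⊕ᶜ 0 ⊕ᶜ -(E₁ * etaStar η C₁) ⊕ᶜ 0 ⊕ʳ
          C₁ * etaStar η E₁ ⊕ᶜ 0 ⊕ᶜ 0 ⊕ᶜ 0 ⊕ᶜ 0 ⊕ʳ
          0 ⊕ᶜ -(C₂ * etaStar η E₂) ⊕ᶜ 0 ⊕ᶜ 0 ⊕ᶜ 0 ⊕ʳ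
          0 ⊕ᶜ -(C₃ * etaStar η E₃) ⊕ᶜ 0 ⊕ᶜ 0 ⊕ᶜ 0)
        (E₁ ⊕ᶜ 0 ⊕ᶜ E₃ ⊕ʳ 0 ⊕ᶜ E₂ ⊕ᶜ E₃ ⊕ʳ A₁ ⊕ᶜ 0 ⊕ᶜ 0 ⊕ʳ 0 ⊕ᶜ A₂ ⊕ᶜ 0 ⊕ʳ 0 ⊕ᶜ 0 ⊕ᶜ A₃)
        (etaStar η E₂ ⊕ᶜ 0 ⊕ᶜ etaStar η A₂ ⊕ᶜ 0 ⊕ᶜ 0 ⊕ʳ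
          0 ⊕ᶜ etaStar η E₁ ⊕ᶜ 0 ⊕ᶜ etaStar η A₁ ⊕ᶜ 0 ⊕ʳ
          etaStar η E₃ ⊕ᶜ etaStar η E₃ ⊕ᶜ 0 ⊕ᶜ 0 ⊕ᶜ etaStar η A₃) 0).submatrix
          sumRegroupEight sumRegroupEight := by
    ext1 i j
    rcases i with i | i | i | i | i | i | i | i <;>
      rcases j with j | j | j | j | j | j | j | j <;> rfl
  have e' : (etaStar η E₂ ⊕ᶜ 0 ⊕ᶜ etaStar η A₂ ⊕ᶜ 0 ⊕ᶜ 0 ⊕ʳ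
          0 ⊕ᶜ etaStar η E₁ ⊕ᶜ 0 ⊕ᶜ etaStar η A₁ ⊕ᶜ 0 ⊕ʳ
          etaStar η E₃ ⊕ᶜ etaStar η E₃ ⊕ᶜ 0 ⊕ᶜ 0 ⊕ᶜ etaStar η A₃) =
      (etaStar η (E₁ ⊕ᶜ 0 ⊕ᶜ E₃ ⊕ʳ 0 ⊕ᶜ E₂ ⊕ᶜ E₃ ⊕ʳ A₁ ⊕ᶜ 0 ⊕ᶜ 0 ⊕ʳ 0 ⊕ᶜ A₂ ⊕ᶜ 0 ⊕ʳ
        0 ⊕ᶜ 0 ⊕ᶜ A₃)).submatrix sumSwapThree sumSwapFive := by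
    simp only [etaStar_fromRows, etaStar_fromCols, etaStar_zero]
    ext1 i j
    rcases i with i | i | i <;> rcases j with j | j | j | j | j <;> rfl
  -- The right block is the η-star of the left one up to a permutation of block rows and columns, so
  -- the ranks agree; this is the source of the factor 2.
  have e'' := congrArg qrank e'
  rw [qrank_submatrix, qrank_etaStar hη] at e''
  rw [e, qrank_submatrix, two_mul]
  conv_lhs => rhs; rhs; rw [← e'']
  rw [qrank_fromBlocks_iff]
  -- In the first block row `X` goes to the left and `Y, Z` to the right; in the second `Y, Z` go to
  -- the left and `X` to the right, all with the opposite sign. This leaves `diag(T, -T)`.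
  refine exists_mul_add_mul_congr
    (a₀ := X * etaStar η E₁ ⊕ᶜ 0 ⊕ᶜ 0 ⊕ᶜ 0 ⊕ᶜ 0 ⊕ʳ
      0 ⊕ᶜ -(Y * etaStar η E₂) ⊕ᶜ 0 ⊕ᶜ 0 ⊕ᶜ 0 ⊕ʳ
      0 ⊕ᶜ -(Z * etaStar η E₃) ⊕ᶜ 0 ⊕ᶜ 0 ⊕ᶜ 0)
    (b₀ := E₂ * Y ⊕ᶜ 0 ⊕ᶜ E₃ * Z ⊕ʳ 0 ⊕ᶜ -(E₁ * X) ⊕ᶜ 0 ⊕ʳ 0 ⊕ʳ 0 ⊕ʳ 0) ?_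
  simp only [fromRows_mul, fromCols_mul_fromRows, Matrix.zero_mul]
  simp only [mul_fromCols, fromRows_add_fromRows, fromCols_add_fromCols,
    Matrix.mul_zero, zero_add, add_zero, fromCols_neg, neg_zero, Matrix.neg_mul, Matrix.mul_neg, neg_add_cancel,
    Matrix.mul_assoc, hXh.mul_etaStar hη hX, hYh.mul_etaStar hη hY, hZh.mul_etaStar hη hZ,
    mul_reassoc hX, mul_reassoc hY, mul_reassoc hZ]
  rw [hT]
  simp only [Matrix.mul_assoc]
  congr 2
  · abel
  · congr 3
    abel

/-- The coupled `E₃` blocks only require the sums `R₁ + R₂` and `R₁' + R₂'` to kill `E₃ L_{A₃}`.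
Sandwiching `diag(T, -T)` between the two annihilators turns its minus sign into an equality. -/
theorem mul_mul_eq_of_qrank_pair (hη : IsBasicUnit η) (hX : A₁ * X = C₁)
    (hXh : IsEtaHermitian η X)
    (hY : A₂ * Y = C₂) (hYh : IsEtaHermitian η Y) (hZ : A₃ * Z = C₃) (hZh : IsEtaHermitian η Z)
    (hT : C = T + E₁ * X * etaStar η E₁ + E₂ * Y * etaStar η E₂ + E₃ * Z * etaStar η E₃)
    (h : qrank (C ⊕ᶜ 0 ⊕ᶜ E₁ ⊕ᶜ 0 ⊕ᶜ E₃ ⊕ᶜ E₂ * etaStar η C₂ ⊕ᶜ 0 ⊕ᶜ E₃ * etaStar η C₃ ⊕ʳ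
        0 ⊕ᶜ -C ⊕ᶜ 0 ⊕ᶜ E₂ ⊕ᶜ E₃ ⊕ᶜ 0 ⊕ᶜ -(E₁ * etaStar η C₁) ⊕ᶜ 0 ⊕ʳ
        etaStar η E₂ ⊕ᶜ 0 ⊕ᶜ 0 ⊕ᶜ 0 ⊕ᶜ 0 ⊕ᶜ etaStar η A₂ ⊕ᶜ 0 ⊕ᶜ 0 ⊕ʳ
        0 ⊕ᶜ etaStar η E₁ ⊕ᶜ 0 ⊕ᶜ 0 ⊕ᶜ 0 ⊕ᶜ 0 ⊕ᶜ etaStar η A₁ ⊕ᶜ 0 ⊕ʳ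
        etaStar η E₃ ⊕ᶜ etaStar η E₃ ⊕ᶜ 0 ⊕ᶜ 0 ⊕ᶜ 0 ⊕ᶜ 0 ⊕ᶜ 0 ⊕ᶜ etaStar η A₃ ⊕ʳ
        C₁ * etaStar η E₁ ⊕ᶜ 0 ⊕ᶜ A₁ ⊕ᶜ 0 ⊕ᶜ 0 ⊕ᶜ 0 ⊕ᶜ 0 ⊕ᶜ 0 ⊕ʳ
        0 ⊕ᶜ -(C₂ * etaStar η E₂) ⊕ᶜ 0 ⊕ᶜ A₂ ⊕ᶜ 0 ⊕ᶜ 0 ⊕ᶜ 0 ⊕ᶜ 0 ⊕ʳ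
        0 ⊕ᶜ -(C₃ * etaStar η E₃) ⊕ᶜ 0 ⊕ᶜ 0 ⊕ᶜ A₃ ⊕ᶜ 0 ⊕ᶜ 0 ⊕ᶜ 0)
      = 2 * qrank (E₁ ⊕ᶜ 0 ⊕ᶜ E₃ ⊕ʳ 0 ⊕ᶜ E₂ ⊕ᶜ E₃ ⊕ʳ A₁ ⊕ᶜ 0 ⊕ᶜ 0 ⊕ʳ 0 ⊕ᶜ A₂ ⊕ᶜ 0 ⊕ʳ
          0 ⊕ᶜ 0 ⊕ᶜ A₃))
    {R₁ R₂ : Matrix r p ℍ[ℝ]} {R₁' R₂' : Matrix r' p ℍ[ℝ]}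
    (h₁ : R₁ * (E₁ * projL A₁) = 0) (h₂ : R₂ * (E₂ * projL A₂) = 0)
    (h₃ : (R₁ + R₂) * (E₃ * projL A₃) = 0) (h₁' : R₁' * (E₂ * projL A₂) = 0)
    (h₂' : R₂' * (E₁ * projL A₁) = 0) (h₃' : (R₁' + R₂') * (E₃ * projL A₃) = 0) :
    R₁ * (T * etaStar η R₁') = R₂ * (T * etaStar η R₂') := by
  have h0 := mul_mul_eq_zero_of_exists
    ((qrank_pair_iff hη hX hXh hY hYh hZ hZh hT).1 h)
    (u := R₁ ⊕ᶜ R₂ ⊕ᶜ -(R₁ * (E₁ * pinv A₁)) ⊕ᶜ -(R₂ * (E₂ * pinv A₂)) ⊕ᶜ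
      -((R₁ + R₂) * (E₃ * pinv A₃)))
    (v := etaStar η R₁' ⊕ʳ etaStar η R₂' ⊕ʳ -etaStar η (R₁' * (E₂ * pinv A₂)) ⊕ʳ
      -etaStar η (R₂' * (E₁ * pinv A₁)) ⊕ʳ -etaStar η ((R₁' + R₂') * (E₃ * pinv A₃))) ?_ ?_
  · simp only [fromCols_mul_fromRows, fromRows_mul, Matrix.zero_mul, Matrix.mul_zero,
      add_zero, zero_add, Matrix.neg_mul, Matrix.mul_neg, neg_zero] at h0
    rwa [← sub_eq_add_neg, sub_eq_zero] at h0
  · have e := mul_eq_of_mul_projL h₃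
    simp only [fromCols_mul_fromRows, mul_fromCols, fromCols_add_fromCols, fromCols_neg,
      neg_zero, Matrix.mul_zero, add_zero, zero_add, Matrix.neg_mul, Matrix.mul_assoc,
      mul_eq_of_mul_projL h₁, mul_eq_of_mul_projL h₂, e, add_neg_cancel]
    rw [Matrix.add_mul, ← add_assoc, add_neg_cancel, fromCols_zero, fromCols_zero]
  · have e := etaStar_mul_of_mul_projL hη h₃'
    rw [etaStar_add, Matrix.mul_add, add_assoc] at e
    simp only [fromRows_mul, fromCols_mul_fromRows, Matrix.zero_mul, Matrix.mul_neg, add_zero,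
      zero_add, neg_zero, etaStar_mul_of_mul_projL hη h₁',
      etaStar_mul_of_mul_projL hη h₂', e, fromRows_zero]

end BlockRank

/-! ### Particular η-Hermitian solution of `A X = C`. -/

section Particular

variable {m n : Type*} [Fintype m] [Fintype n] [DecidableEq m] [DecidableEq n] {η : ℍ[ℝ]}
  {A C : Matrix m n ℍ[ℝ]}

theorem mul_particular (h : projR A * C = 0) :
    A * (pinv A * C + projL A * etaStar η C * pinv (etaStar η A)) = C := by
  rw [Matrix.mul_add, mul_pinv_mul_of_projR h, Matrix.mul_assoc, mul_reassoc (mul_projL A),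
    Matrix.zero_mul, add_zero]

/-- Expanding `L_A`, the first two terms are exchanged by the η-star, and compatibility makes the
third, `A†A C^{η*}(A^{η*})†`, equal to its own η-star. -/
theorem particular_isEtaHermitian (hη : IsBasicUnit η) (h : A * etaStar η C = C * etaStar η A) :
    IsEtaHermitian η (pinv A * C + projL A * etaStar η C * pinv (etaStar η A)) := by
  have e : pinv A * (A * (etaStar η C * pinv (etaStar η A))) =
      pinv A * (C * (etaStar η A * pinv (etaStar η A))) := by
    rw [mul_reassoc h, Matrix.mul_assoc]
  rw [IsEtaHermitian]
  simp only [projL, etaStar_add, etaStar_mul hη, etaStar_sub, etaStar_pinv hη,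
    etaStar_etaStar hη, Matrix.sub_mul, Matrix.one_mul, Matrix.mul_assoc, e]
  abel

theorem projR_mul_eq_zero_iff : projR A * C = 0 ↔ ∃ X : Matrix n n ℍ[ℝ], C = A * X := by
  constructor
  · intro h
    exact ⟨_, (mul_pinv_mul_of_projR h).symm⟩
  · rintro ⟨X, rfl⟩
    rw [← Matrix.mul_assoc, projR_mul, Matrix.zero_mul]

theorem qrank_fromCols_eq_iff_projR :
    qrank (fromCols A C) = qrank A ↔ projR A * C = 0 := by
  rw [qrank_fromCols_comm, qrank_fromCols_iff, projR_mul_eq_zero_iff]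

end Particular

/-! ### Nested pairs `G₁ U H₄ = L₁`, `G₂ U H₃ = L₂`. -/

section Nested

variable {g₁ g₂ h₃ h₄ n k : Type*} [Fintype g₁] [Fintype g₂] [Fintype h₃] [Fintype h₄]
  [Fintype n] [Fintype k] [DecidableEq g₁] [DecidableEq g₂] [DecidableEq h₃] [DecidableEq h₄]
  [DecidableEq n] [DecidableEq k]
  {G₁ : Matrix g₁ n ℍ[ℝ]} {G₂ : Matrix g₂ n ℍ[ℝ]} {H₃ : Matrix k h₃ ℍ[ℝ]} {H₄ : Matrix k h₄ ℍ[ℝ]}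
  {L₁ : Matrix g₁ h₄ ℍ[ℝ]} {L₂ : Matrix g₂ h₃ ℍ[ℝ]} {P : Matrix g₁ g₂ ℍ[ℝ]}
  {P' : Matrix h₄ h₃ ℍ[ℝ]}

/-- A particular solution of the nested pair `G₁ U H₄ = L₁`, `G₂ U H₃ = L₂`. -/
theorem nested_particular (hG : G₁ = P * G₂) (hH : H₃ = H₄ * P') (hL : L₁ * P' = P * L₂)
    (h1 : projR G₁ * L₁ = 0) (h1' : L₁ * projL H₄ = 0) (h2 : projR G₂ * L₂ = 0)
    (h2' : L₂ * projL H₃ = 0) {F : Matrix n k ℍ[ℝ]}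
    (hF : F = pinv G₁ * L₁ * pinv H₄ + projL G₁ * pinv G₂ * L₂ * pinv H₃) :
    G₁ * (F * H₄) = L₁ ∧ G₂ * (F * H₃) = L₂ := by
  have e1 := mul_pinv_mul_of_projL h1'
  have e2 := mul_pinv_mul_of_projL h2'
  constructor
  · rw [hF]
    simp only [Matrix.mul_add, Matrix.add_mul, Matrix.mul_assoc, mul_reassoc (mul_projL G₁),
      Matrix.zero_mul, add_zero, e1, mul_pinv_mul_of_projR h1]
  · have e3 : L₁ * (pinv H₄ * H₃) = P * L₂ := by
      rw [hH, ← hL, ← Matrix.mul_assoc (pinv H₄), ← Matrix.mul_assoc L₁, e1]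
    have e4 : G₁ * (pinv G₂ * L₂) = P * L₂ := by
      conv_lhs => lhs; rw [hG]
      rw [Matrix.mul_assoc, mul_pinv_mul_of_projR h2]
    rw [hF]
    simp only [Matrix.mul_add, Matrix.add_mul, Matrix.mul_assoc, e2, e3]
    rw [projL, Matrix.sub_mul, Matrix.one_mul, Matrix.mul_sub, mul_pinv_mul_of_projR h2,
      Matrix.mul_assoc, e4, add_sub_cancel]

theorem nested_homogeneous (hG : G₁ = P * G₂) (hH : H₃ = H₄ * P') (V₁ V₂ V₃ : Matrix n k ℍ[ℝ]) :
    G₁ * ((projL G₂ * V₁ + V₂ * projR H₄ + projL G₁ * V₃ * projR H₃) * H₄) = 0 ∧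
    G₂ * ((projL G₂ * V₁ + V₂ * projR H₄ + projL G₁ * V₃ * projR H₃) * H₃) = 0 := by
  have e1 : G₁ * projL G₂ = 0 := by rw [hG, Matrix.mul_assoc, mul_projL, Matrix.mul_zero]
  have e2 : projR H₄ * H₃ = 0 := by rw [hH, ← Matrix.mul_assoc, projR_mul, Matrix.zero_mul]
  constructor <;>
  simp only [Matrix.mul_add, Matrix.add_mul, Matrix.mul_assoc, mul_reassoc (mul_projL G₁),
    mul_reassoc (mul_projL G₂), mul_reassoc e1, projR_mul, e2, Matrix.zero_mul, Matrix.mul_zero,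
    add_zero]

/-- Every solution of the homogeneous nested pair has the expected form. -/
theorem exists_nested (hG : G₁ = P * G₂) {U : Matrix n k ℍ[ℝ]}
    (h1 : G₁ * (U * H₄) = 0) (h2 : G₂ * (U * H₃) = 0) (hH : H₃ = H₄ * P') :
    ∃ V₁ V₂ V₃ : Matrix n k ℍ[ℝ],
      U = projL G₂ * V₁ + V₂ * projR H₄ + projL G₁ * V₃ * projR H₃ := by
  have e1 : projL G₁ * projL G₂ = projL G₂ :=
    eq_projL_mul (by rw [hG, Matrix.mul_assoc, mul_projL, Matrix.mul_zero])
  have e2 : projR H₄ * H₃ = 0 := by rw [hH, ← Matrix.mul_assoc, projR_mul, Matrix.zero_mul]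
  have f1 := exists_of_mul_mul_eq_zero (A := G₁) (X := U) (B := H₄) (by rwa [Matrix.mul_assoc])
  have h3 : G₂ * (projL G₁ * U) * H₃ = 0 := by
    rw [f1, Matrix.add_mul, Matrix.mul_add] at h2
    simpa only [Matrix.mul_assoc, e2, Matrix.mul_zero, add_zero] using h2
  have f2 := congrArg (fun K => projL G₁ * K) (exists_of_mul_mul_eq_zero h3)
  simp only [Matrix.mul_add, mul_reassoc e1, mul_reassoc (projL_mul_projL G₁)] at f2
  -- Split `U` by the first equation, then its part `L_{G₁} U` by the second, and reapply `L_{G₁}`,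
  -- which fixes `L_{G₂}`.
  refine ⟨projL G₁ * U, pinv G₁ * G₁ * U, pinv G₂ * G₂ * (projL G₁ * U), ?_⟩
  conv_lhs => rw [f1, f2]
  simp only [Matrix.mul_assoc]
  abel

end Nested

end QMat

/-! ### The two pairs of equations for `U₃` and the reduced equation with right side `E`. -/

namespace EtaSystem

open QMat

variable {m₁ m₂ m₃ n₁ n₂ n₃ p : ℕ} {S : EtaSystem m₁ m₂ m₃ n₁ n₂ n₃ p}

/-- The solvability conditions of the two nested pairs of equations for `U₃`. -/
structure PairConditions (S : EtaSystem m₁ m₂ m₃ n₁ n₂ n₃ p) : Prop where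
  herm : IsEtaHermitian S.η S.T1
  c1 : projR S.G1 * S.L1 = 0
  c2 : projR S.G2 * S.L2 = 0
  c3 : projR S.G3 * S.L3 = 0
  c4 : projR S.G4 * S.L4 = 0

theorem G_mul_A11 : S.G * S.A11 = 0 := by
  rw [G, Matrix.mul_assoc, projR_mul, Matrix.mul_zero]

theorem G_mul_A22 : S.G * S.A22 = 0 := by
  rw [G, Matrix.mul_assoc, ← M1, projR_mul]

theorem G_mul_projR : S.G * projR S.A22 = S.G := eq_mul_projR G_mul_A22

theorem G1_eq : S.G1 = projR S.M1 * S.G2 := by rw [G1, G2, G, Matrix.mul_assoc]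

theorem G1_eq' : S.G1 = S.G * S.G3 := by rw [G1, G3, ← Matrix.mul_assoc, G_mul_projR]

theorem G2_eq : S.G2 = projR S.A11 * S.G4 := rfl

theorem G3_eq : S.G3 = projR S.A22 * S.G4 := rfl

section Conditions

variable (hη : IsBasicUnit S.η)

include hη

theorem st_mul {a b c : Type*} [Fintype b] (A : Matrix a b ℍ[ℝ]) (B : Matrix b c ℍ[ℝ]) :
    S.st (A * B) = S.st B * S.st A := etaStar_mul hη A B

theorem st_st {a b : Type*} (A : Matrix a b ℍ[ℝ]) : S.st (S.st A) = A := etaStar_etaStar hη A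

theorem st_pinv {a b : Type*} [Fintype a] [Fintype b] (A : Matrix a b ℍ[ℝ]) :
    S.st (pinv A) = pinv (S.st A) := etaStar_pinv hη A

theorem st_projL {a b : Type*} [Fintype a] [Fintype b] [DecidableEq b] (A : Matrix a b ℍ[ℝ]) :
    S.st (projL A) = projR (S.st A) := etaStar_projL hη A

theorem st_projR {a b : Type*} [Fintype a] [Fintype b] [DecidableEq a] (A : Matrix a b ℍ[ℝ]) :
    S.st (projR A) = projL (S.st A) := etaStar_projR hη A

theorem PairConditions.st_L1 (h : S.PairConditions) : S.st S.L1 = S.L4 := by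
  rw [L1, st_mul hη, L4]
  exact congrArg (· * _) h.herm.symm

theorem PairConditions.st_L3 (h : S.PairConditions) : S.st S.L3 = S.L2 := by
  rw [L3, st_mul hη, st_mul hη, st_st hη, L2, Matrix.mul_assoc]
  exact congrArg (fun K => _ * (K * _)) h.herm.symm

theorem st_eq_zero {a b : Type*} {A : Matrix a b ℍ[ℝ]} (h : S.st A = 0) : A = 0 := by
  rw [← st_st hη A, h]
  exact etaStar_zero

theorem mul_projL_st {a b c : Type*} [Fintype a] [Fintype b] [Fintype c] [DecidableEq b]
    {A : Matrix a b ℍ[ℝ]} {B : Matrix b c ℍ[ℝ]} (h : projR B * S.st A = 0) :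
    A * projL (S.st B) = 0 := by
  apply st_eq_zero hη
  rw [st_mul hη]
  have e : S.st (projL (S.st B)) = projR B := by
    rw [← etaStar_projR hη]; exact st_st hη _
  rw [e, h]

/-- The nested pair also needs conditions on the right. As `T₁` is η-Hermitian, the η-star exchanges
`L₁` with `L₄` and `L₂` with `L₃`, so these are the η-stars of the left conditions on `G₄` and `G₃`.
-/
theorem PairConditions.F1_spec (h : S.PairConditions) :
    S.G1 * (S.F1 * S.st S.G4) = S.L1 ∧ S.G2 * (S.F1 * S.st S.G3) = S.L2 := by
  refine nested_particular (P := projR S.M1) (P' := S.st (projR S.A22)) G1_eq ?_ ?_ h.c1 ?_ h.c2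
    ?_ rfl
  · rw [G3_eq, st_mul hη]
  · rw [L1, L2, G]; simp only [Matrix.mul_assoc]
  · exact mul_projL_st hη (by rw [h.st_L1 hη, h.c4])
  · exact mul_projL_st hη (by rw [← h.st_L3 hη, st_st hη, h.c3])

theorem PairConditions.F2_spec (h : S.PairConditions) :
    S.G3 * (S.F2 * S.st S.G2) = S.L3 ∧ S.G4 * (S.F2 * S.st S.G1) = S.L4 := by
  refine nested_particular (P := projR S.A22) (P' := S.st (projR S.M1)) G3_eq ?_ ?_ h.c3 ?_ h.c4
    ?_ rfl
  · rw [G1_eq, st_mul hη]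
  · rw [L3, L4, G, st_mul hη]; simp only [Matrix.mul_assoc]
  · exact mul_projL_st hη (by rw [h.st_L3 hη, h.c2])
  · exact mul_projL_st hη (by rw [← h.st_L1 hη, st_st hη, h.c1])

omit hη in
theorem projR_C11_mul : projR S.C11 * projL S.G2 = 0 ∧ projR S.C11 * projL S.G4 = 0 := by
  have h := projR_mul S.C11
  conv_lhs at h => rhs; rw [C11]
  rw [mul_fromCols, ← fromCols_zero, fromCols_ext_iff] at h
  exact h

/-- The product `G₁UG₂^{η*}` is determined by either pair alone: through `G₁ = G G₃` from the
second, through `G₂ = R_{A₁₁} G₄` from the first. Both give `G T₁ R_{A₁₁}^{η*}`. -/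
theorem PairConditions.G1_F_G2 (h : S.PairConditions) : S.G1 * (S.F * S.st S.G2) = 0 := by
  have e1 : S.G1 * (S.F2 * S.st S.G2) = S.G * S.L3 := by
    rw [G1_eq', Matrix.mul_assoc, (h.F2_spec hη).1]
  have e2 : S.G1 * (S.F1 * S.st S.G2) = S.L1 * S.st (projR S.A11) := by
    rw [G2_eq, st_mul hη, ← Matrix.mul_assoc S.F1, ← Matrix.mul_assoc S.G1, (h.F1_spec hη).1]
  rw [F, Matrix.sub_mul, Matrix.mul_sub, e1, e2, L3, L1, sub_eq_zero]
  simp only [Matrix.mul_assoc, mul_reassoc G_mul_projR]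

theorem PairConditions.G2_F_G1 (h : S.PairConditions) : S.G2 * (S.F * S.st S.G1) = 0 := by
  have e1 : S.G2 * (S.F2 * S.st S.G1) = projR S.A11 * S.L4 := by
    rw [G2_eq, Matrix.mul_assoc, (h.F2_spec hη).2]
  have e2 : S.G2 * (S.F1 * S.st S.G1) = S.L2 * S.st S.G := by
    rw [G1_eq', st_mul hη, ← Matrix.mul_assoc S.F1, ← Matrix.mul_assoc S.G2, (h.F1_spec hη).2]
  have e3 : S.st (projR S.A22) * S.st S.G = S.st S.G := by rw [← st_mul hη, G_mul_projR]
  rw [F, Matrix.sub_mul, Matrix.mul_sub, e1, e2, L2, L4, sub_eq_zero]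
  simp only [Matrix.mul_assoc, e3]

/-- A sandwich `K F K'^{η*}` vanishes when `K`, `K'` factor through `G`, `G'` and
`G F G'^{η*} = 0`. -/
theorem mul_F_mul_eq_zero {a b c d : Type*} [Fintype a] [Fintype b] [Fintype c] [Fintype d]
    {K : Matrix a (Fin n₃) ℍ[ℝ]}
    {K' : Matrix b (Fin n₃) ℍ[ℝ]} {A : Matrix c (Fin n₃) ℍ[ℝ]} {B : Matrix d (Fin n₃) ℍ[ℝ]}
    (hK : K * projL A = 0) (hK' : K' * projL B = 0) (h : A * (S.F * S.st B) = 0) :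
    K * (S.F * S.st K') = 0 := by
  rw [← mul_pinv_mul_of_projL hK, ← mul_pinv_mul_of_projL hK', st_mul hη, st_mul hη]
  have e : A * (S.F * (S.st B * S.st (pinv B) * S.st K')) =
      A * (S.F * S.st B) * (S.st (pinv B) * S.st K') := by simp only [Matrix.mul_assoc]
  rw [Matrix.mul_assoc, Matrix.mul_assoc, e, h, Matrix.zero_mul, Matrix.mul_zero, Matrix.mul_zero]

omit hη in
theorem projR_E11_mul : projR S.E11 * projR S.C11 * projL S.G1 = 0 := by
  rw [Matrix.mul_assoc]; exact projR_mul S.E11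

omit hη in
theorem projR_E22_mul : projR S.E22 * projR S.C11 * projL S.G3 = 0 := by
  rw [Matrix.mul_assoc]; exact projR_mul S.E22

theorem PairConditions.projR_E11_mul_E (h : S.PairConditions) : projR S.E11 * S.E = 0 := by
  have := mul_F_mul_eq_zero hη projR_E11_mul projR_C11_mul.1 (h.G1_F_G2 hη)
  rw [E]
  simpa only [Matrix.mul_assoc] using this

theorem PairConditions.E_mul_projL (h : S.PairConditions) : S.E * projL (S.st S.E11) = 0 := by
  have := mul_F_mul_eq_zero hη projR_C11_mul.1 projR_E11_mul (h.G2_F_G1 hη)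
  rw [st_mul hη] at this
  rw [E, ← etaStar_projR hη]
  simpa only [Matrix.mul_assoc] using this

theorem N_eq : S.N = S.st S.E11 * projL (S.st S.E22) := by
  rw [N, st_mul hη, ← etaStar_projR hη]

/-- Since `R_{E₁₁} E = 0` and `E L_{E₁₁^{η*}} = 0` already hold, only the condition with `R_{E₂₂}`
on both sides has to be imposed. -/
theorem PairConditions.E_solvable (h : S.PairConditions)
    (h5 : projR S.E22 * S.E * S.st (projR S.E22) = 0) :
    TwoTermSolvable S.E11 (S.st S.E22) S.E22 (S.st S.E11) S.E S.M S.N where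
  left := by rw [h.projR_E11_mul_E hη, Matrix.mul_zero]
  right := by
    have e := mul_pinv_mul_of_projL (h.E_mul_projL hη)
    rw [← e]
    have : S.st S.E11 * (projL (S.st S.E22) * projL S.N) = 0 := by
      rw [← Matrix.mul_assoc, ← N_eq hη, mul_projL]
    simp only [Matrix.mul_assoc, this, Matrix.mul_zero]
  left_right := by rw [h.projR_E11_mul_E hη, Matrix.zero_mul]
  right_left := by rw [← etaStar_projR hη, ← Matrix.mul_assoc]; exact h5

/-- These relations explain why `V₃` and `W₃` may be written with `F` where the two-term formulas
have `E = R_{C₁₁} F R_{C₁₁}^{η*}`. -/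
theorem pinv_E_absorb :
    pinv S.E11 * projR S.C11 = pinv S.E11 ∧ pinv S.E22 * projR S.C11 = pinv S.E22 ∧
    pinv S.M * projR S.C11 = pinv S.M ∧
    S.st (projR S.C11) * pinv (S.st S.E11) = pinv (S.st S.E11) ∧
    S.st (projR S.C11) * pinv (S.st S.E22) = pinv (S.st S.E22) ∧
    S.st (projR S.C11) * pinv S.N = pinv S.N := by
  have hR := conjTranspose_projR S.C11
  have hR' : (S.st (projR S.C11))ᴴ = S.st (projR S.C11) := by
    rw [conjTranspose_etaStar hη, hR]
  have e1 : projR S.C11 * S.E11 = S.E11 := by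
    rw [E11, ← Matrix.mul_assoc, projR_mul_projR]
  have e2 : projR S.C11 * S.E22 = S.E22 := by
    rw [E22, ← Matrix.mul_assoc, projR_mul_projR]
  have key : ∀ A B : Matrix (Fin n₃) (Fin n₃) ℍ[ℝ], projR S.C11 * A = A → projR S.C11 * B = B →
      projR S.C11 * (projR A * B) = projR A * B := by
    intro A B hA hB
    rw [projR, projR, Matrix.sub_mul (1 : Matrix _ _ ℍ[ℝ]) (A * pinv A), Matrix.mul_sub,
      Matrix.one_mul, Matrix.mul_assoc A, ← Matrix.mul_assoc _ A]
    rw [← projR, hA, hB]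
  refine ⟨pinv_mul_of_mul_eq hR e1, pinv_mul_of_mul_eq hR e2,
    pinv_mul_of_mul_eq hR (key _ _ e1 e2), mul_pinv_of_mul_eq hR' ?_, mul_pinv_of_mul_eq hR' ?_,
    mul_pinv_of_mul_eq hR' ?_⟩
  · rw [← st_mul hη, e1]
  · rw [← st_mul hη, e2]
  · rw [N, ← st_mul hη, key _ _ e2 e1]

theorem V3_eq (P : EtaParams n₁ n₂ n₃) :
    S.V3 P = twoTermFst S.E11 (S.st S.E22) S.E22 (S.st S.E11) S.E S.M S.N S.SM
      P.U₃₁ P.U₃₂ P.U₃₃ := by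
  obtain ⟨a1, a2, a3, -, a5, a6⟩ := pinv_E_absorb (S := S) hη
  rw [V3, twoTermFst, E, st_projL hη]
  simp only [Matrix.mul_assoc, mul_reassoc a1, mul_reassoc a2, mul_reassoc a3, a5,
    mul_reassoc a6]

theorem W3_eq (P : EtaParams n₁ n₂ n₃) :
    S.W3 P = twoTermSnd S.E22 (S.st S.E11) S.E S.M S.N S.SM P.U₃₁ P.U₄₁ (-P.U₄₂) := by
  obtain ⟨-, a2, a3, a4, -, a6⟩ := pinv_E_absorb (S := S) hη
  rw [W3, twoTermSnd, E, st_projL hη, Matrix.neg_mul, ← sub_eq_add_neg]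
  simp only [Matrix.mul_assoc, mul_reassoc a2, mul_reassoc a3, a4, a6]

end Conditions

end EtaSystem

/-! ### Extracting blocks by multiplication with `(I, 0)` and `(0, I)`. -/

namespace QMat

variable {a b c : Type*} [Fintype a] [Fintype b] [DecidableEq a] [DecidableEq b]

theorem fromCols_one_zero_mul (X : Matrix (a ⊕ b) c ℍ[ℝ]) :
    fromCols (1 : Matrix a a ℍ[ℝ]) (0 : Matrix a b ℍ[ℝ]) * X = X.toRows₁ := by
  conv_lhs => rw [← fromRows_toRows X]
  rw [fromCols_mul_fromRows, Matrix.one_mul, Matrix.zero_mul, add_zero]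

theorem fromCols_zero_one_mul (X : Matrix (a ⊕ b) c ℍ[ℝ]) :
    fromCols (0 : Matrix b a ℍ[ℝ]) (1 : Matrix b b ℍ[ℝ]) * X = X.toRows₂ := by
  conv_lhs => rw [← fromRows_toRows X]
  rw [fromCols_mul_fromRows, Matrix.one_mul, Matrix.zero_mul, zero_add]

theorem mul_fromRows_one_zero (X : Matrix c (a ⊕ b) ℍ[ℝ]) :
    X * fromRows (1 : Matrix a a ℍ[ℝ]) (0 : Matrix b a ℍ[ℝ]) = X.toCols₁ := by
  conv_lhs => rw [← fromCols_toCols X]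
  rw [fromCols_mul_fromRows, Matrix.mul_one, Matrix.mul_zero, add_zero]

theorem mul_fromRows_zero_one (X : Matrix c (a ⊕ b) ℍ[ℝ]) :
    X * fromRows (0 : Matrix a b ℍ[ℝ]) (1 : Matrix b b ℍ[ℝ]) = X.toCols₂ := by
  conv_lhs => rw [← fromCols_toCols X]
  rw [fromCols_mul_fromRows, Matrix.mul_one, Matrix.mul_zero, zero_add]

end QMat

/-! ### The formulas for `U₃`, `U₁`, `U₂` solve the reduced equation. -/

namespace EtaSystem

open QMat

variable {m₁ m₂ m₃ n₁ n₂ n₃ p : ℕ} {S : EtaSystem m₁ m₂ m₃ n₁ n₂ n₃ p}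

/-- The stacked matrix `(V₁; W₁)`. -/
theorem fromRows_V1_W1 (P : EtaParams n₁ n₂ n₃) :
    fromRows (S.V1 P) (S.W1 P) = pinv S.C11 * S.Q P -
      (pinv S.C11 * P.U₁₁ * S.st S.C11 + projL S.C11 * P.U₁₂) := by
  have e1 : S.V1 P = (pinv S.C11 * S.Q P -
      (pinv S.C11 * P.U₁₁ * S.st S.C11 + projL S.C11 * P.U₁₂)).toRows₁ := by
    rw [← fromCols_one_zero_mul, Matrix.mul_sub]
    rfl
  have e2 : S.W1 P = (pinv S.C11 * S.Q P -
      (pinv S.C11 * P.U₁₁ * S.st S.C11 + projL S.C11 * P.U₁₂)).toRows₂ := by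
    rw [← fromCols_zero_one_mul, Matrix.mul_sub]
    rfl
  rw [e1, e2, fromRows_toRows]

/-- The matrix `(W₂, V₂)`. -/
theorem fromCols_W2_V2 (P : EtaParams n₁ n₂ n₃) :
    fromCols (S.W2 P) (S.V2 P) = projR S.C11 * S.Q P * pinv (S.st S.C11) +
      (S.C11 * pinv S.C11 * P.U₁₁ + P.U₂₁ * S.st (projL S.C11)) := by
  have e1 : S.W2 P = (projR S.C11 * S.Q P * pinv (S.st S.C11) +
      (S.C11 * pinv S.C11 * P.U₁₁ + P.U₂₁ * S.st (projL S.C11))).toCols₁ := by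
    rw [← mul_fromRows_one_zero, Matrix.add_mul]
    rfl
  have e2 : S.V2 P = (projR S.C11 * S.Q P * pinv (S.st S.C11) +
      (S.C11 * pinv S.C11 * P.U₁₁ + P.U₂₁ * S.st (projL S.C11))).toCols₂ := by
    rw [← mul_fromRows_zero_one, Matrix.add_mul]
    rfl
  rw [e1, e2, fromCols_toCols]

section Sufficiency

variable (hη : IsBasicUnit S.η)

include hη

theorem C11_sylvester_expand (V₁ W₁ V₂ W₂ : Matrix (Fin n₃) (Fin n₃) ℍ[ℝ]) :
    S.C11 * fromRows V₁ W₁ + fromCols W₂ V₂ * S.st S.C11 =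
      projL S.G2 * V₁ + projL S.G4 * W₁ +
        (W₂ * projR (S.st S.G2) + V₂ * projR (S.st S.G4)) := by
  have e : S.st S.C11 = fromRows (projR (S.st S.G2)) (projR (S.st S.G4)) := by
    rw [← st_projL hη, ← st_projL hη]; exact etaStar_fromCols _ _
  rw [e, fromCols_mul_fromRows, C11, fromCols_mul_fromRows]

theorem Q_eq (P : EtaParams n₁ n₂ n₃) :
    S.Q P = S.F - projL S.G1 * S.V3 P * projR (S.st S.G3)
      - projL S.G3 * S.W3 P * projR (S.st S.G1) := by
  rw [Q, C22, C33, st_projL hη, st_projL hη]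

/-- The solvability condition of the Sylvester equation is precisely the two-term equation satisfied
by `V₃` and `W₃`. -/
theorem projR_Q_projL (h : S.PairConditions)
    (h5 : projR S.E22 * S.E * S.st (projR S.E22) = 0) (P : EtaParams n₁ n₂ n₃) :
    projR S.C11 * S.Q P * projL (S.st S.C11) = 0 := by
  have e := mul_twoTermFst_mul_add (h.E_solvable hη h5) rfl (N_eq hη)
    (show S.SM = _ from rfl) P.U₃₁ P.U₄₁ (-P.U₄₂)
    P.U₃₂ P.U₃₃
  rw [← V3_eq hη, ← W3_eq hη, E, E11, E22, st_mul hη, st_mul hη] at e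
  rw [Q, ← st_projR hη, Matrix.mul_sub, Matrix.mul_sub, Matrix.sub_mul, Matrix.sub_mul, ← e]
  simp only [Matrix.mul_assoc]
  abel

/-- The Sylvester equation solved by `V₁, W₁, W₂, V₂` says exactly that the two expressions
coincide, for the same parameters. -/
theorem U3_eq_U3' (h : S.PairConditions)
    (h5 : projR S.E22 * S.E * S.st (projR S.E22) = 0) (P : EtaParams n₁ n₂ n₃) :
    S.U3 P = S.U3' P := by
  have e := sylvester_solves (projR_Q_projL hη h h5 P) P.U₁₁ P.U₁₂ P.U₂₁
  rw [← fromRows_V1_W1, ← st_projL hη, ← fromCols_W2_V2, C11_sylvester_expand hη, Q_eq hη,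
    F] at e
  rw [U3, U3', ← sub_eq_zero]
  rw [← sub_eq_zero] at e
  rw [← e]
  abel

/-- Both pairs of equations for `U₃`. -/
theorem U3_spec (h : S.PairConditions)
    (h5 : projR S.E22 * S.E * S.st (projR S.E22) = 0) (P : EtaParams n₁ n₂ n₃) :
    (S.G1 * (S.U3 P * S.st S.G4) = S.L1 ∧ S.G2 * (S.U3 P * S.st S.G3) = S.L2) ∧
    (S.G3 * (S.U3 P * S.st S.G2) = S.L3 ∧ S.G4 * (S.U3 P * S.st S.G1) = S.L4) := by
  constructor
  · obtain ⟨f1, f2⟩ := h.F1_spec hη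
    obtain ⟨z1, z2⟩ := nested_homogeneous (H₃ := S.st S.G3) (H₄ := S.st S.G4) (G1_eq (S := S))
      (by rw [G3_eq, st_mul hη]) (S.V1 P) (S.V2 P) (S.V3 P)
    rw [U3, add_assoc, add_assoc, ← add_assoc (projL S.G2 * _)]
    constructor
    · rw [Matrix.add_mul, Matrix.mul_add, f1, z1, add_zero]
    · rw [Matrix.add_mul, Matrix.mul_add, f2, z2, add_zero]
  · obtain ⟨f1, f2⟩ := h.F2_spec hη
    obtain ⟨z1, z2⟩ := nested_homogeneous (H₃ := S.st S.G1) (H₄ := S.st S.G2) (G3_eq (S := S))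
      (by rw [G1_eq, st_mul hη]) (S.W1 P) (S.W2 P) (S.W3 P)
    -- The first expression visibly solves the first pair, the second one the second pair.
    rw [U3_eq_U3' hη h h5, U3', sub_sub, sub_sub, ← add_assoc]
    constructor
    · rw [Matrix.sub_mul, Matrix.mul_sub, f1, z1, sub_zero]
    · rw [Matrix.sub_mul, Matrix.mul_sub, f2, z2, sub_zero]

theorem U1_eq (P : EtaParams n₁ n₂ n₃)
    (U₃ : Matrix (Fin n₃) (Fin n₃) ℍ[ℝ]) :
    S.U1 P U₃ = twoTermFst S.A11 (S.st S.A11) S.A22 (S.st S.A22) (S.T U₃) S.M1 (S.st S.M1) S.S1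
      P.U₄ P.U₅ P.U₆ := by
  rw [U1, twoTermFst, st_pinv hη, st_pinv hη]

theorem U2_eq (P : EtaParams n₁ n₂ n₃) (U₃ : Matrix (Fin n₃) (Fin n₃) ℍ[ℝ]) :
    S.U2 P U₃ = twoTermSnd S.A22 (S.st S.A22) (S.T U₃) S.M1 (S.st S.M1) S.S1
      P.U₄ P.U₇ P.U₈ := by
  rw [U2, twoTermSnd, st_pinv hη, st_pinv hη]
  abel

theorem st_M1 : S.st S.M1 = S.st S.A22 * projL (S.st S.A11) := by
  rw [M1, st_mul hη, st_projR hη]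

/-- The equations for `U₃` say that the remaining two-term equation is solvable. -/
theorem T_solvable_iff (U : Matrix (Fin n₃) (Fin n₃) ℍ[ℝ]) :
    TwoTermSolvable S.A11 (S.st S.A11) S.A22 (S.st S.A22) (S.T U) S.M1 (S.st S.M1) ↔
    (S.G1 * (U * S.st S.G4) = S.L1 ∧ S.G2 * (U * S.st S.G3) = S.L2) ∧
    (S.G3 * (U * S.st S.G2) = S.L3 ∧ S.G4 * (U * S.st S.G1) = S.L4) := by
  have e1 : projR S.M1 * (projR S.A11 * S.T U) = S.L1 - S.G1 * (U * S.st S.G4) := by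
    rw [T, L1, G1, G4, G]
    simp only [Matrix.mul_sub, Matrix.mul_assoc]
  have e2 : projR S.A11 * S.T U * projL (S.st S.A22) = S.L2 - S.G2 * (U * S.st S.G3) := by
    rw [T, L2, G2, G3, st_mul hη, ← st_projR hη]
    simp only [Matrix.mul_sub, Matrix.sub_mul, Matrix.mul_assoc]
  have e3 : projR S.A22 * (S.T U * projL (S.st S.A11)) = S.L3 - S.G3 * (U * S.st S.G2) := by
    rw [T, L3, G2, G3, st_mul hη, ← st_projR hη]
    simp only [Matrix.mul_sub, Matrix.sub_mul, Matrix.mul_assoc]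
  have e4 : S.T U * projL (S.st S.A11) * projL (S.st S.M1) = S.L4 - S.G4 * (U * S.st S.G1) := by
    rw [T, L4, G1, G4, st_mul hη, G, st_mul hη, ← st_projR hη, ← st_projR hη]
    simp only [Matrix.sub_mul, Matrix.mul_assoc]
  constructor
  · rintro ⟨h1, h2, h3, h4⟩
    rw [e1] at h1
    rw [e4] at h2
    rw [e2] at h3
    rw [e3] at h4
    exact ⟨⟨(sub_eq_zero.1 h1).symm, (sub_eq_zero.1 h3).symm⟩, (sub_eq_zero.1 h4).symm,
      (sub_eq_zero.1 h2).symm⟩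
  · rintro ⟨⟨h1, h2⟩, h3, h4⟩
    constructor
    · rw [e1, h1, sub_self]
    · rw [e4, h4, sub_self]
    · rw [e2, h2, sub_self]
    · rw [e3, h3, sub_self]

theorem sum_of_solvable (P : EtaParams n₁ n₂ n₃) {U : Matrix (Fin n₃) (Fin n₃) ℍ[ℝ]}
    (h : TwoTermSolvable S.A11 (S.st S.A11) S.A22 (S.st S.A22) (S.T U) S.M1 (S.st S.M1)) :
    S.A11 * S.U1 P U * S.st S.A11 + S.A22 * S.U2 P U * S.st S.A22 + S.A33 * U * S.st S.A33
      = S.T1 := by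
  rw [U1_eq hη, U2_eq hη, mul_twoTermFst_mul_add h rfl (st_M1 hη) (show S.S1 = _ from rfl), T, sub_add_cancel]

end Sufficiency

end EtaSystem

/-! ### Hermitian parts of solutions. -/

namespace QMat

section Hermitian

variable {m n p : Type*} [Fintype m] [Fintype n] [Fintype p] [DecidableEq m] [DecidableEq n]
  {η : ℍ[ℝ]} {A C : Matrix m n ℍ[ℝ]} {X : Matrix n n ℍ[ℝ]}

theorem half_smul_add_self (A : Matrix m n ℍ[ℝ]) : (1 / 2 : ℝ) • (A + A) = A := by
  rw [← two_smul ℝ A, smul_smul]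
  norm_num

theorem half_isEtaHermitian (hη : IsBasicUnit η) (X : Matrix n n ℍ[ℝ]) :
    IsEtaHermitian η ((1 / 2 : ℝ) • (X + etaStar η X)) := by
  rw [IsEtaHermitian, etaStar_smul, etaStar_add, etaStar_etaStar hη, add_comm]

theorem IsEtaHermitian.compat (hη : IsBasicUnit η) (hX : IsEtaHermitian η X) (h : A * X = C) :
    A * etaStar η C = C * etaStar η A := by
  rw [← hX.mul_etaStar hη h, ← Matrix.mul_assoc, h]

theorem IsEtaHermitian.conj (hη : IsBasicUnit η) (hX : IsEtaHermitian η X)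
    (E : Matrix p n ℍ[ℝ]) : IsEtaHermitian η (E * X * etaStar η E) := by
  rw [IsEtaHermitian, etaStar_mul hη, etaStar_mul hη, etaStar_etaStar hη, ← hX, Matrix.mul_assoc]

theorem IsEtaHermitian.sub {Y : Matrix n n ℍ[ℝ]} (hX : IsEtaHermitian η X)
    (hY : IsEtaHermitian η Y) : IsEtaHermitian η (X - Y) := by
  rw [IsEtaHermitian, etaStar_sub, ← hX, ← hY]

/-- The Hermitian part of `X₀ + L_A U L_A^{η*}` solves `A X = C` when `X₀` does. -/
theorem mul_half_add (hη : IsBasicUnit η) (hX : IsEtaHermitian η X) (h : A * X = C)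
    {X' U : Matrix n n ℍ[ℝ]} (hX' : X' = X + projL A * U * etaStar η (projL A)) :
    A * ((1 / 2 : ℝ) • (X' + etaStar η X')) = C := by
  have e1 : A * X' = C := by
    rw [hX', Matrix.mul_add, h, Matrix.mul_assoc, mul_reassoc (mul_projL A), Matrix.zero_mul,
      add_zero]
  have e2 : A * etaStar η X' = C := by
    rw [hX', etaStar_add, ← hX, etaStar_mul hη, etaStar_mul hη, etaStar_etaStar hη,
      Matrix.mul_add, h, mul_reassoc (mul_projL A), Matrix.zero_mul, add_zero]
  rw [Matrix.mul_smul, Matrix.mul_add, e1, e2, half_smul_add_self]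

theorem conj_half_add (hη : IsBasicUnit η) (E : Matrix p n ℍ[ℝ]) (X : Matrix n n ℍ[ℝ]) :
    E * ((1 / 2 : ℝ) • (X + etaStar η X)) * etaStar η E =
      (1 / 2 : ℝ) • (E * X * etaStar η E + etaStar η (E * X * etaStar η E)) := by
  rw [Matrix.mul_smul, Matrix.smul_mul, Matrix.mul_add, Matrix.add_mul, etaStar_mul hη,
    etaStar_mul hη, etaStar_etaStar hη, Matrix.mul_assoc E (etaStar η X)]

/-- The difference of two Hermitian solutions of `A X = C`. -/
theorem projL_mul_sub_mul (hη : IsBasicUnit η) {Y : Matrix n n ℍ[ℝ]} (hX : IsEtaHermitian η X)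
    (hY : IsEtaHermitian η Y) (h : A * X = C) (h' : A * Y = C) :
    projL A * (X - Y) * etaStar η (projL A) = X - Y := by
  have e : projL A * (X - Y) = X - Y := eq_projL_mul (by rw [Matrix.mul_sub, h, h', sub_self])
  have e' := congrArg (etaStar η) e
  rw [etaStar_mul hη, ← hX.sub hY] at e'
  rw [e, e']

end Hermitian

end QMat

/-! ### The implications between the criteria and completeness of the formulas. -/

namespace EtaSystem

open QMat

variable {m₁ m₂ m₃ n₁ n₂ n₃ p : ℕ} {S : EtaSystem m₁ m₂ m₃ n₁ n₂ n₃ p}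
  {X : Matrix (Fin n₁) (Fin n₁) ℍ[ℝ]} {Y : Matrix (Fin n₂) (Fin n₂) ℍ[ℝ]}
  {Z : Matrix (Fin n₃) (Fin n₃) ℍ[ℝ]}

/-- The particular solutions `X₀, Y₀, Z₀` of `A₁X = C₁`, `A₂Y = C₂`, `A₃Z = C₃`. -/
structure Particular (S : EtaSystem m₁ m₂ m₃ n₁ n₂ n₃ p) : Prop where
  mulX : S.A₁ * S.X0 = S.C₁
  mulY : S.A₂ * S.Y0 = S.C₂
  mulZ : S.A₃ * S.Z0 = S.C₃
  hermX : IsEtaHermitian S.η S.X0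
  hermY : IsEtaHermitian S.η S.Y0
  hermZ : IsEtaHermitian S.η S.Z0

theorem C_eq : S.C = S.T1 + S.E₁ * S.X0 * S.st S.E₁ + S.E₂ * S.Y0 * S.st S.E₂ +
    S.E₃ * S.Z0 * S.st S.E₃ := by
  rw [T1]; abel

section

variable (hη : IsBasicUnit S.η)

include hη

theorem particular (h : S.Compatible) (h1 : projR S.A₁ * S.C₁ = 0) (h2 : projR S.A₂ * S.C₂ = 0)
    (h3 : projR S.A₃ * S.C₃ = 0) : S.Particular where
  mulX := mul_particular h1
  mulY := mul_particular h2
  mulZ := mul_particular h3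
  hermX := particular_isEtaHermitian hη h.1
  hermY := particular_isEtaHermitian hη h.2.1
  hermZ := particular_isEtaHermitian hη h.2.2

theorem Particular.herm_T1 (h : S.Particular) (hC : IsEtaHermitian S.η S.C) :
    IsEtaHermitian S.η S.T1 :=
  ((hC.sub (h.hermX.conj hη _)).sub (h.hermY.conj hη _)).sub (h.hermZ.conj hη _)

theorem IsSolution.compatible (h : S.IsSolution X Y Z) : S.Compatible ∧
    projR S.A₁ * S.C₁ = 0 ∧ projR S.A₂ * S.C₂ = 0 ∧ projR S.A₃ * S.C₃ = 0 := by
  obtain ⟨hX, hXh, hY, hYh, hZ, hZh, -⟩ := h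
  exact ⟨⟨hXh.compat hη hX, hYh.compat hη hY, hZh.compat hη hZ⟩,
    projR_mul_eq_zero_iff.2 ⟨X, hX.symm⟩, projR_mul_eq_zero_iff.2 ⟨Y, hY.symm⟩,
    projR_mul_eq_zero_iff.2 ⟨Z, hZ.symm⟩⟩

/-- For an actual solution the residual vanishes, so each criterion is met by zero matrices. The
third rank equality is the second with the indices 1 and 2 exchanged. -/
theorem IsSolution.rankCondition (h : S.IsSolution X Y Z) : S.RankCondition := by
  obtain ⟨hc, h1, h2, h3⟩ := h.compatible hη
  obtain ⟨hX, hXh, hY, hYh, hZ, hZh, hs⟩ := h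
  have hT : S.C = 0 + S.E₁ * X * etaStar S.η S.E₁ + S.E₂ * Y * etaStar S.η S.E₂ +
      S.E₃ * Z * etaStar S.η S.E₃ := by rw [zero_add]; exact hs.symm
  have hT' : S.C = 0 + S.E₂ * Y * etaStar S.η S.E₂ + S.E₁ * X * etaStar S.η S.E₁ +
      S.E₃ * Z * etaStar S.η S.E₃ := by rw [hT]; abel
  refine ⟨hc, qrank_fromCols_eq_iff_projR.2 h1, qrank_fromCols_eq_iff_projR.2 h2,
    qrank_fromCols_eq_iff_projR.2 h3, ?_, ?_, ?_, ?_, ?_⟩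
  · refine (qrank_column_iff hX hY hZ hT).2 ⟨0, ?_⟩
    rw [Matrix.mul_zero]
    simp only [fromRows_zero]
  · refine (qrank_two_left_iff hη hX hY hYh hZ hT).2 ⟨0, 0, ?_⟩
    rw [Matrix.mul_zero, Matrix.zero_mul, add_zero]
    simp only [fromRows_zero, fromCols_zero]
  · refine (qrank_two_left_iff hη hY hX hXh hZ hT').2 ⟨0, 0, ?_⟩
    rw [Matrix.mul_zero, Matrix.zero_mul, add_zero]
    simp only [fromRows_zero, fromCols_zero]
  · refine (qrank_one_left_iff hη hX hXh hY hYh hZ hT).2 ⟨0, 0, ?_⟩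
    rw [Matrix.mul_zero, Matrix.zero_mul, add_zero]
    simp only [fromRows_zero, fromCols_zero]
  · refine (qrank_pair_iff hη hX hXh hY hYh hZ hZh hT).2 ⟨0, 0, ?_⟩
    rw [Matrix.mul_zero, Matrix.zero_mul, add_zero]
    simp only [fromRows_zero, fromCols_zero, neg_zero]

theorem RankCondition.projectorCondition (hC : IsEtaHermitian S.η S.C) (h : S.RankCondition) :
    S.ProjectorCondition := by
  obtain ⟨hc, h1, h2, h3, r1, r2, r3, r4, r5⟩ := h
  rw [qrank_fromCols_eq_iff_projR] at h1 h2 h3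
  have hp := particular hη hc h1 h2 h3
  have hT : S.C = S.T1 + S.E₂ * S.Y0 * etaStar S.η S.E₂ + S.E₁ * S.X0 * etaStar S.η S.E₁ +
      S.E₃ * S.Z0 * etaStar S.η S.E₃ := by rw [add_right_comm S.T1]; exact C_eq
  have hG1 : projR S.G1 * S.G * S.A33 = 0 := by rw [Matrix.mul_assoc]; exact projR_mul S.G1
  have hG2 : projR S.G2 * projR S.A11 * S.A33 = 0 := by
    rw [Matrix.mul_assoc]; exact projR_mul S.G2
  have hG3 : projR S.G3 * projR S.A22 * S.A33 = 0 := by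
    rw [Matrix.mul_assoc]; exact projR_mul S.G3
  have c1 : projR S.G1 * S.L1 = 0 := by
    rw [L1, ← Matrix.mul_assoc]
    refine mul_eq_zero_of_qrank_column hp.mulX hp.mulY hp.mulZ C_eq r1 ?_ ?_ hG1
    · rw [Matrix.mul_assoc, ← A11, G_mul_A11, Matrix.mul_zero]
    · rw [Matrix.mul_assoc, ← A22, G_mul_A22, Matrix.mul_zero]
  have c2 : projR S.G2 * S.L2 = 0 := by
    rw [L2, Matrix.mul_assoc, ← Matrix.mul_assoc]
    refine mul_mul_eq_zero_of_qrank_two_left hη hp.mulX hp.mulY hp.hermY hp.mulZ C_eq r2 ?_ hG2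
      (projR_mul S.A22)
    rw [Matrix.mul_assoc, ← A11, projR_mul, Matrix.mul_zero]
  have c3 : projR S.G3 * S.L3 = 0 := by
    rw [L3, Matrix.mul_assoc, ← Matrix.mul_assoc]
    refine mul_mul_eq_zero_of_qrank_two_left hη hp.mulY hp.mulX hp.hermX hp.mulZ hT r3 ?_ hG3
      (projR_mul S.A11)
    rw [Matrix.mul_assoc, ← A22, projR_mul, Matrix.mul_zero]
  have c4 : projR S.G4 * S.L4 = 0 :=
    mul_mul_eq_zero_of_qrank_one_left hη hp.mulX hp.hermX hp.mulY hp.hermY hp.mulZ C_eq r4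
      (projR_mul S.A33) G_mul_A11 G_mul_A22
  have hpc : S.PairConditions := ⟨hp.herm_T1 hη hC, c1, c2, c3, c4⟩
  refine ⟨hc, h1, h2, h3, c1, c2, c3, c4, ?_⟩
  -- `K` kills both `L_{G₂}` and `L_{G₃}`, so it factors through `G₂` and through `G₃`. This makes
  -- `R₁ A₃₃ = K` and `R₂ A₃₃ = -K` below, as the coupled annihilators require.
  obtain ⟨K, hK⟩ : ∃ K, K = projR S.E22 * projR S.C11 := ⟨_, rfl⟩
  have k2 : K * (pinv S.G2 * S.G2) = K := mul_pinv_mul_of_projL (by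
    rw [hK, Matrix.mul_assoc, projR_C11_mul.1, Matrix.mul_zero])
  have k3 : K * (pinv S.G3 * S.G3) = K := mul_pinv_mul_of_projL (by rw [hK, projR_E22_mul])
  obtain ⟨R₁, hR₁⟩ : ∃ R₁, R₁ = K * pinv S.G2 * projR S.A11 := ⟨_, rfl⟩
  obtain ⟨R₂, hR₂⟩ : ∃ R₂, R₂ = -(K * pinv S.G3 * projR S.A22) := ⟨_, rfl⟩
  have a1 : R₁ * S.A11 = 0 := by rw [hR₁, Matrix.mul_assoc, projR_mul, Matrix.mul_zero]
  have a2 : R₂ * S.A22 = 0 := by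
    rw [hR₂, Matrix.neg_mul, Matrix.mul_assoc, projR_mul, Matrix.mul_zero, neg_zero]
  have a3 : (R₁ + R₂) * S.A33 = 0 := by
    have b1 : R₁ * S.A33 = K := by rw [hR₁, Matrix.mul_assoc, ← G2, Matrix.mul_assoc, k2]
    have b2 : R₂ * S.A33 = -K := by
      rw [hR₂, Matrix.neg_mul, Matrix.mul_assoc, ← G3, Matrix.mul_assoc, k3]
    rw [Matrix.add_mul, b1, b2, add_neg_cancel]
  -- On the right the roles of `R₁` and `R₂` are exchanged, giving `R₁T₁R₂^{η*} = R₂T₁R₁^{η*}`; up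
  -- to sign the two sides are `K F₁ K^{η*}` and `K F₂ K^{η*}`.
  have hR := mul_mul_eq_of_qrank_pair hη hp.mulX hp.hermX hp.mulY hp.hermY hp.mulZ hp.hermZ C_eq
    r5 a1 a2 a3 a2 a1 (by rw [add_comm]; exact a3)
  have k2' : S.st S.G2 * (S.st (pinv S.G2) * S.st K) = S.st K := by
    rw [← Matrix.mul_assoc, ← st_mul hη, ← st_mul hη, k2]
  have k3' : S.st S.G3 * (S.st (pinv S.G3) * S.st K) = S.st K := by
    rw [← Matrix.mul_assoc, ← st_mul hη, ← st_mul hη, k3]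
  have f1 : K * (S.F1 * S.st K) = -(R₁ * (S.T1 * S.st R₂)) := by
    have e := congrArg (fun J => J * (S.st (pinv S.G3) * S.st K)) (hpc.F1_spec hη).2
    simp only [Matrix.mul_assoc, k3'] at e
    conv_lhs => lhs; rw [← k2]
    rw [Matrix.mul_assoc, Matrix.mul_assoc, e, hR₁, hR₂, L2]
    simp only [st, etaStar_neg, etaStar_mul hη, Matrix.mul_neg, neg_neg, Matrix.mul_assoc]
  have f2 : K * (S.F2 * S.st K) = -(R₂ * (S.T1 * S.st R₁)) := by
    have e := congrArg (fun J => J * (S.st (pinv S.G2) * S.st K)) (hpc.F2_spec hη).1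
    simp only [Matrix.mul_assoc, k2'] at e
    conv_lhs => lhs; rw [← k3]
    rw [Matrix.mul_assoc, Matrix.mul_assoc, e, hR₁, hR₂, L3]
    simp only [st, etaStar_mul hη, Matrix.neg_mul, neg_neg, Matrix.mul_assoc]
  have e : projR S.E22 * S.E * S.st (projR S.E22) = K * (S.F * S.st K) := by
    rw [hK, st_mul hη, E]; simp only [Matrix.mul_assoc]
  rw [e, F, Matrix.sub_mul, Matrix.mul_sub, f1, f2, sub_eq_zero, neg_inj]
  exact hR.symm

theorem ProjectorCondition.pairConditions (hC : IsEtaHermitian S.η S.C)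
    (h : S.ProjectorCondition) : S.PairConditions := by
  obtain ⟨hc, h1, h2, h3, c1, c2, c3, c4, -⟩ := h
  exact ⟨(particular hη hc h1 h2 h3).herm_T1 hη hC, c1, c2, c3, c4⟩

theorem ProjectorCondition.isSolution (hC : IsEtaHermitian S.η S.C) (h : S.ProjectorCondition)
    {P : EtaParams n₁ n₂ n₃} (hP : S.IsGiven P (S.U3 P) X Y Z) : S.IsSolution X Y Z := by
  have hpc := h.pairConditions hη hC
  obtain ⟨hc, h1, h2, h3, -, -, -, -, h5⟩ := h
  have hp := particular hη hc h1 h2 h3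
  have hU := sum_of_solvable hη P ((T_solvable_iff hη _).2 (U3_spec hη hpc h5 P))
  generalize S.U3 P = U at hP hU
  obtain ⟨rfl, rfl, rfl⟩ := hP
  refine ⟨mul_half_add hη hp.hermX hp.mulX (U := S.U1 P U) rfl, half_isEtaHermitian hη _,
    mul_half_add hη hp.hermY hp.mulY (U := S.U2 P U) rfl, half_isEtaHermitian hη _,
    mul_half_add hη hp.hermZ hp.mulZ (U := U) rfl, half_isEtaHermitian hη _, ?_⟩
  have e : S.E₁ * S.Xt P U * S.st S.E₁ + S.E₂ * S.Yt P U * S.st S.E₂ +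
      S.E₃ * S.Zt U * S.st S.E₃ = S.C := by
    have e1 : S.Xt P U = S.X0 + projL S.A₁ * S.U1 P U * S.st (projL S.A₁) := rfl
    have e2 : S.Yt P U = S.Y0 + projL S.A₂ * S.U2 P U * S.st (projL S.A₂) := rfl
    have e3 : S.Zt U = S.Z0 + projL S.A₃ * U * S.st (projL S.A₃) := rfl
    rw [C_eq, ← hU, A11, A22, A33, st_mul hη, st_mul hη, st_mul hη, e1, e2, e3]
    simp only [Matrix.mul_add, Matrix.add_mul, Matrix.mul_assoc]
    abel
  rw [conj_half_add hη, conj_half_add hη, conj_half_add hη, ← smul_add, ← smul_add]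
  -- As `C` is η-Hermitian it is the average of itself and its η-star, matching the average of the
  -- equation for `X̃, Ỹ, Z̃` with its η-star.
  conv_rhs => rw [← half_smul_add_self S.C]; rhs; rhs; rw [hC]
  conv_rhs => rw [← e]
  rw [etaStar_add, etaStar_add]
  congr 1
  abel

/-- The deviations `D₁, D₂, D₃` from the particular solutions serve as `U₁, U₂, U₃`; the parameters
are recovered layer by layer from the completeness of the nested, Sylvester and two-term solutions.
-/
theorem IsSolution.exists_isGiven (hC : IsEtaHermitian S.η S.C) (h : S.IsSolution X Y Z) :
    ∃ P : EtaParams n₁ n₂ n₃, S.IsGiven P (S.U3 P) X Y Z := by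
  have hpc := ((h.rankCondition hη).projectorCondition hη hC).pairConditions hη hC
  obtain ⟨hc, h1, h2, h3⟩ := h.compatible hη
  have hp := particular hη hc h1 h2 h3
  obtain ⟨hX, hXh, hY, hYh, hZ, hZh, hs⟩ := h
  have d1 := projL_mul_sub_mul hη hXh hp.hermX hX hp.mulX
  have d2 := projL_mul_sub_mul hη hYh hp.hermY hY hp.mulY
  have d3 := projL_mul_sub_mul hη hZh hp.hermZ hZ hp.mulZ
  obtain ⟨D₁, hD₁⟩ : ∃ D₁, D₁ = X - S.X0 := ⟨_, rfl⟩
  obtain ⟨D₂, hD₂⟩ : ∃ D₂, D₂ = Y - S.Y0 := ⟨_, rfl⟩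
  obtain ⟨D₃, hD₃⟩ : ∃ D₃, D₃ = Z - S.Z0 := ⟨_, rfl⟩
  rw [← hD₁] at d1
  rw [← hD₂] at d2
  rw [← hD₃] at d3
  have t : S.A11 * D₁ * S.st S.A11 + S.A22 * D₂ * S.st S.A22 = S.T D₃ := by
    have a1 : S.A11 * D₁ * S.st S.A11 = S.E₁ * D₁ * S.st S.E₁ := by
      conv_rhs => rw [← d1]
      rw [A11, st_mul hη]; simp only [Matrix.mul_assoc]
    have a2 : S.A22 * D₂ * S.st S.A22 = S.E₂ * D₂ * S.st S.E₂ := by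
      conv_rhs => rw [← d2]
      rw [A22, st_mul hη]; simp only [Matrix.mul_assoc]
    have a3 : S.A33 * D₃ * S.st S.A33 = S.E₃ * D₃ * S.st S.E₃ := by
      conv_rhs => rw [← d3]
      rw [A33, st_mul hη]; simp only [Matrix.mul_assoc]
    rw [T, a1, a2, a3, T1, ← hs, hD₁, hD₂, hD₃]
    simp only [Matrix.mul_sub, Matrix.sub_mul]
    abel
  obtain ⟨⟨g1, g2⟩, g3, g4⟩ :=
    (T_solvable_iff hη D₃).1 (TwoTermSolvable.of_eq rfl (st_M1 hη) t)
  obtain ⟨f1, f2⟩ := hpc.F1_spec hη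
  obtain ⟨f3, f4⟩ := hpc.F2_spec hη
  obtain ⟨V₁, V₂, V₃, hV⟩ := exists_nested (H₃ := S.st S.G3) (H₄ := S.st S.G4) (U := D₃ - S.F1)
    (G1_eq (S := S)) (by rw [Matrix.sub_mul, Matrix.mul_sub, g1, f1, sub_self])
    (by rw [Matrix.sub_mul, Matrix.mul_sub, g2, f2, sub_self]) (by rw [G3_eq, st_mul hη])
  -- The difference is taken as `F₂ - D₃` because the second expression subtracts its free terms
  -- from `F₂`.
  obtain ⟨W₁, W₂, W₃, hW⟩ := exists_nested (H₃ := S.st S.G1) (H₄ := S.st S.G2) (U := S.F2 - D₃)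
    (G3_eq (S := S)) (by rw [Matrix.sub_mul, Matrix.mul_sub, g3, f3, sub_self])
    (by rw [Matrix.sub_mul, Matrix.mul_sub, g4, f4, sub_self]) (by rw [G1_eq, st_mul hη])
  have hQ : S.C11 * fromRows V₁ W₁ + fromCols W₂ V₂ * S.st S.C11 = S.F -
      projL S.G1 * V₃ * projR (S.st S.G3) - projL S.G3 * W₃ * projR (S.st S.G1) := by
    rw [C11_sylvester_expand hη, F]
    have e : S.F2 - S.F1 = (S.F2 - D₃) + (D₃ - S.F1) := by abel
    rw [e, hV, hW]
    abel
  have hE : S.E11 * V₃ * S.st S.E22 + S.E22 * W₃ * S.st S.E11 = S.E := by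
    -- Multiplying by `R_{C₁₁}` and `L_{C₁₁^{η*}}` eliminates the Sylvester unknowns and leaves the
    -- two-term equation for `V₃, W₃`.
    have e := congrArg (fun K => projR S.C11 * K * projL (S.st S.C11)) hQ
    simp only [Matrix.mul_add, Matrix.add_mul, Matrix.mul_sub, Matrix.sub_mul, Matrix.mul_assoc,
      mul_projL, Matrix.mul_zero, mul_reassoc (projR_mul S.C11), Matrix.zero_mul, add_zero] at e
    rw [E11, E22, E, st_mul hη, st_mul hη, C22, C33, st_projL hη, st_projL hη, st_projR hη]
    simp only [Matrix.mul_assoc]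
    rw [sub_sub, eq_comm, sub_eq_zero] at e
    exact e.symm
  obtain ⟨U₃₁, U₄₁, Z₄₂, U₃₂, U₃₃, hV₃, hW₃⟩ :=
    exists_twoTerm (M := S.M) rfl (N_eq hη) (show S.SM = _ from rfl) hE
  obtain ⟨U₁₁, U₁₂, U₂₁, hVW, hWV⟩ := exists_sylvester hQ
  obtain ⟨U₄, U₇, U₈, U₅, U₆, hU₁, hU₂⟩ :=
    exists_twoTerm (M := S.M1) rfl (st_M1 hη) (show S.S1 = _ from rfl) t
  -- The sign of the last entry compensates for `U₄₂` entering `W₃` with a minus.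
  obtain ⟨P, hP⟩ : ∃ P : EtaParams n₁ n₂ n₃, P = ⟨U₄, U₅, U₆, U₇, U₈, U₁₁, U₁₂, U₂₁, U₃₁, U₃₂,
    U₃₃, U₄₁, -Z₄₂⟩ := ⟨_, rfl⟩
  have hV₃' : S.V3 P = V₃ := by rw [V3_eq hη, ← hV₃, hP]
  have hW₃' : S.W3 P = W₃ := by rw [W3_eq hη, ← hW₃, hP, neg_neg]
  have hVW' := fromRows_V1_W1 (S := S) P
  have hWV' := fromCols_W2_V2 (S := S) P
  -- With `V₃, W₃` recovered, `Q` is the right side of `hQ`, for which `U₁₁, U₁₂, U₂₁` were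
  -- obtained.
  rw [Q_eq hη, hV₃', hW₃', hP] at hVW' hWV'
  rw [st_projL hη] at hWV'
  rw [hVW, ← hP, fromRows_ext_iff] at hVW'
  rw [hWV, ← hP, fromCols_ext_iff] at hWV'
  have hU₃ : S.U3 P = D₃ := by
    rw [U3, hVW'.1, hWV'.2, hV₃', add_assoc, add_assoc, ← add_assoc (projL S.G2 * _), ← hV,
      add_sub_cancel]
  have x1 : S.Xt P D₃ = X := by
    have e : S.Xt P D₃ = S.X0 + projL S.A₁ * S.U1 P D₃ * S.st (projL S.A₁) := rfl
    have e' : S.U1 P D₃ = D₁ := by rw [U1_eq hη, ← hU₁, hP]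
    rw [e, e', d1, hD₁, add_sub_cancel]
  have x2 : S.Yt P D₃ = Y := by
    have e : S.Yt P D₃ = S.Y0 + projL S.A₂ * S.U2 P D₃ * S.st (projL S.A₂) := rfl
    have e' : S.U2 P D₃ = D₂ := by rw [U2_eq hη, ← hU₂, hP]
    rw [e, e', d2, hD₂, add_sub_cancel]
  have x3 : S.Zt D₃ = Z := by
    have e : S.Zt D₃ = S.Z0 + projL S.A₃ * D₃ * S.st (projL S.A₃) := rfl
    rw [e, d3, hD₃, add_sub_cancel]
  refine ⟨P, ?_⟩
  rw [hU₃, IsGiven, x1, x2, x3]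
  have y1 : S.st X = X := hXh.symm
  have y2 : S.st Y = Y := hYh.symm
  have y3 : S.st Z = Z := hZh.symm
  -- `X̃, Ỹ, Z̃` are already `X, Y, Z`, and an η-Hermitian matrix is its own Hermitian part.
  rw [y1, y2, y3, half_smul_add_self, half_smul_add_self, half_smul_add_self]
  exact ⟨rfl, rfl, rfl⟩

end

end EtaSystem

theorem theorem4p2 {m₁ m₂ m₃ n₁ n₂ n₃ p : ℕ} (S : EtaSystem m₁ m₂ m₃ n₁ n₂ n₃ p)
    (hη : QMat.IsBasicUnit S.η) (hC : QMat.IsEtaHermitian S.η S.C) :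
    List.TFAE [S.Consistent, S.ProjectorCondition, S.RankCondition] ∧
    (S.Consistent → ∀ X Y Z,
      (S.IsSolution X Y Z ↔ ∃ P : EtaParams n₁ n₂ n₃, S.IsGiven P (S.U3 P) X Y Z) ∧
      (S.IsSolution X Y Z ↔ ∃ P : EtaParams n₁ n₂ n₃, S.IsGiven P (S.U3' P) X Y Z)) := by
  have h13 : S.Consistent → S.RankCondition := fun ⟨_, _, _, h⟩ => h.rankCondition hη
  have h32 : S.RankCondition → S.ProjectorCondition := fun h => h.projectorCondition hη hC
  constructor
  · tfae_have 1 → 3 := h13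
    tfae_have 3 → 2 := h32
    tfae_have 2 → 1 := fun h =>
      ⟨_, _, _, h.isSolution hη hC (P := ⟨0, 0, 0, 0, 0, 0, 0, 0, 0, 0, 0, 0, 0⟩) ⟨rfl, rfl, rfl⟩⟩
    tfae_finish
  · intro h X Y Z
    have hp := h32 (h13 h)
    have key : S.IsSolution X Y Z ↔ ∃ P : EtaParams n₁ n₂ n₃, S.IsGiven P (S.U3 P) X Y Z :=
      ⟨fun hs => hs.exists_isGiven hη hC, fun ⟨_, hP⟩ => hp.isSolution hη hC hP⟩
    refine ⟨key, key.trans (exists_congr fun P => ?_)⟩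
    rw [EtaSystem.U3_eq_U3' hη (hp.pairConditions hη hC) hp.2.2.2.2.2.2.2.2]
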